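/- Let $N\ge 1$, $E=\mathbb R^N$ with the Euclidean norm, $\gamma_0>0$, and let $(\Xi,\mathcal G,\mu)$ be a probability space. For every $\gamma\in(0,\gamma_0)$ let $P_\gamma$ be a Markov transition kernel on $E$, let $h_\gamma:\Xi\times E\to E$ be measurable, and let $H:\Xi\times E\rightrightarrows E$ be a set-valued map. For a set-valued map $G:\Xi\rightrightarrows E$, the selection integral is $\int G\,d\mu=\overline{\{\int\varphi\,d\mu:\ \varphi\in\mathcal L^1(\mu;E),\ \varphi(s)\in G(s)\ \mu\text{-a.e.}\}}$. Put $\mathsf H(x)=\int H(s,x)\,\mu(ds)$, and let $\Phi(a)\subset C(\mathbb R_+,E)$ be the set of (locally) absolutely continuous solutions on $\mathbb R_+$ of $\dot{\mathsf x}(t)\in\mathsf H(\mathsf x(t))$ for a.e. $t$, $\mathsf x(0)=a$. Distances to sets are $d(x,S)=\inf_{y\in S}\|x-y\|$, with $\inf\emptyset=+\infty$. **(RM)** (i) $\int\gamma^{-1}(y-x)\,P_\gamma(x,dy)=\int h_\gamma(s,x)\,\mu(ds)$ for all $x\in E$, $\gamma\in(0,\gamma_0)$; (ii) for $\mu$-a.e.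 $s$ and every sequence $(u_n,\gamma_n)$ in $E\times(0,\gamma_0)$ with $(u_n,\gamma_n)\to(u^\star,0)$, $d(h_{\gamma_n}(s,u_n),H(s,u^\star))\to0$; (iii) for $\mu$-a.e. $s$, $H(s,\cdot)$ is proper (not identically empty) and upper semicontinuous with closed convex values; (iv) for every $x$, $H(\cdot,x)$ has a $\mu$-integrable selection; (v) $\Phi(a)\ne\emptyset$ for every $a\in E$, and $\sup\{\|\mathsf x(t)\|: t\in[0,T],\ \mathsf x\in\Phi(a),\ a\in K\}<\infty$ for every $T>0$ and every compact $K\subset E$; (vi) for every compact $K\subset E$ there is $\epsilon_K>0$ such that $\sup_{x\in K}\sup_{0<\gamma<\gamma_0}\int\|\gamma^{-1}(y-x)\|^{1+\epsilon_K}P_\gamma(x,dy)<\infty$ and $\sup_{x\in K}\sup_{0<\gamma<\gamma_0}\int\|h_\gamma(s,x)\|^{1+\epsilon_K}\mu(ds)<\infty$. **(PH)** $V,\psi:E\to[0,\infty)$ are measurable, $\alpha:(0,\gamma_0)\to(0,\infty)$, $\beta:(0,\gamma_0)\to\mathbb R$, $\sup_\gamma\beta(\gamma)/\alpha(\gamma)<\infty$,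 $\psi(x)\to\infty$ as $\|x\|\to\infty$, and $P_\gamma V\le V-\alpha(\gamma)\psi+\beta(\gamma)$ for every $\gamma\in(0,\gamma_0)$. **(FL)** For every $s\in\Xi$ and $\gamma\in(0,\gamma_0)$, $h_\gamma(s,\cdot)$ is continuous. For $\mathsf x\in C(\mathbb R_+,E)$ let $\mathrm{aver}(\mathsf x)(t)=\frac1t\int_0^t\mathsf x(s)\,ds$ for $t>0$, $\mathrm{aver}(\mathsf x)(0)=\mathsf x(0)$; let $L_{\mathsf x}=\bigcap_{t\ge0}\overline{\mathsf x([t,\infty))}$ and $L_{\mathrm{aver}(\Phi)}=\bigcup_{a\in E}\bigcup_{\mathsf x\in\Phi(a)}L_{\mathrm{aver}(\mathsf x)}$, with convex hull $\mathrm{co}(L_{\mathrm{aver}(\Phi)})$. For a probability measure $\nu$ on $E$ let $\mathbb P^{\nu,\gamma}$ be the law on $E^{\mathbb N}$ of the homogeneous Markov chain $(X_n)$ with initial law $\nu$ and kernel $P_\gamma$, and let $\overline X_n=\frac1{n+1}\sum_{k=0}^nX_k$. **Theorem.** Assume (RM), (PH) and (FL), that $\Phi(E)=\bigcup_{a\in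 E}\Phi(a)$ is closed in $C(\mathbb R_+,E)$ for uniform convergence on compact sets, that $\nu(V)<\infty$, and that $\psi(a)/\|a\|\to\infty$ as $\|a\|\to\infty$. Then $\overline X_n$ is $\mathbb P^{\nu,\gamma}$-integrable for all $n\in\mathbb N$ and $\gamma\in(0,\gamma_0)$, and for every $\varepsilon>0$, $$\limsup_{n\to\infty}\,d\bigl(\mathbb E^{\nu,\gamma}(\overline X_n),\mathrm{co}(L_{\mathrm{aver}(\Phi)})\bigr)\xrightarrow[\gamma\to0]{}0,\qquad \limsup_{n\to\infty}\,\mathbb P^{\nu,\gamma}\bigl(d(\overline X_n,\mathrm{co}(L_{\mathrm{aver}(\Phi)}))\ge\varepsilon\bigr)\xrightarrow[\gamma\to0]{}0.$$ -/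

import Mathlib

open MeasureTheory ProbabilityTheory Filter Topology Set
open scoped NNReal ENNReal

noncomputable section

namespace StochApprox

/-! ### Differential inclusions and the averaged flow -/

section Flow

/-- A path `x : ℝ₊ → E` viewed as a function on `ℝ`, constant on the negative half-line. -/
def pathExt {E : Type*} [TopologicalSpace E] (x : C(ℝ≥0, E)) (t : ℝ) : E := x t.toNNReal

lemma continuous_pathExt {E : Type*} [TopologicalSpace E] (x : C(ℝ≥0, E)) : Continuous (pathExt x) :=
  x.continuous.comp continuous_real_toNNReal

variable {E : Type*} [NormedAddCommGroup E] [NormedSpace ℝ E]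

/-- `Φ_G a`: the set of solutions on `ℝ₊` of the differential inclusion `x'(t) ∈ G (x t)` started
from `a`, that is, of the paths which are absolutely continuous on every compact interval, start
from `a`, and satisfy the inclusion at almost every `t`. The space `C(ℝ≥0, E)` carries the
topology of uniform convergence on compact sets. -/
def solutions (G : E → Set E) (a : E) : Set C(ℝ≥0, E) :=
  {x | x 0 = a ∧
    (∀ T : ℝ, 0 < T → AbsolutelyContinuousOnInterval (pathExt x) 0 T) ∧
    ∀ᵐ t ∂(volume.restrict (Ioi (0 : ℝ))), ∃ v ∈ G (pathExt x t), HasDerivAt (pathExt x) v t}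

/-- The time average of a path. -/
def averFun (x : C(ℝ≥0, E)) (t : ℝ≥0) : E :=
  if t = 0 then x 0 else (t : ℝ)⁻¹ • ∫ s in (0 : ℝ)..t, pathExt x s

lemma averFun_eq [CompleteSpace E] (x : C(ℝ≥0, E)) (t : ℝ≥0) :
    averFun x t = ∫ u in (0 : ℝ)..1, pathExt x (t * u) := by
  unfold averFun
  split_ifs with h
  · subst h
    simp [pathExt]
  · have h' : (t : ℝ) ≠ 0 := by exact_mod_cast h
    rw [intervalIntegral.integral_comp_mul_left (fun s => pathExt x s) h']
    simp

lemma continuous_averFun [CompleteSpace E] (x : C(ℝ≥0, E)) : Continuous (averFun x) := by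
  have : averFun x = fun t : ℝ≥0 => ∫ u in (0 : ℝ)..1, pathExt x (t * u) :=
    funext (averFun_eq x)
  rw [this]
  apply intervalIntegral.continuous_parametric_intervalIntegral_of_continuous'
  exact (continuous_pathExt x).comp
    ((NNReal.continuous_coe.comp continuous_fst).mul continuous_snd)

/-- The map `aver : C(ℝ₊, E) → C(ℝ₊, E)`, `aver(x)(t) = t⁻¹ ∫₀ᵗ x(s) ds`, `aver(x)(0) = x(0)`. -/
def aver [CompleteSpace E] (x : C(ℝ≥0, E)) : C(ℝ≥0, E) := ⟨averFun x, continuous_averFun x⟩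

/-- The set-valued map `aver(Φ)`. -/
def averFlow [CompleteSpace E] (Φ : E → Set C(ℝ≥0, E)) (a : E) : Set C(ℝ≥0, E) := aver '' Φ a

/-- The limit set of a path. -/
def limitSet (x : C(ℝ≥0, E)) : Set E := ⋂ t : ℝ≥0, closure (x '' Ici t)

/-- The limit set `L_Φ` of a set-valued evolution system. -/
def flowLimitSet (Φ : E → Set C(ℝ≥0, E)) : Set E := ⋃ a, ⋃ x ∈ Φ a, limitSet x

end Flow

/-! ### The selection integral -/

section Selection

variable {Ξ : Type*} [MeasurableSpace Ξ] {E : Type*} [NormedAddCommGroup E] [NormedSpace ℝ E]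

/-- Integrable selections of a set-valued map. -/
def integrableSelections (μ : Measure Ξ) (G : Ξ → Set E) : Set (Ξ → E) :=
  {φ | Integrable φ μ ∧ ∀ᵐ s ∂μ, φ s ∈ G s}

/-- The selection integral: the closure of the set of integrals of integrable selections. -/
def selectionIntegral (μ : Measure Ξ) (G : Ξ → Set E) : Set E :=
  closure ((fun φ : Ξ → E => ∫ s, φ s ∂μ) '' integrableSelections μ G)

end Selection

/-! ### The Markov chain -/

/-- The law on `E^ℕ` of the homogeneous Markov chain with initial law `ν` and transition
kernel `P`. -/
def chainLaw {E : Type*} [MeasurableSpace E] (ν : Measure E) (P : Kernel E E)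
    [IsMarkovKernel P] : Measure (ℕ → E) :=
  Kernel.trajMeasure (X := fun _ => E) ν
    (fun n => P.comap (fun x => x ⟨n, Finset.mem_Iic.2 le_rfl⟩) (measurable_pi_apply _))

/-- The Cesàro mean `(n + 1)⁻¹ ∑_{k ≤ n} x_k`. -/
def cesaro {E : Type*} [AddCommGroup E] [Module ℝ E] (n : ℕ) (x : ℕ → E) : E :=
  ((n : ℝ) + 1)⁻¹ • ∑ k ∈ Finset.range (n + 1), x k

/-! ### Assumptions -/

section Assumptions

variable {N : ℕ} {Ξ : Type*} [MeasurableSpace Ξ] {γ₀ : ℝ}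

/-- Assumption (RM). The distance to the empty set is `∞`. -/
structure RM (μ : Measure Ξ)
    (P : Ioo (0 : ℝ) γ₀ → Kernel (EuclideanSpace ℝ (Fin N)) (EuclideanSpace ℝ (Fin N)))
    (h : Ioo (0 : ℝ) γ₀ → Ξ → EuclideanSpace ℝ (Fin N) → EuclideanSpace ℝ (Fin N))
    (H : Ξ → EuclideanSpace ℝ (Fin N) → Set (EuclideanSpace ℝ (Fin N))) : Prop where
  measurable_h : ∀ γ, Measurable (fun p : Ξ × EuclideanSpace ℝ (Fin N) => h γ p.1 p.2)
  drift : ∀ γ x, ∫ y, (γ : ℝ)⁻¹ • (y - x) ∂(P γ x) = ∫ s, h γ s x ∂μ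
  tendsto_h : ∀ᵐ s ∂μ, ∀ (u : ℕ → EuclideanSpace ℝ (Fin N)) (γ : ℕ → Ioo (0 : ℝ) γ₀)
    (u' : EuclideanSpace ℝ (Fin N)),
    Tendsto u atTop (𝓝 u') → Tendsto (fun n => (γ n : ℝ)) atTop (𝓝 0) →
      Tendsto (fun n => Metric.infEDist (h (γ n) s (u n)) (H s u')) atTop (𝓝 0)
  proper : ∀ᵐ s ∂μ, ∃ x, (H s x).Nonempty
  usc : ∀ᵐ s ∂μ, UpperHemicontinuous (H s)
  closed_convex : ∀ᵐ s ∂μ, ∀ x, IsClosed (H s x) ∧ Convex ℝ (H s x)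
  integrable_H : ∀ x, (integrableSelections μ (fun s => H s x)).Nonempty
  solutions_nonempty : ∀ a, (solutions (fun x => selectionIntegral μ (fun s => H s x)) a).Nonempty
  solutions_bounded : ∀ T : ℝ≥0, 0 < T → ∀ K : Set (EuclideanSpace ℝ (Fin N)), IsCompact K →
    ∃ C : ℝ, ∀ a ∈ K, ∀ x ∈ solutions (fun x => selectionIntegral μ (fun s => H s x)) a,
      ∀ t ≤ T, ‖x t‖ ≤ C
  moments : ∀ K : Set (EuclideanSpace ℝ (Fin N)), IsCompact K → ∃ ε : ℝ, 0 < ε ∧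
    (⨆ x ∈ K, ⨆ γ : Ioo (0 : ℝ) γ₀, ∫⁻ y, ‖(γ : ℝ)⁻¹ • (y - x)‖ₑ ^ (1 + ε) ∂(P γ x)) < ∞ ∧
    (⨆ x ∈ K, ⨆ γ : Ioo (0 : ℝ) γ₀, ∫⁻ s, ‖h γ s x‖ₑ ^ (1 + ε) ∂μ) < ∞

/-- Assumption (PH), the Pakes-Has'minskii criterion. -/
structure PH
    (P : Ioo (0 : ℝ) γ₀ → Kernel (EuclideanSpace ℝ (Fin N)) (EuclideanSpace ℝ (Fin N)))
    (V ψ : EuclideanSpace ℝ (Fin N) → ℝ) (α β : Ioo (0 : ℝ) γ₀ → ℝ) : Prop where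
  measurable_V : Measurable V
  measurable_psi : Measurable ψ
  V_nonneg : ∀ x, 0 ≤ V x
  psi_nonneg : ∀ x, 0 ≤ ψ x
  alpha_pos : ∀ γ, 0 < α γ
  ratio_bounded : BddAbove (range fun γ => β γ / α γ)
  psi_tendsto : Tendsto ψ (Bornology.cobounded _) atTop
  lyapunov : ∀ γ x, Integrable V (P γ x) ∧ ∫ y, V y ∂(P γ x) ≤ V x - α γ * ψ x + β γ

/-- Assumption (FL). -/
def FL (h : Ioo (0 : ℝ) γ₀ → Ξ → EuclideanSpace ℝ (Fin N) → EuclideanSpace ℝ (Fin N)) : Prop :=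
  ∀ s γ, Continuous (h γ s)

end Assumptions

end StochApprox

end

open StochApprox

namespace StochApprox

/-! ### Convex combinations in Hilbert spaces and truncation. -/

section ConvexCombinations

/-! The argument is by contradiction: averages that stay away from the limit set produce a single
solution of the inclusion whose time averages accumulate at a forbidden point. It is run for an
arbitrary convex 1-Lipschitz cost `d ≥ 0` vanishing on the limit set of the averaged flow
(`RM.eventually_lintegral_cesaro_lt`). The distance to the convex hull is such a cost; Jensen's
inequality then yields the claim on expectations and Markov's inequality the claim on probabilities.

Suppose the mean cost of the Cesàro means is at least `δ` along `γ_j → 0` and `n_j` with `γ_j n_j →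
∞`. Let `Q_j` be the average of the laws of the chain shifted by `0, …, n_j`. It is almost shift
invariant, and the Lyapunov inequality together with the superlinear growth of `ψ` makes the
coordinates up to time `n_j` uniformly integrable under it. Up to boundary terms a Cesàro mean is an
average of averages over blocks of `a⌈1/γ_j⌉` steps, that is, of duration about `a` in the time of
the inclusion. By convexity of `d` the mean cost of such block averages under `Q_j` stays bounded
below (`lintegral_cesaro_le`); this is where the convex hull is needed.

A mean ergodic theorem for asymptotically stationary sequences
(`exists_forall_integral_norm_avg_sub_le`) shows that block averages of durations `a` and `b` are
`L¹`-close once both are large. Hence there are durations `a_0 < a_1 < …` and sample paths with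
bounded initial point, small deviation from the mean drift, consecutive block averages at
geometrically small distance, and cost at least `δ / 2` for the first one. Along a subsequence these
paths converge to a solution (`RM.exists_solution_tendsto_blockAvg`), whose time averages at `a_0,
a_1, …` form a Cauchy sequence. The limit lies in the limit set and has positive cost, a
contradiction.

The convergence to a solution rests on two devices. The drifts are only bounded in `L^{1+ε}`, so
forward convex combinations that converge in `L¹` are taken; closedness and convexity of the values
of `H` keep the limit in `H`. The moment bounds are only local, so paths are frozen on leaving a
time-dependent ball, chosen larger than every solution, and the limit is shown never to be stopped
(`RM.eventually_alive`). -/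

lemma parallelogram_midpoint {F : Type*} [NormedAddCommGroup F] [InnerProductSpace ℝ F] (x y : F) :
    ‖x - y‖ ^ 2 = 2 * ‖x‖ ^ 2 + 2 * ‖y‖ ^ 2 - 4 * ‖(2 : ℝ)⁻¹ • (x + y)‖ ^ 2 := by
  have h := parallelogram_law_with_norm ℝ x y
  rw [norm_smul, Real.norm_of_nonneg (by norm_num : (0 : ℝ) ≤ 2⁻¹)]
  nlinarith

/-- A bounded sequence in a Hilbert space has convergent forward convex combinations. -/
lemma exists_tendsto_convexHull_tail {F : Type*} [NormedAddCommGroup F] [InnerProductSpace ℝ F]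
    [CompleteSpace F] (f : ℕ → F) (C : ℝ) (hf : ∀ n, ‖f n‖ ≤ C) :
    ∃ (g : ℕ → F) (G : F), (∀ n, g n ∈ convexHull ℝ (f '' Ici n)) ∧ Tendsto g atTop (𝓝 G) := by
  set K : ℕ → Set F := fun n => convexHull ℝ (f '' Ici n) with hK
  have hKne : ∀ n, (norm '' K n).Nonempty := fun n =>
    ⟨‖f n‖, f n, subset_convexHull ℝ _ ⟨n, self_mem_Ici, rfl⟩, rfl⟩
  have hKbdd : ∀ n, BddBelow (norm '' K n) := fun n =>
    ⟨0, by rintro _ ⟨x, -, rfl⟩; exact norm_nonneg x⟩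
  have hKanti : ∀ m n, m ≤ n → K n ⊆ K m := fun m n hmn =>
    convexHull_mono (image_mono (Ici_subset_Ici.2 hmn))
  -- `d n` is the distance from the origin to the `n`-th tail hull. It increases to a finite limit,
  -- and near-minimisers form a Cauchy sequence by the parallelogram identity, since their midpoints
  -- remain in an earlier hull and so cannot be much shorter.
  set d : ℕ → ℝ := fun n => sInf (norm '' K n) with hd
  have hd0 : ∀ n, 0 ≤ d n := fun n =>
    Real.sInf_nonneg (by rintro _ ⟨x, -, rfl⟩; exact norm_nonneg x)
  have hdC : ∀ n, d n ≤ C := fun n =>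
    (csInf_le (hKbdd n) ⟨f n, subset_convexHull ℝ _ ⟨n, self_mem_Ici, rfl⟩, rfl⟩).trans (hf n)
  have hdmono : Monotone d := fun m n hmn =>
    csInf_le_csInf (hKbdd m) (hKne n) (image_mono (hKanti m n hmn))
  have hdbdd : BddAbove (range d) := ⟨C, by rintro _ ⟨n, rfl⟩; exact hdC n⟩
  have hdlim := tendsto_atTop_ciSup hdmono hdbdd
  set D := ⨆ n, d n
  have hdD : ∀ n, d n ≤ D := fun n => le_ciSup hdbdd n
  have hex : ∀ n : ℕ, ∃ g ∈ K n, ‖g‖ < d n + 1 / ((n : ℝ) + 1) := by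
    intro n
    obtain ⟨_, ⟨g, hg, rfl⟩, hlt⟩ := exists_lt_of_csInf_lt (hKne n)
      (show sInf (norm '' K n) < d n + 1 / ((n : ℝ) + 1) by
        have : (0 : ℝ) < 1 / ((n : ℝ) + 1) := by positivity
        linarith)
    exact ⟨g, hg, hlt⟩
  choose g hgK hgn using hex
  have hb : Tendsto (fun n : ℕ => Real.sqrt (4 * ((D + 1 / ((n : ℝ) + 1)) ^ 2 - d n ^ 2))) atTop
      (𝓝 0) := by
    have h1 : Tendsto (fun n : ℕ => 4 * ((D + 1 / ((n : ℝ) + 1)) ^ 2 - d n ^ 2)) atTop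
        (𝓝 (4 * ((D + 0) ^ 2 - D ^ 2))) :=
      (((tendsto_one_div_add_atTop_nhds_zero_nat.const_add D).pow 2).sub (hdlim.pow 2)).const_mul 4
    have := h1.sqrt
    simpa using this
  have hcau : CauchySeq g := by
    refine cauchySeq_of_le_tendsto_0 _ (fun n m N hn hm => ?_) hb
    rw [dist_eq_norm]
    apply Real.le_sqrt_of_sq_le
    rw [parallelogram_midpoint]
    have hbound : ∀ k, N ≤ k → ‖g k‖ ≤ D + 1 / ((N : ℝ) + 1) := fun k hk => by
      have h1 : 1 / ((k : ℝ) + 1) ≤ 1 / ((N : ℝ) + 1) := by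
        apply one_div_le_one_div_of_le (by positivity)
        have : (N : ℝ) ≤ k := by exact_mod_cast hk
        linarith
      linarith [hgn k, hdD k]
    have hmid : d N ≤ ‖(2 : ℝ)⁻¹ • (g n + g m)‖ := by
      apply csInf_le (hKbdd N)
      refine ⟨_, ?_, rfl⟩
      rw [smul_add]
      exact convex_convexHull ℝ _ (hKanti _ _ hn (hgK n)) (hKanti _ _ hm (hgK m))
        (by norm_num) (by norm_num) (by norm_num)
    have e1 := pow_le_pow_left₀ (norm_nonneg _) (hbound n hn) 2
    have e2 := pow_le_pow_left₀ (norm_nonneg _) (hbound m hm) 2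
    have e3 := pow_le_pow_left₀ (hd0 N) hmid 2
    linarith
  obtain ⟨G, hG⟩ := cauchySeq_tendsto_of_complete hcau
  exact ⟨g, G, hgK, hG⟩

/-- Truncation at radius `L`. -/
noncomputable def trunc {E : Type*} [NormedAddCommGroup E] (L : ℝ) (x : E) : E :=
  open Classical in if ‖x‖ ≤ L then x else 0

section Trunc
variable {E : Type*} [NormedAddCommGroup E]

lemma norm_trunc_le {L : ℝ} (hL : 0 ≤ L) (x : E) : ‖trunc L x‖ ≤ L := by
  unfold trunc; split_ifs with h
  · exact h
  · simpa using hL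

lemma measurable_trunc [MeasurableSpace E] [OpensMeasurableSpace E] (L : ℝ) :
    Measurable (trunc L : E → E) := by
  classical
  unfold trunc
  exact Measurable.ite (measurableSet_le measurable_norm measurable_const) measurable_id
    measurable_const

lemma stronglyMeasurable_trunc_comp {Ω : Type*} [MeasurableSpace Ω] {v : Ω → E}
    (hv : StronglyMeasurable v) (L : ℝ) : StronglyMeasurable (fun ω => trunc L (v ω)) := by
  classical
  unfold trunc
  exact StronglyMeasurable.ite (measurableSet_le hv.norm.measurable measurable_const) hv
    stronglyMeasurable_const

/-- The tail left by the truncation is controlled by a moment of order `1 + ε`. -/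
lemma enorm_sub_trunc_le {L ε : ℝ} (hL : 0 < L) (hε : 0 < ε) (x : E) :
    ‖x - trunc L x‖ₑ ≤ ENNReal.ofReal (L ^ (-ε)) * ‖x‖ₑ ^ (1 + ε) := by
  unfold trunc
  split_ifs with h
  · simp
  · push Not at h
    have hx : 0 < ‖x‖ := hL.trans h
    rw [sub_zero, ← ofReal_norm, ENNReal.ofReal_rpow_of_pos hx,
      ← ENNReal.ofReal_mul (by positivity)]
    apply ENNReal.ofReal_le_ofReal
    rw [Real.rpow_add hx, Real.rpow_one, Real.rpow_neg hL.le]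
    have h1 : L ^ ε ≤ ‖x‖ ^ ε := Real.rpow_le_rpow hL.le h.le hε.le
    have h2 : 0 < L ^ ε := Real.rpow_pos_of_pos hL ε
    rw [inv_mul_eq_div, le_div_iff₀ h2]
    exact mul_le_mul_of_nonneg_left h1 hx.le

end Trunc

end ConvexCombinations

/-! ### Komlós-type compactness for sequences bounded in `L^{1+ε}`. -/

section ConvexCombinationsL1

variable {Ω : Type*} [MeasurableSpace Ω] {E : Type*} [NormedAddCommGroup E] [InnerProductSpace ℝ E]

lemma integrable_of_lintegral_rpow_le {F : Type*} [NormedAddCommGroup F] (m : Measure Ω)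
    [IsFiniteMeasure m] {v : Ω → F} (hv : AEStronglyMeasurable v m) {ε : ℝ} (hε : 0 < ε)
    (hM : ∫⁻ ω, ‖v ω‖ₑ ^ (1 + ε) ∂m < ∞) : Integrable v m := by
  refine ⟨hv, ?_⟩
  have h1 : ∀ ω, ‖v ω‖ₑ ≤ 1 + ‖v ω‖ₑ ^ (1 + ε) := fun ω => by
    rcases le_total ‖v ω‖ₑ 1 with h | h
    · exact h.trans le_self_add
    · calc ‖v ω‖ₑ = ‖v ω‖ₑ ^ (1 : ℝ) := (ENNReal.rpow_one _).symm
        _ ≤ ‖v ω‖ₑ ^ (1 + ε) := ENNReal.rpow_le_rpow_of_exponent_le h (by linarith)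
        _ ≤ _ := le_add_self
  calc ∫⁻ ω, ‖v ω‖ₑ ∂m ≤ ∫⁻ ω, (1 + ‖v ω‖ₑ ^ (1 + ε)) ∂m := lintegral_mono h1
    _ = m univ + ∫⁻ ω, ‖v ω‖ₑ ^ (1 + ε) ∂m := by
        rw [lintegral_add_left measurable_const]; simp
    _ < ∞ := ENNReal.add_lt_top.2 ⟨measure_lt_top _ _, hM⟩

/-- Convexity of this set of pairs lets an `L¹` estimate between a function and its Hilbert space
surrogate pass to convex combinations, provided both components use the same coefficients. -/
lemma convex_eLpNorm_sub_le (m : Measure Ω) {F : Type*} [NormedAddCommGroup F] [NormedSpace ℝ F]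
    (T : F →ₗ[ℝ] Lp E 2 m) (c : ℝ≥0∞) :
    Convex ℝ {p : F × (Ω → E) | Integrable p.2 m ∧ eLpNorm (p.2 - ⇑(T p.1)) 1 m ≤ c} := by
  rintro ⟨W, V⟩ ⟨hV, hVc⟩ ⟨W', V'⟩ ⟨hV', hVc'⟩ a b ha hb hab
  refine ⟨(hV.smul a).add (hV'.smul b), ?_⟩
  have hsm : ∀ (W : F) (V : Ω → E), Integrable V m → AEStronglyMeasurable (V - ⇑(T W)) m :=
    fun W V hV => hV.1.sub (Lp.memLp _).1
  have hae : ((a • V + b • V') - ⇑(T (a • W + b • W')) : Ω → E) =ᵐ[m]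
      a • (V - ⇑(T W)) + b • (V' - ⇑(T W')) := by
    rw [map_add, map_smul, map_smul]
    filter_upwards [Lp.coeFn_add (a • T W) (b • T W'), Lp.coeFn_smul a (T W),
      Lp.coeFn_smul b (T W')] with ω h1 h2 h3
    simp only [Pi.sub_apply, Pi.add_apply, Pi.smul_apply] at *
    rw [h1, h2, h3]
    simp only [smul_sub]; abel
  have hn : ∀ a : ℝ, 0 ≤ a → ‖a‖ₑ = ENNReal.ofReal a := fun a ha => by
    rw [← ofReal_norm, Real.norm_of_nonneg ha]
  calc eLpNorm ((a • V + b • V') - ⇑(T (a • W + b • W')) : Ω → E) 1 m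
      = eLpNorm (a • (V - ⇑(T W)) + b • (V' - ⇑(T W'))) 1 m := eLpNorm_congr_ae hae
    _ ≤ eLpNorm (a • (V - ⇑(T W))) 1 m + eLpNorm (b • (V' - ⇑(T W'))) 1 m :=
        eLpNorm_add_le ((hsm W V hV).const_smul a) ((hsm W' V' hV').const_smul b) le_rfl
    _ ≤ ENNReal.ofReal a * c + ENNReal.ofReal b * c := by
        rw [eLpNorm_const_smul, eLpNorm_const_smul, hn a ha, hn b hb]
        gcongr
    _ = c := by rw [← add_mul, ← ENNReal.ofReal_add ha hb, hab, ENNReal.ofReal_one, one_mul]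

/-- Elements of `ℓ²(L²)` recording all the truncations of a random variable. -/
lemma exists_lp_trunc (m : Measure Ω) [IsFiniteMeasure m] :
    ∃ c : ℕ → ℝ, (∀ L, 0 < c L) ∧ ∀ v : Ω → E, StronglyMeasurable v →
      ∃ w : lp (fun _ : ℕ => Lp E 2 m) 2, ‖w‖ ≤ 2 ∧
        ∀ L : ℕ, ((c L)⁻¹ • w L : Lp E 2 m) =ᵐ[m] fun ω => trunc ((L : ℝ) + 1) (v ω) := by
  set A : ℝ := ((m univ) ^ (1 / (2 : ℝ))).toReal with hA
  have hA0 : 0 ≤ A := ENNReal.toReal_nonneg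
  have hden : ∀ L : ℕ, 0 < A * ((L : ℝ) + 1) + 1 := fun L => by positivity
  -- The `L²` norm of the `L`-th truncation is at most `A * (L + 1)`, so these weights make the
  -- squared norms summable. One Hilbert vector thus carries all truncation levels, and no diagonal
  -- extraction over `L` is required.
  refine ⟨fun L => (1 / 2) ^ L / (A * ((L : ℝ) + 1) + 1), fun L => div_pos (by positivity) (hden L),
    fun v hv => ?_⟩
  have hmem : ∀ L : ℕ, MemLp (fun ω => trunc ((L : ℝ) + 1) (v ω)) 2 m := fun L =>
    MemLp.of_bound (stronglyMeasurable_trunc_comp hv _).aestronglyMeasurable ((L : ℝ) + 1)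
      (Eventually.of_forall fun ω => norm_trunc_le (by positivity) _)
  have hnorm : ∀ L : ℕ, ‖(hmem L).toLp‖ ≤ A * ((L : ℝ) + 1) := fun L => by
    rw [Lp.norm_toLp]
    have h1 := eLpNorm_le_of_ae_bound (p := 2) (μ := m)
      (f := fun ω => trunc ((L : ℝ) + 1) (v ω)) (C := (L : ℝ) + 1)
      (Eventually.of_forall fun ω => norm_trunc_le (by positivity) _)
    refine (ENNReal.toReal_mono (ENNReal.mul_ne_top ?_ ENNReal.ofReal_ne_top) h1).trans ?_
    · exact ENNReal.rpow_ne_top_of_nonneg (by norm_num) (measure_ne_top _ _)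
    · rw [ENNReal.toReal_mul, ENNReal.toReal_ofReal (by positivity)]
      simp [hA]
  set w₀ : ℕ → Lp E 2 m := fun L => ((1 / 2) ^ L / (A * ((L : ℝ) + 1) + 1)) • (hmem L).toLp with hw₀
  have hw₀n : ∀ L, ‖w₀ L‖ ≤ (1 / 2) ^ L := fun L => by
    rw [hw₀]
    simp only [norm_smul]
    rw [Real.norm_of_nonneg (div_pos (by positivity) (hden L)).le, div_mul_eq_mul_div,
      div_le_iff₀ (hden L)]
    exact mul_le_mul_of_nonneg_left ((hnorm L).trans (by linarith)) (by positivity)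
  have hsq : ∀ L, ‖w₀ L‖ ^ (2 : ℝ≥0∞).toReal ≤ (1 / 2) ^ L := fun L => by
    have h1 : (1 / 2 : ℝ) ^ L ≤ 1 := pow_le_one₀ (by norm_num) (by norm_num)
    have : (2 : ℝ≥0∞).toReal = ((2 : ℕ) : ℝ) := by simp
    rw [this, Real.rpow_natCast]
    nlinarith [hw₀n L, norm_nonneg (w₀ L)]
  have hsum : Summable fun L => ‖w₀ L‖ ^ (2 : ℝ≥0∞).toReal :=
    Summable.of_nonneg_of_le (fun L => by positivity) hsq
      (summable_geometric_of_lt_one (by norm_num) (by norm_num))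
  refine ⟨⟨w₀, memℓp_gen hsum⟩, ?_, fun L => ?_⟩
  · apply lp.norm_le_of_tsum_le (by norm_num) (by norm_num)
    have h2 : ∑' L, ‖w₀ L‖ ^ (2 : ℝ≥0∞).toReal ≤ 2 := by
      refine (hsum.tsum_le_tsum hsq
        (summable_geometric_of_lt_one (by norm_num) (by norm_num))).trans ?_
      rw [tsum_geometric_of_lt_one (by norm_num) (by norm_num)]; norm_num
    refine h2.trans ?_
    have : (2 : ℝ≥0∞).toReal = ((2 : ℕ) : ℝ) := by simp
    rw [this, Real.rpow_natCast]; norm_num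
  · have : ((1 / 2) ^ L / (A * ((L : ℝ) + 1) + 1))⁻¹ • w₀ L = (hmem L).toLp := by
      rw [hw₀]
      simp only
      rw [smul_smul, inv_mul_cancel₀ (div_pos (by positivity) (hden L)).ne', one_smul]
    simp only [this]
    exact (hmem L).coeFn_toLp

/-- A sequence bounded in `L^{1+ε}` of a finite measure has forward convex combinations which
converge in `L¹` and almost everywhere. -/
lemma exists_convexHull_tail_tendsto_L1 [CompleteSpace E] (m : Measure Ω) [IsFiniteMeasure m]
    (v : ℕ → Ω → E)
    (hv : ∀ n, StronglyMeasurable (v n)) {ε : ℝ} (hε : 0 < ε) {M : ℝ≥0∞} (hM : M ≠ ∞)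
    (hvM : ∀ n, ∫⁻ ω, ‖v n ω‖ₑ ^ (1 + ε) ∂m ≤ M) :
    ∃ (g : ℕ → Ω → E) (G : Ω → E), (∀ n, g n ∈ convexHull ℝ (v '' Ici n)) ∧
      (∀ n, Integrable (g n) m) ∧ Integrable G m ∧
      (∀ᵐ ω ∂m, Tendsto (fun n => g n ω) atTop (𝓝 (G ω))) ∧
      Tendsto (fun n => ∫⁻ ω, ‖g n ω - G ω‖ₑ ∂m) atTop (𝓝 0) := by
  obtain ⟨c, hc, hw⟩ := exists_lp_trunc (E := E) m
  choose w hw2 hwL using fun n => hw (v n) (hv n)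
  obtain ⟨W, Winf, hW, hWlim⟩ := exists_tendsto_convexHull_tail w 2 hw2
  -- lift the convex combinations to pairs
  have hlift : ∀ n, ∃ V : Ω → E, (W n, V) ∈ convexHull ℝ ((fun i => (w i, v i)) '' Ici n) := by
    intro n
    have h1 : w '' Ici n = LinearMap.fst ℝ _ (Ω → E) '' ((fun i => (w i, v i)) '' Ici n) := by
      rw [image_image]; rfl
    have h2 := hW n
    rw [h1, ← LinearMap.image_convexHull] at h2
    obtain ⟨⟨a, V⟩, hp, rfl⟩ := h2
    exact ⟨V, hp⟩
  choose V hV using hlift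
  have hVv : ∀ n, V n ∈ convexHull ℝ (v '' Ici n) := fun n => by
    have h1 : v '' Ici n = LinearMap.snd ℝ (lp (fun _ : ℕ => Lp E 2 m) 2) (Ω → E) ''
        ((fun i => (w i, v i)) '' Ici n) := by
      rw [image_image]; rfl
    rw [h1, ← LinearMap.image_convexHull]
    exact ⟨_, hV n, rfl⟩
  -- `T L` undoes the weight and reads off the `L`-th truncation. By `hpair`, `V n` is within `η L`
  -- of `T L (W n)` in `L¹`, uniformly in `n`.
  let T : ℕ → lp (fun _ : ℕ => Lp E 2 m) 2 →ₗ[ℝ] Lp E 2 m := fun L =>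
    { toFun := fun x => (c L)⁻¹ • x L
      map_add' := fun x y => by rw [lp.coeFn_add, Pi.add_apply, smul_add]
      map_smul' := fun a x => by rw [lp.coeFn_smul, Pi.smul_apply, smul_comm]; rfl }
  set η : ℕ → ℝ≥0∞ := fun L => ENNReal.ofReal (((L : ℝ) + 1) ^ (-ε)) * M with hη
  have hpair : ∀ n L, Integrable (V n) m ∧ eLpNorm (V n - ⇑(T L (W n))) 1 m ≤ η L := by
    intro n L
    have hsub : convexHull ℝ ((fun i => (w i, v i)) '' Ici n) ⊆
        {p | Integrable p.2 m ∧ eLpNorm (p.2 - ⇑(T L p.1)) 1 m ≤ η L} := by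
      apply convexHull_min _ (convex_eLpNorm_sub_le m (T L) (η L))
      rintro _ ⟨i, -, rfl⟩
      refine ⟨integrable_of_lintegral_rpow_le m (hv i).aestronglyMeasurable hε
        ((hvM i).trans_lt hM.lt_top), ?_⟩
      have hae : (v i - ⇑(T L (w i)) : Ω → E) =ᵐ[m]
          fun ω => v i ω - trunc ((L : ℝ) + 1) (v i ω) := by
        filter_upwards [hwL i L] with ω h
        simp only [Pi.sub_apply]
        rw [← h]; rfl
      change eLpNorm (v i - ⇑(T L (w i)) : Ω → E) 1 m ≤ η L
      rw [eLpNorm_congr_ae hae, eLpNorm_one_eq_lintegral_enorm]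
      calc ∫⁻ ω, ‖v i ω - trunc ((L : ℝ) + 1) (v i ω)‖ₑ ∂m
          ≤ ∫⁻ ω, ENNReal.ofReal (((L : ℝ) + 1) ^ (-ε)) * ‖v i ω‖ₑ ^ (1 + ε) ∂m :=
            lintegral_mono fun ω => enorm_sub_trunc_le (by positivity) hε _
        _ ≤ η L := by
            rw [lintegral_const_mul' _ _ ENNReal.ofReal_ne_top]
            exact mul_le_mul' le_rfl (hvM i)
    exact hsub (hV n)
  have hVint : ∀ n, Integrable (V n) m := fun n => (hpair n 0).1
  have hVmem : ∀ n, MemLp (V n) 1 m := fun n => memLp_one_iff_integrable.2 (hVint n)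
  have hη0 : Tendsto η atTop (𝓝 0) := by
    have h1 : Tendsto (fun L : ℕ => ((L : ℝ) + 1) ^ (-ε)) atTop (𝓝 0) :=
      (tendsto_rpow_neg_atTop hε).comp
        (tendsto_atTop_add_const_right _ _ tendsto_natCast_atTop_atTop)
    have h2 := ENNReal.Tendsto.mul_const (b := M) (ENNReal.tendsto_ofReal h1) (Or.inr hM)
    simpa using h2
  set κ : ℝ≥0∞ := m univ ^ (1 / (1 : ℝ≥0∞).toReal - 1 / (2 : ℝ≥0∞).toReal) with hκ
  have hκt : κ ≠ ∞ := ENNReal.rpow_ne_top_of_nonneg (by norm_num) (measure_ne_top _ _)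
  -- Three-term argument: choose `L` for the two truncation errors, then use `L²` convergence at
  -- this fixed level. The factor `κ` compares `L¹` with `L²` on a finite measure.
  have hcau : CauchySeq fun n => (hVmem n).toLp (V n) := by
    rw [EMetric.cauchySeq_iff]
    intro δ hδ
    obtain ⟨L, hL⟩ := (hη0.eventually (gt_mem_nhds (ENNReal.div_pos hδ.ne' (by norm_num :
      (4 : ℝ≥0∞) ≠ ∞)))).exists
    have hWL : CauchySeq fun n => T L (W n) := by
      have : Tendsto (fun n => T L (W n)) atTop (𝓝 (T L Winf)) := by
        have h1 : Tendsto (fun n => W n L) atTop (𝓝 (Winf L)) := by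
          rw [tendsto_iff_norm_sub_tendsto_zero] at hWlim ⊢
          refine squeeze_zero (fun n => norm_nonneg _) (fun n => ?_) hWlim
          exact lp.norm_apply_le_norm (by norm_num) (W n - Winf) L
        exact h1.const_smul (c L)⁻¹
      exact this.cauchySeq
    rw [EMetric.cauchySeq_iff] at hWL
    obtain ⟨N, hN⟩ := hWL (δ / 4 / (κ + 1)) (ENNReal.div_pos
      (ENNReal.div_pos hδ.ne' (by norm_num)).ne' (ENNReal.add_ne_top.2 ⟨hκt, by norm_num⟩))
    by_cases hδt : δ = ∞
    · exact ⟨0, fun a _ b _ => hδt ▸ edist_lt_top _ _⟩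
    refine ⟨N, fun a ha b hb => ?_⟩
    rw [Lp.edist_toLp_toLp]
    have hmT : ∀ n, AEStronglyMeasurable (V n - ⇑(T L (W n))) m := fun n =>
      (hVint n).1.sub (Lp.memLp _).1
    have hmT' : AEStronglyMeasurable (⇑(T L (W a)) - ⇑(T L (W b))) m :=
      (Lp.memLp _).1.sub (Lp.memLp _).1
    have hdec : V a - V b = (V a - ⇑(T L (W a))) + ((⇑(T L (W a)) - ⇑(T L (W b))) -
        (V b - ⇑(T L (W b)))) := by abel
    have hmid : eLpNorm (⇑(T L (W a)) - ⇑(T L (W b))) 1 m ≤ δ / 4 := by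
      refine (eLpNorm_le_eLpNorm_mul_rpow_measure_univ (p := 1) (q := 2) (by norm_num)
        hmT').trans ?_
      rw [← Lp.edist_def]
      calc edist (T L (W a)) (T L (W b)) * κ ≤ (δ / 4 / (κ + 1)) * (κ + 1) := by
            gcongr
            · exact (hN a ha b hb).le
            · exact le_self_add
        _ = δ / 4 := ENNReal.div_mul_cancel (by simp) (ENNReal.add_ne_top.2 ⟨hκt, by norm_num⟩)
    calc eLpNorm (V a - V b) 1 m
        ≤ eLpNorm (V a - ⇑(T L (W a))) 1 m + (eLpNorm (⇑(T L (W a)) - ⇑(T L (W b))) 1 m +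
          eLpNorm (V b - ⇑(T L (W b))) 1 m) := by
          conv_lhs => rw [hdec]
          refine (eLpNorm_add_le (hmT a) (hmT'.sub (hmT b)) le_rfl).trans ?_
          gcongr
          exact eLpNorm_sub_le hmT' (hmT b) le_rfl
      _ ≤ δ / 4 + (δ / 4 + δ / 4) := by
          gcongr
          · exact (hpair a L).2.trans hL.le
          · exact (hpair b L).2.trans hL.le
      _ < δ := by
          lift δ to ℝ≥0 using hδt
          have hpos : 0 < δ := by exact_mod_cast hδ
          have : (δ : ℝ≥0∞) / 4 = ((δ / 4 : ℝ≥0) : ℝ≥0∞) := by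
            rw [ENNReal.coe_div (by norm_num)]; rfl
          rw [this]
          norm_cast
          rw [← NNReal.coe_lt_coe]
          have : (0 : ℝ) < δ := hpos
          push_cast
          linarith
  obtain ⟨G, hG⟩ := cauchySeq_tendsto_of_complete hcau
  have hG1 : Tendsto (fun n => eLpNorm (V n - ⇑G) 1 m) atTop (𝓝 0) := by
    have h1 := tendsto_iff_edist_tendsto_0.1 hG
    refine h1.congr fun n => ?_
    rw [Lp.edist_def]
    refine eLpNorm_congr_ae ?_
    filter_upwards [(hVmem n).coeFn_toLp] with ω h
    simp [h]
  -- A further subsequence gives almost everywhere convergence; it still consists of forward convex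
  -- combinations because `φ n ≥ n`.
  obtain ⟨φ, hφ, hae⟩ := (tendstoInMeasure_of_tendsto_eLpNorm one_ne_zero
    (fun n => (hVint n).1) (Lp.memLp G).1 hG1).exists_seq_tendsto_ae
  refine ⟨fun n => V (φ n), G, fun n => ?_, fun n => hVint _,
    memLp_one_iff_integrable.1 (Lp.memLp G), hae, ?_⟩
  · exact convexHull_mono (image_mono (Ici_subset_Ici.2 (hφ.id_le n))) (hVv (φ n))
  · have h2 := hG1.comp hφ.tendsto_atTop
    refine h2.congr fun n => ?_
    simp only [Function.comp, eLpNorm_one_eq_lintegral_enorm]; rfl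

end ConvexCombinationsL1

/-! ### Passing to the limit in approximate selections. -/

section InclusionLimit

variable {Ξ : Type*} [MeasurableSpace Ξ] {E : Type*} [NormedAddCommGroup E]
  [InnerProductSpace ℝ E]

/-- Closed thickenings of a convex set are convex, so they absorb forward convex combinations as
soon as they absorb the tail of the sequence; closedness of `S` then removes the thickening. -/
lemma mem_of_tendsto_infEDist_of_convexHull_tail {Ω : Type*} {S : Set E} (hS : IsClosed S)
    (hS' : Convex ℝ S) (v g : ℕ → Ω → E) (hg : ∀ n, g n ∈ convexHull ℝ (v '' Ici n)) (ω : Ω) {z : E}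
    (hv : Tendsto (fun n => Metric.infEDist (v n ω) S) atTop (𝓝 0))
    (hz : Tendsto (fun n => g n ω) atTop (𝓝 z)) : z ∈ S := by
  have key : ∀ δ : ℝ, 0 < δ → z ∈ Metric.cthickening δ S := by
    intro δ hδ
    obtain ⟨n, hn⟩ := eventually_atTop.1 (hv.eventually (ge_mem_nhds (ENNReal.ofReal_pos.2 hδ)))
    have hmem : ∀ k ≥ n, g k ω ∈ Metric.cthickening δ S := by
      intro k hk
      have hsub : convexHull ℝ (v '' Ici k) ⊆ {f | f ω ∈ Metric.cthickening δ S} := by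
        refine convexHull_min ?_ (fun f hf f' hf' a b ha hb hab =>
        (hS'.cthickening δ) hf hf' ha hb hab)
        rintro _ ⟨i, hi, rfl⟩
        exact Metric.mem_cthickening_iff.2 (hn i (hk.le.trans hi))
      exact hsub (hg k)
    exact Metric.isClosed_cthickening.mem_of_tendsto hz (eventually_atTop.2 ⟨n, hmem⟩)
  have h1 : z ∈ ⋂ δ > (0 : ℝ), Metric.cthickening δ S := by
    simpa only [mem_iInter] using key
  rwa [← Metric.closure_eq_iInter_cthickening, hS.closure_eq] at h1

/-- Balls are convex and the integral is linear on integrable functions, so integrals of forward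
convex combinations are trapped in every ball that contains the tail. -/
lemma tendsto_integral_of_convexHull_tail {Ω : Type*} [MeasurableSpace Ω] (m : Measure Ω)
    (v g : ℕ → Ω → E) (hg : ∀ n, g n ∈ convexHull ℝ (v '' Ici n)) (hv : ∀ n, Integrable (v n) m)
    {z : E} (hz : Tendsto (fun n => ∫ ω, v n ω ∂m) atTop (𝓝 z)) :
    Tendsto (fun n => ∫ ω, g n ω ∂m) atTop (𝓝 z) := by
  rw [Metric.tendsto_atTop] at hz ⊢
  intro δ hδ
  obtain ⟨n, hn⟩ := hz δ hδ
  refine ⟨n, fun k hk => ?_⟩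
  have hsub : convexHull ℝ (v '' Ici k) ⊆
      {f | Integrable f m ∧ ∫ ω, f ω ∂m ∈ Metric.ball z δ} := by
    refine convexHull_min ?_ ?_
    · rintro _ ⟨i, hi, rfl⟩
      exact ⟨hv i, hn i (hk.le.trans hi)⟩
    · rintro f ⟨hf, hf'⟩ f' ⟨hg, hg'⟩ a b ha hb hab
      refine ⟨(hf.smul a).add (hg.smul b), ?_⟩
      have : ∫ ω, (a • f + b • f') ω ∂m = a • ∫ ω, f ω ∂m + b • ∫ ω, f' ω ∂m := by
        refine (integral_add (hf.smul a) (hg.smul b)).trans ?_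
        simp only [Pi.smul_apply]
        rw [integral_smul, integral_smul]
      rw [this]
      exact convex_ball z δ hf' hg' ha hb hab
  exact (hsub (hg k)).2

variable [CompleteSpace E] [MeasurableSpace E] [BorelSpace E] [SecondCountableTopology E]

/-- Limits of integrals of approximate selections satisfy the limit differential inclusion. -/
lemma ae_hasDerivAt_mem_selectionIntegral (μ : Measure Ξ) [IsProbabilityMeasure μ]
    (h : ℕ → Ξ → E → E) (hmeas : ∀ k, Measurable fun p : Ξ × E => h k p.1 p.2)
    (H : Ξ → E → Set E) (hcc : ∀ᵐ s ∂μ, ∀ x, IsClosed (H s x) ∧ Convex ℝ (H s x))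
    (hH : ∀ᵐ s ∂μ, ∀ (u : ℕ → E) (u' : E), Tendsto u atTop (𝓝 u') →
      Tendsto (fun k => Metric.infEDist (h k s (u k)) (H s u')) atTop (𝓝 0))
    (u : ℕ → ℝ → E) (hu : ∀ k, Measurable (u k)) (x : ℝ → E) (τ : ℝ) (hτ : 0 ≤ τ)
    (hux : ∀ᵐ t ∂(volume.restrict (Ioc 0 τ)), Tendsto (fun k => u k t) atTop (𝓝 (x t)))
    {ε : ℝ} (hε : 0 < ε) {M : ℝ≥0∞} (hM : M ≠ ∞)
    (hmom : ∀ k, ∀ t ∈ Ioc 0 τ, ∫⁻ s, ‖h k s (u k t)‖ₑ ^ (1 + ε) ∂μ ≤ M)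
    (hx : ∀ t ∈ Icc 0 τ, Tendsto (fun k => ∫ t' in (0 : ℝ)..t, ∫ s, h k s (u k t') ∂μ) atTop
      (𝓝 (x t - x 0))) :
    ∀ᵐ t ∂(volume.restrict (Ioo 0 τ)), ∃ v ∈ selectionIntegral μ (fun s => H s (x t)),
      HasDerivAt x v t := by
  set lam : ℝ → Measure ℝ := fun t => volume.restrict (Ioc 0 t) with hlam
  set m : ℝ → Measure (Ξ × ℝ) := fun t => μ.prod (lam t) with hm
  set v : ℕ → Ξ × ℝ → E := fun k p => h k p.1 (u k p.2) with hv
  have hvm : ∀ k, Measurable (v k) := fun k =>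
    (hmeas k).comp (measurable_fst.prodMk ((hu k).comp measurable_snd))
  have hvmom : ∀ k, ∫⁻ p, ‖v k p‖ₑ ^ (1 + ε) ∂(m τ) ≤ M * ENNReal.ofReal τ := by
    intro k
    rw [lintegral_prod_symm _ ((hvm k).enorm.pow_const _).aemeasurable]
    calc ∫⁻ t, ∫⁻ s, ‖v k (s, t)‖ₑ ^ (1 + ε) ∂μ ∂(lam τ) ≤ ∫⁻ _, M ∂(lam τ) := by
          refine lintegral_mono_ae ?_
          filter_upwards [ae_restrict_mem measurableSet_Ioc] with t ht using hmom k t ht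
      _ = M * ENNReal.ofReal τ := by simp [hlam]
  obtain ⟨g, G, hg, hgi, hGi, hae, hL1⟩ := exists_convexHull_tail_tendsto_L1 (m τ) v
    (fun k => (hvm k).stronglyMeasurable) hε (ENNReal.mul_ne_top hM ENNReal.ofReal_ne_top) hvmom
  have hvi : ∀ k, Integrable (v k) (m τ) := fun k =>
    integrable_of_lintegral_rpow_le _ (hvm k).aestronglyMeasurable hε
      ((hvmom k).trans_lt (ENNReal.mul_lt_top hM.lt_top ENNReal.ofReal_lt_top))
  have hmono : ∀ t ≤ τ, m t ≤ m τ := fun t ht =>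
    Measure.prod_mono le_rfl (Measure.restrict_mono (Ioc_subset_Ioc_right ht) le_rfl)
  -- the limit is a selection
  have hsel : ∀ᵐ p ∂(m τ), G p ∈ H p.1 (x p.2) := by
    have h1 := Measure.quasiMeasurePreserving_fst (μ := μ) (ν := lam τ) |>.ae hH
    have h2 := Measure.quasiMeasurePreserving_fst (μ := μ) (ν := lam τ) |>.ae hcc
    have h3 := Measure.quasiMeasurePreserving_snd (μ := μ) (ν := lam τ) |>.ae hux
    filter_upwards [h1, h2, h3, hae] with p p1 p2 p3 p4
    exact mem_of_tendsto_infEDist_of_convexHull_tail (p2 _).1 (p2 _).2 v g hg p (p1 _ _ p3) p4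
  set y : ℝ → E := fun t => ∫ s, G (s, t) ∂μ with hy
  have hyi : IntervalIntegrable y volume 0 τ := by
    have h1 : Integrable y (lam τ) := hGi.integral_prod_right
    rwa [intervalIntegrable_iff_integrableOn_Ioc_of_le hτ]
  -- The integrals of `g n` have two limits: `x t - x 0` by convexity, because it is the limit for
  -- `v`, and the integral of `G` by `L¹` convergence. Hence `x` is a primitive of `y`, and Lebesgue
  -- differentiation gives its derivative almost everywhere.
  have hxy : ∀ t ∈ Icc 0 τ, x t - x 0 = ∫ t' in (0 : ℝ)..t, y t' := by
    intro t ht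
    have hle := hmono t ht.2
    have h1 : ∀ k, ∫ p, v k p ∂(m t) = ∫ t' in (0 : ℝ)..t, ∫ s, h k s (u k t') ∂μ := fun k => by
      rw [integral_prod_symm _ ((hvi k).mono_measure hle), intervalIntegral.integral_of_le ht.1]
    have h2 := tendsto_integral_of_convexHull_tail (m t) v g hg
      (fun k => (hvi k).mono_measure hle) (z := x t - x 0) (by simpa only [h1] using hx t ht)
    have h3 : Tendsto (fun n => ∫ p, g n p ∂(m t)) atTop (𝓝 (∫ p, G p ∂(m t))) := by
      refine tendsto_integral_of_L1 G (hGi.mono_measure hle).1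
        (Eventually.of_forall fun k => (hgi k).mono_measure hle) ?_
      exact tendsto_of_tendsto_of_tendsto_of_le_of_le tendsto_const_nhds hL1
        (fun _ => zero_le) (fun k => lintegral_mono' hle le_rfl)
    rw [tendsto_nhds_unique h2 h3, integral_prod_symm _ (hGi.mono_measure hle),
      intervalIntegral.integral_of_le ht.1]
  have hder := hyi.ae_hasDerivAt_integral
  have hselt : ∀ᵐ t ∂(lam τ), ∀ᵐ s ∂μ, G (s, t) ∈ H s (x t) := by
    have h1 : ∀ᵐ q ∂((lam τ).prod μ), G q.swap ∈ H q.swap.1 (x q.swap.2) := by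
      have := Measure.measurePreserving_swap (μ := lam τ) (ν := μ)
      exact this.quasiMeasurePreserving.ae hsel
    exact Measure.ae_ae_of_ae_prod h1
  have hle : volume.restrict (Ioo 0 τ) ≤ lam τ := Measure.restrict_mono Ioo_subset_Ioc_self le_rfl
  filter_upwards [ae_mono hle hselt, ae_mono hle hGi.prod_left_ae, ae_restrict_of_ae hder,
    ae_restrict_mem measurableSet_Ioo] with t h1 h2 h3 ht
  refine ⟨y t, subset_closure ⟨fun s => G (s, t), ⟨h2, h1⟩, rfl⟩, ?_⟩
  rw [uIcc_of_le hτ] at h3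
  have h4 := (h3 (Ioo_subset_Icc_self ht) 0 (left_mem_Icc.2 hτ)).add_const (x 0)
  refine h4.congr_of_eventuallyEq ?_
  filter_upwards [Ioo_mem_nhds ht.1 ht.2] with t' ht'
  rw [← hxy t' (Ioo_subset_Icc_self ht')]
  abel

end InclusionLimit

/-! ### Compactness and concatenation of paths. -/

section Paths

variable {E : Type*} [NormedAddCommGroup E]

lemma pathExt_coe (x : C(ℝ≥0, E)) (t : ℝ≥0) : pathExt x t = x t := by simp [pathExt]

/-- Arzelà–Ascoli for paths which are Lipschitz on bounded intervals. -/
lemma isCompact_lipschitz_paths [ProperSpace E] (r : ℝ) (K : ℕ → ℝ) :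
    IsCompact {x : C(ℝ≥0, E) | ‖x 0‖ ≤ r ∧
      ∀ T : ℕ, ∀ s t : ℝ≥0, s ≤ T → t ≤ T → dist (x s) (x t) ≤ K T * dist s t} := by
  set S := {x : C(ℝ≥0, E) | ‖x 0‖ ≤ r ∧
      ∀ T : ℕ, ∀ s t : ℝ≥0, s ≤ T → t ≤ T → dist (x s) (x t) ≤ K T * dist s t} with hS
  set S' := {x : ℝ≥0 → E | ‖x 0‖ ≤ r ∧
      ∀ T : ℕ, ∀ s t : ℝ≥0, s ≤ T → t ≤ T → dist (x s) (x t) ≤ K T * dist s t} with hS'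
  have hequi : ∀ (A : Set (ℝ≥0 → E)), A ⊆ S' → Equicontinuous ((↑) : A → ℝ≥0 → E) := by
    intro A hA t₀
    rw [Metric.equicontinuousAt_iff]
    intro δ hδ
    obtain ⟨T, hT⟩ := exists_nat_gt (t₀ + 1)
    have hT0 : t₀ ≤ T := le_self_add.trans hT.le
    -- The bound `1` keeps `t` below `T`, where the constant `K T` applies; the absolute value and
    -- `+ 1` are there because no sign is assumed for `K T`.
    refine ⟨min 1 (δ / (|K T| + 1)), lt_min one_pos (by positivity), fun t ht f => ?_⟩
    have htT : t ≤ T := by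
      have h1 : dist t t₀ < 1 := ht.trans_le (min_le_left _ _)
      rw [NNReal.dist_eq] at h1
      have h2 := (abs_lt.1 h1).2
      rw [← NNReal.coe_lt_coe] at hT
      rw [← NNReal.coe_le_coe]
      push_cast at hT ⊢
      linarith
    refine ((hA f.2).2 T _ _ hT0 htT).trans_lt ?_
    rw [dist_comm t₀ t]
    have h3 : dist t t₀ < δ / (|K T| + 1) := ht.trans_le (min_le_right _ _)
    rw [lt_div_iff₀ (by positivity)] at h3
    nlinarith [le_abs_self (K T), dist_nonneg (x := t) (y := t₀)]
  have himage : ContinuousMap.toFun '' S = S' := by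
    ext f
    constructor
    · rintro ⟨x, hx, rfl⟩; exact hx
    · intro hf
      have hcont : Continuous f :=
        (hequi {f} (singleton_subset_iff.2 hf)).continuous ⟨f, rfl⟩
      exact ⟨⟨f, hcont⟩, hf, rfl⟩
  apply ArzelaAscoli.isCompact_of_equicontinuous
  · rw [himage]
    refine IsCompact.of_isClosed_subset (isCompact_univ_pi fun t : ℝ≥0 =>
      isCompact_closedBall (0 : E) (r + |K ⌈t⌉₊| * t)) ?_ ?_
    · rw [hS', ofPred_and]
      refine (isClosed_le (continuous_apply _).norm continuous_const).inter ?_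
      simp only [ofPred_forall]
      refine isClosed_iInter fun T => isClosed_iInter fun s => isClosed_iInter fun t =>
        isClosed_iInter fun _ => isClosed_iInter fun _ => ?_
      exact isClosed_le ((continuous_apply s).dist (continuous_apply t)) continuous_const
    · rintro f ⟨hf0, hf⟩ t -
      rw [mem_closedBall_zero_iff]
      have h1 := hf ⌈t⌉₊ t 0 (Nat.le_ceil t) zero_le
      rw [dist_eq_norm, NNReal.dist_eq] at h1
      have h2 : |(t : ℝ) - (0 : ℝ≥0)| = t := by simp
      rw [h2] at h1
      have h3 : ‖f t‖ ≤ ‖f 0‖ + ‖f t - f 0‖ := by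
        have := norm_add_le (f 0) (f t - f 0)
        simpa using this
      have h4 : K ⌈t⌉₊ * (t : ℝ) ≤ |K ⌈t⌉₊| * t :=
        mul_le_mul_of_nonneg_right (le_abs_self _) t.2
      linarith
  · have h1 := hequi S' subset_rfl
    have h2 := h1.comp (fun x : S => (⟨x.1, by rw [← himage]; exact ⟨x.1, x.2, rfl⟩⟩ : S'))
    exact h2

/-- A monotone map sends disjoint intervals to disjoint intervals, and a 1-Lipschitz one does not
increase total length, so the same `δ` works. It covers the clamped reparametrisations used to glue
paths. -/
lemma AbsolutelyContinuousOnInterval.comp_monotone {f : ℝ → E} {T : ℝ}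
    (hf : AbsolutelyContinuousOnInterval f 0 T) (φ : ℝ → ℝ) (hφ : Monotone φ)
    (hφ1 : ∀ s t, dist (φ s) (φ t) ≤ dist s t) (hmaps : MapsTo φ (uIcc 0 T) (uIcc 0 T)) :
    AbsolutelyContinuousOnInterval (f ∘ φ) 0 T := by
  rw [absolutelyContinuousOnInterval_iff] at hf ⊢
  intro ε hε
  obtain ⟨δ, hδ, h⟩ := hf ε hε
  refine ⟨δ, hδ, fun I hI hlen => ?_⟩
  refine h (I.1, fun i => (φ (I.2 i).1, φ (I.2 i).2)) ⟨fun i hi => ?_, ?_⟩ ?_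
  · exact ⟨hmaps (hI.1 i hi).1, hmaps (hI.1 i hi).2⟩
  · intro i hi j hj hij
    have hd := hI.2 hi hj hij
    simp only [Function.onFun] at hd ⊢
    rw [Set.disjoint_left] at hd ⊢
    intro z hz hz'
    simp only [uIoc, mem_Ioc] at hz hz' hd
    rw [← hφ.map_min, ← hφ.map_max] at hz hz'
    set a := min (I.2 i).1 (I.2 i).2
    set b := max (I.2 i).1 (I.2 i).2
    set c := min (I.2 j).1 (I.2 j).2
    set d := max (I.2 j).1 (I.2 j).2
    have hlt : ∀ p q, φ p < z → z ≤ φ q → p < q := fun p q hp hq => by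
      by_contra hle
      exact absurd (hφ (not_lt.1 hle)) (not_le.2 (hp.trans_le hq))
    -- The smaller right endpoint is common to both original intervals as soon as their images share
    -- a point.
    exact hd (a := min b d)
      ⟨lt_min (hlt _ _ hz.1 hz.2) (hlt _ _ hz.1 hz'.2), min_le_left _ _⟩
      ⟨lt_min (hlt _ _ hz'.1 hz.2) (hlt _ _ hz'.1 hz'.2), min_le_right _ _⟩
  · exact (Finset.sum_le_sum fun i _ => hφ1 _ _).trans_lt hlen

variable [NormedSpace ℝ E]

/-- A path solving the inclusion on `(0, ζ)` can be continued by any solution started from its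
value at `ζ`. -/
lemma exists_solution_concat (G : E → Set E) (x : C(ℝ≥0, E)) (ζ : ℝ≥0)
    (hlip : ∀ T : ℝ, 0 < T → ∃ K, LipschitzOnWith K (pathExt x) (Icc 0 T))
    (hx : ∀ᵐ t ∂(volume.restrict (Ioo (0 : ℝ) ζ)), ∃ v ∈ G (pathExt x t),
      HasDerivAt (pathExt x) v t)
    (y : C(ℝ≥0, E)) (hy : y ∈ solutions G (x ζ)) :
    ∃ z ∈ solutions G (x 0), ∀ t ≤ ζ, z t = x t := by
  obtain ⟨hy0, hyac, hyd⟩ := hy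
  -- Written as a sum, the glued path needs no case distinction for continuity or absolute
  -- continuity: subtraction in `ℝ≥0` is truncated, so the second term vanishes before `ζ`.
  let z : C(ℝ≥0, E) := ⟨fun t => x (min t ζ) + (y (t - ζ) - y 0), by fun_prop⟩
  have hz : ∀ t, z t = x (min t ζ) + (y (t - ζ) - y 0) := fun _ => rfl
  have hzle : ∀ t ≤ ζ, z t = x t := fun t ht => by
    rw [hz, min_eq_left ht, tsub_eq_zero_of_le ht, sub_self, add_zero]
  have hzge : ∀ t, ζ ≤ t → z t = y (t - ζ) := fun t ht => by
    rw [hz, min_eq_right ht, hy0]; abel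
  refine ⟨z, ⟨hzle 0 zero_le, fun T hT => ?_, ?_⟩, hzle⟩
  · have hf1 : AbsolutelyContinuousOnInterval (pathExt x ∘ fun t => min t (ζ : ℝ)) 0 T := by
      apply AbsolutelyContinuousOnInterval.comp_monotone
      · obtain ⟨K, hK⟩ := hlip T hT
        rw [← uIcc_of_le hT.le] at hK
        exact hK.absolutelyContinuousOnInterval
      · exact fun s t hst => min_le_min_right _ hst
      · intro s t
        rw [Real.dist_eq, Real.dist_eq]
        exact (abs_min_sub_min_le_max s ζ t ζ).trans (by simp)
      · intro t ht
        rw [uIcc_of_le hT.le] at ht ⊢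
        exact ⟨le_min ht.1 ζ.2, (min_le_left _ _).trans ht.2⟩
    have hf2 : AbsolutelyContinuousOnInterval (pathExt y ∘ fun t => max (t - (ζ : ℝ)) 0) 0 T := by
      apply AbsolutelyContinuousOnInterval.comp_monotone (hyac T hT)
      · exact fun s t hst => max_le_max_right _ (sub_le_sub_right hst _)
      · intro s t
        rw [Real.dist_eq, Real.dist_eq]
        refine (abs_max_sub_max_le_abs _ _ _).trans (le_of_eq ?_)
        congr 1; ring
      · intro t ht
        rw [uIcc_of_le hT.le] at ht ⊢
        exact ⟨le_max_right _ _, max_le (by linarith [ht.2, ζ.2]) hT.le⟩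
    have hf3 : AbsolutelyContinuousOnInterval (fun _ : ℝ => y 0) 0 T :=
      (LipschitzWith.const (y 0)).lipschitzOnWith.absolutelyContinuousOnInterval
    have := hf1.add (hf2.sub hf3)
    convert this using 1
    ext t
    simp only [Pi.add_apply, Pi.sub_apply, Function.comp, pathExt, hz]
    congr 2
    · rw [Monotone.map_min (fun _ _ h => Real.toNNReal_mono h), Real.toNNReal_coe]
    · congr 1
      apply NNReal.coe_injective
      rw [Real.coe_toNNReal _ (le_max_right _ _), NNReal.coe_sub_def,
        Real.coe_toNNReal']
      rcases le_total 0 t with h | h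
      · rw [max_eq_left h]
      · rw [max_eq_right h]
        have : (0 : ℝ) ≤ ζ := ζ.2
        rw [max_eq_right (by simp), max_eq_right (by linarith)]
  · rw [ae_restrict_iff' measurableSet_Ioi] at hyd ⊢
    rw [ae_restrict_iff' measurableSet_Ioo] at hx
    have hyd' := (measurePreserving_sub_right volume (ζ : ℝ)).quasiMeasurePreserving.ae hyd
    have hne : ∀ᵐ t : ℝ, t ≠ ζ := by simp [ae_iff, measure_singleton]
    filter_upwards [hx, hyd', hne] with t h1 h2 h3 ht
    rcases lt_or_gt_of_ne h3 with hlt | hgt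
    · obtain ⟨v, hv, hd⟩ := h1 ⟨ht, hlt⟩
      have heq : pathExt z =ᶠ[𝓝 t] pathExt x := by
        filter_upwards [Iio_mem_nhds hlt] with s hs
        exact hzle _ (Real.toNNReal_le_iff_le_coe.2 (le_of_lt hs))
      exact ⟨v, by rwa [heq.eq_of_nhds], hd.congr_of_eventuallyEq heq⟩
    · obtain ⟨v, hv, hd⟩ := h2 (sub_pos.2 hgt)
      have heq : pathExt z =ᶠ[𝓝 t] fun s => pathExt y (s - ζ) := by
        filter_upwards [Ioi_mem_nhds hgt] with s hs
        have hs' : (ζ : ℝ) < s := hs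
        have hs0 : 0 ≤ s := ζ.2.trans hs'.le
        rw [pathExt, hzge _ ((Real.le_toNNReal_iff_coe_le hs0).2 hs'.le), pathExt]
        congr 1
        rw [NNReal.sub_def, Real.coe_toNNReal _ hs0]
      refine ⟨v, by rw [heq.eq_of_nhds]; exact hv, ?_⟩
      refine HasDerivAt.congr_of_eventuallyEq ?_ heq
      have := hd.comp_sub_const t (ζ : ℝ)
      exact this

end Paths

/-! ### Step functions on the grid of mesh `γ`. -/

section StepFunctions

variable {F : Type*} [NormedAddCommGroup F]

/-- The step function with value `f i` on `[i γ, (i + 1) γ)`. -/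
noncomputable def stepFun {F : Type*} (γ : ℝ) (f : ℕ → F) (t : ℝ) : F := f ⌊t / γ⌋₊

lemma stronglyMeasurable_stepFun (γ : ℝ) (f : ℕ → F) : StronglyMeasurable (stepFun γ f) := by
  have h1 : StronglyMeasurable f := StronglyMeasurable.of_discrete
  exact h1.comp_measurable (Nat.measurable_floor.comp (measurable_id.div_const γ))

lemma intervalIntegrable_stepFun {γ : ℝ} (hγ : 0 < γ) (f : ℕ → F) (a b : ℝ) :
    IntervalIntegrable (stepFun γ f) volume a b := by
  rw [intervalIntegrable_iff]
  refine Measure.integrableOn_of_bounded (M := ∑ i ∈ Finset.range (⌊max a b / γ⌋₊ + 1), ‖f i‖)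
    (by simp [uIoc]) (stronglyMeasurable_stepFun γ f).aestronglyMeasurable ?_
  filter_upwards [ae_restrict_mem measurableSet_uIoc] with t ht
  apply Finset.single_le_sum (f := fun i => ‖f i‖) (fun _ _ => norm_nonneg _)
  rw [Finset.mem_range, Nat.lt_succ_iff]
  exact Nat.floor_le_floor (div_le_div_of_nonneg_right ht.2 hγ.le)

lemma stepFun_of_mem_Ico {F : Type*} {γ : ℝ} (hγ : 0 < γ) (f : ℕ → F) {n : ℕ} {t : ℝ}
    (ht : t ∈ Ico (n * γ) ((n + 1) * γ)) : stepFun γ f t = f n := by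
  unfold stepFun
  congr 1
  rw [Nat.floor_eq_iff (div_nonneg (le_trans (by positivity) ht.1) hγ.le)]
  exact ⟨(le_div_iff₀ hγ).2 ht.1, (div_lt_iff₀ hγ).2 ht.2⟩

variable [NormedSpace ℝ F]

lemma integral_stepFun {γ : ℝ} (hγ : 0 < γ) (f : ℕ → F) [CompleteSpace F] (n : ℕ) :
    ∫ t in (0 : ℝ)..(n * γ), stepFun γ f t = γ • ∑ i ∈ Finset.range n, f i := by
  induction n with
  | zero => simp
  | succ n ih =>
    rw [← intervalIntegral.integral_add_adjacent_intervals (b := n * γ)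
      (intervalIntegrable_stepFun hγ f _ _) (intervalIntegrable_stepFun hγ f _ _), ih,
      Finset.sum_range_succ, smul_add]
    congr 1
    have hle : (n : ℝ) * γ ≤ ((n : ℝ) + 1) * γ := by nlinarith
    have : ∫ t in (n * γ : ℝ)..((n + 1 : ℕ) * γ), stepFun γ f t =
        ∫ _ in (n * γ : ℝ)..((n + 1) * γ), f n := by
      push_cast
      rw [intervalIntegral.integral_of_le hle, intervalIntegral.integral_of_le hle,
        integral_Ioc_eq_integral_Ioo, integral_Ioc_eq_integral_Ioo]
      refine setIntegral_congr_fun measurableSet_Ioo fun t ht => ?_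
      exact stepFun_of_mem_Ico hγ f (Ioo_subset_Ico_self ht)
    rw [this, intervalIntegral.integral_const]
    congr 1
    ring

end StepFunctions

/-! ### Discrete paths stopped on leaving a time-dependent ball, and their drift interpolation. -/

section StoppedPaths

variable {E : Type*} [NormedAddCommGroup E] (Rad : ℝ → ℝ) (γ : ℝ) (ω : ℕ → E)

/-- The path `ω` has stayed in the time-dependent ball of radius `Rad` up to the index `l`. -/
def Alive (l : ℕ) : Prop := ∀ i ≤ l, ‖ω i‖ ≤ Rad (i * γ)

open Classical in
/-- The indicator of `Alive`. -/
noncomputable def aliveInd (l : ℕ) : ℝ := if Alive Rad γ ω l then 1 else 0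

variable {Rad γ ω}

lemma Alive.mono {l l' : ℕ} (h : Alive Rad γ ω l) (hl : l' ≤ l) : Alive Rad γ ω l' :=
  fun i hi => h i (hi.trans hl)

lemma aliveInd_of_alive {l : ℕ} (h : Alive Rad γ ω l) : aliveInd Rad γ ω l = 1 := if_pos h

lemma aliveInd_of_not_alive {l : ℕ} (h : ¬ Alive Rad γ ω l) : aliveInd Rad γ ω l = 0 := if_neg h

lemma abs_aliveInd_le (l : ℕ) : |aliveInd Rad γ ω l| ≤ 1 := by
  unfold aliveInd; split_ifs <;> simp

variable [NormedSpace ℝ E]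

variable (Rad γ ω) in
/-- The path `ω` frozen at its first exit from the time-dependent ball. -/
noncomputable def stopped (i : ℕ) : E :=
  ω 0 + ∑ l ∈ Finset.range i, aliveInd Rad γ ω l • (ω (l + 1) - ω l)

variable (Rad γ ω) in
/-- The stopped sum of the deviations of the increments of `ω` from `γ • b`. -/
noncomputable def stopErr (b : E → E) (i : ℕ) : E :=
  ∑ l ∈ Finset.range i, aliveInd Rad γ ω l • (ω (l + 1) - ω l - γ • b (ω l))

/-- Only strictly earlier indices matter: the jump that leaves the ball is still performed, so the
frozen path sits at the exit point, outside the ball. -/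
lemma stopped_eq_of_forall_lt {i : ℕ} (h : ∀ l < i, Alive Rad γ ω l) : stopped Rad γ ω i = ω i := by
  have : ∑ l ∈ Finset.range i, aliveInd Rad γ ω l • (ω (l + 1) - ω l) = ω i - ω 0 := by
    rw [← Finset.sum_range_sub]
    refine Finset.sum_congr rfl fun l hl => ?_
    rw [aliveInd_of_alive (h l (Finset.mem_range.1 hl)), one_smul]
  rw [stopped, this]; abel

lemma stopped_eq {i : ℕ} (h : Alive Rad γ ω i) : stopped Rad γ ω i = ω i :=
  stopped_eq_of_forall_lt fun _ hl => h.mono hl.le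

/-- After the exit, the stopped path sits at the exit point. -/
lemma exists_stopped_eq_of_not_alive {l : ℕ} (h : ¬ Alive Rad γ ω l) :
    ∃ z ≤ l, (∀ l' < z, Alive Rad γ ω l') ∧ ¬ Alive Rad γ ω z ∧ Rad (z * γ) < ‖ω z‖ ∧
      ∀ i ≥ z, stopped Rad γ ω i = ω z := by
  classical
  have hex : ∃ l, ¬ Alive Rad γ ω l := ⟨l, h⟩
  refine ⟨Nat.find hex, Nat.find_min' hex h, fun l' hl' => not_not.1 (Nat.find_min hex hl'),
    Nat.find_spec hex, ?_, ?_⟩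
  · by_contra hle
    refine Nat.find_spec hex fun i hi => ?_
    rcases hi.lt_or_eq with hi | rfl
    · exact (not_not.1 (Nat.find_min hex hi)) i le_rfl
    · exact not_lt.1 hle
  · intro i hi
    induction i, hi using Nat.le_induction with
    | base => exact stopped_eq_of_forall_lt fun l' hl' => not_not.1 (Nat.find_min hex hl')
    | succ i hi ih =>
      rw [← ih, stopped, Finset.sum_range_succ, aliveInd_of_not_alive, zero_smul, add_zero, stopped]
      exact fun ha => Nat.find_spec hex (ha.mono hi)

variable (Rad γ ω) in
/-- The velocity of the interpolated stopped path. -/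
noncomputable def stopVel (b : E → E) (l : ℕ) : E := aliveInd Rad γ ω l • b (ω l)

variable (Rad γ ω) in
/-- The interpolated drift path. -/
noncomputable def driftPath (b : E → E) (t : ℝ) : E :=
  ω 0 + ∫ s in (0 : ℝ)..t, stepFun γ (stopVel Rad γ ω b) s

lemma norm_stopVel_le {b : E → E} {T M : ℝ} (hRad : Monotone Rad) (hγ : 0 < γ) (hM : 0 ≤ M)
    (hb : ∀ x, ‖x‖ ≤ Rad T → ‖b x‖ ≤ M) {t : ℝ} (ht0 : 0 ≤ t) (ht : t ≤ T) :
    ‖stepFun γ (stopVel Rad γ ω b) t‖ ≤ M := by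
  unfold stepFun stopVel
  by_cases h : Alive Rad γ ω ⌊t / γ⌋₊
  · rw [aliveInd_of_alive h, one_smul]
    refine hb _ ((h _ le_rfl).trans (hRad ?_))
    refine le_trans ?_ ht
    have := Nat.floor_le (div_nonneg ht0 hγ.le)
    rwa [le_div_iff₀ hγ] at this
  · rw [aliveInd_of_not_alive h, zero_smul, norm_zero]; exact hM

lemma norm_driftPath_sub_le {b : E → E} {T M : ℝ} (hRad : Monotone Rad) (hγ : 0 < γ) (hM : 0 ≤ M)
    (hb : ∀ x, ‖x‖ ≤ Rad T → ‖b x‖ ≤ M) {s t : ℝ} (hs : s ∈ Icc 0 T) (ht : t ∈ Icc 0 T) :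
    ‖driftPath Rad γ ω b t - driftPath Rad γ ω b s‖ ≤ M * |t - s| := by
  have : driftPath Rad γ ω b t - driftPath Rad γ ω b s =
      ∫ r in s..t, stepFun γ (stopVel Rad γ ω b) r := by
    rw [driftPath, driftPath, add_sub_add_left_eq_sub, intervalIntegral.integral_interval_sub_left]
      <;> exact intervalIntegrable_stepFun hγ _ _ _
  rw [this]
  refine intervalIntegral.norm_integral_le_of_norm_le_const fun r hr => ?_
  rw [uIoc, mem_Ioc] at hr
  exact norm_stopVel_le hRad hγ hM hb ((le_min hs.1 ht.1).trans hr.1.le)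
    (hr.2.trans (max_le hs.2 ht.2))

lemma continuous_driftPath {b : E → E} (hγ : 0 < γ) : Continuous (driftPath Rad γ ω b) :=
  continuous_const.add (intervalIntegral.continuous_primitive
    (fun _ _ => intervalIntegrable_stepFun hγ _ _ _) 0)

variable [CompleteSpace E]

/-- At grid times the integral of the step velocity is exactly the stopped sum of `γ • b`, so the
stopped path splits without remainder into drift and accumulated noise. Between grid times only an
error of order `γ` is added. -/
lemma stopped_eq_driftPath_add (b : E → E) (hγ : 0 < γ) (n : ℕ) :
    stopped Rad γ ω n = driftPath Rad γ ω b (n * γ) + stopErr Rad γ ω b n := by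
  rw [driftPath, integral_stepFun hγ, stopped, stopErr, add_assoc, Finset.smul_sum,
    ← Finset.sum_add_distrib]
  congr 1
  refine Finset.sum_congr rfl fun l _ => ?_
  rw [stopVel, smul_comm γ, ← smul_add]
  congr 1
  abel

lemma norm_stopped_sub_driftPath_le {b : E → E} {T M : ℝ} (hRad : Monotone Rad) (hγ : 0 < γ)
    (hM : 0 ≤ M) (hb : ∀ x, ‖x‖ ≤ Rad T → ‖b x‖ ≤ M) {t : ℝ} (ht0 : 0 ≤ t) (ht : t ≤ T) :
    ‖stepFun γ (stopped Rad γ ω) t - driftPath Rad γ ω b t‖ ≤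
      stepFun γ (fun i => ‖stopErr Rad γ ω b i‖) t + M * γ := by
  set n := ⌊t / γ⌋₊ with hn
  have h1 : (n : ℝ) * γ ≤ t := by
    have := Nat.floor_le (div_nonneg ht0 hγ.le)
    rwa [le_div_iff₀ hγ] at this
  have h2 : t < ((n : ℝ) + 1) * γ := by
    have := Nat.lt_floor_add_one (t / γ)
    rwa [div_lt_iff₀ hγ] at this
  have h3 : stepFun γ (stopped Rad γ ω) t = stopped Rad γ ω n := rfl
  have h4 : stepFun γ (fun i => ‖stopErr Rad γ ω b i‖) t = ‖stopErr Rad γ ω b n‖ := rfl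
  rw [h3, h4, stopped_eq_driftPath_add b hγ]
  have h5 := norm_driftPath_sub_le (ω := ω) hRad hγ hM hb (s := t) (t := n * γ) ⟨ht0, ht⟩
    ⟨by positivity, h1.trans ht⟩
  have h6 : |(n : ℝ) * γ - t| ≤ γ := by rw [abs_le]; constructor <;> linarith
  calc ‖driftPath Rad γ ω b (n * γ) + stopErr Rad γ ω b n - driftPath Rad γ ω b t‖
      = ‖stopErr Rad γ ω b n + (driftPath Rad γ ω b (n * γ) - driftPath Rad γ ω b t)‖ := by
        congr 1; abel
    _ ≤ ‖stopErr Rad γ ω b n‖ + M * |(n : ℝ) * γ - t| := (norm_add_le _ _).trans (by gcongr)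
    _ ≤ _ := by gcongr

lemma integral_norm_stopped_sub_driftPath_le {b : E → E} {T M : ℝ} (hT : 0 ≤ T)
    (hRad : Monotone Rad) (hγ : 0 < γ)
    (hM : 0 ≤ M) (hb : ∀ x, ‖x‖ ≤ Rad T → ‖b x‖ ≤ M) :
    ∫ t in (0 : ℝ)..T, ‖stepFun γ (stopped Rad γ ω) t - driftPath Rad γ ω b t‖ ≤
      γ * ∑ i ∈ Finset.range (⌊T / γ⌋₊ + 1), ‖stopErr Rad γ ω b i‖ + T * (M * γ) := by
  have hI : ∀ a c : ℝ, IntervalIntegrable (stepFun γ fun i => ‖stopErr Rad γ ω b i‖) volume a c :=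
    fun a c => intervalIntegrable_stepFun hγ _ _ _
  calc ∫ t in (0 : ℝ)..T, ‖stepFun γ (stopped Rad γ ω) t - driftPath Rad γ ω b t‖
      ≤ ∫ t in (0 : ℝ)..T, (stepFun γ (fun i => ‖stopErr Rad γ ω b i‖) t + M * γ) := by
        refine intervalIntegral.integral_mono_on hT ?_ ?_ fun t ht =>
          norm_stopped_sub_driftPath_le hRad hγ hM hb ht.1 ht.2
        · exact ((intervalIntegrable_stepFun hγ _ _ _).sub
            ((continuous_driftPath hγ).intervalIntegrable _ _)).norm
        · exact (hI _ _).add intervalIntegrable_const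
    _ = (∫ t in (0 : ℝ)..T, stepFun γ (fun i => ‖stopErr Rad γ ω b i‖) t) + T * (M * γ) := by
        rw [intervalIntegral.integral_add (hI _ _) intervalIntegrable_const,
          intervalIntegral.integral_const]
        simp
    -- Enlarging the interval to the next grid point turns the integral into a finite sum.
    _ ≤ (∫ t in (0 : ℝ)..((⌊T / γ⌋₊ + 1 : ℕ) * γ), stepFun γ (fun i => ‖stopErr Rad γ ω b i‖) t) +
          T * (M * γ) := by
        gcongr
        refine intervalIntegral.integral_mono_interval le_rfl hT ?_ ?_ (hI _ _)
        · have := Nat.lt_floor_add_one (T / γ)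
          rw [div_lt_iff₀ hγ] at this
          push_cast; exact this.le
        · exact Eventually.of_forall fun t => norm_nonneg _
    _ = _ := by rw [integral_stepFun hγ]; rfl

end StoppedPaths

lemma exists_subseq_ae_tendsto {E : Type*} [NormedAddCommGroup E] {T : ℝ} (hT : 0 ≤ T)
    (u : ℕ → ℝ → E) (x : ℝ → E) (hu : ∀ k, IntervalIntegrable (u k) volume 0 T)
    (hx : IntervalIntegrable x volume 0 T)
    (h : Tendsto (fun k => ∫ t in (0 : ℝ)..T, ‖u k t - x t‖) atTop (𝓝 0)) :
    ∃ ψ : ℕ → ℕ, StrictMono ψ ∧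
      ∀ᵐ t ∂(volume.restrict (Ioc 0 T)), Tendsto (fun k => u (ψ k) t) atTop (𝓝 (x t)) := by
  have h1 : ∀ k, Integrable (u k) (volume.restrict (Ioc 0 T)) := fun k =>
    (intervalIntegrable_iff_integrableOn_Ioc_of_le hT).1 (hu k)
  have h2 : Integrable x (volume.restrict (Ioc 0 T)) :=
    (intervalIntegrable_iff_integrableOn_Ioc_of_le hT).1 hx
  refine (tendstoInMeasure_of_tendsto_eLpNorm one_ne_zero (fun k => (h1 k).1) h2.1
    ?_).exists_seq_tendsto_ae
  have h3 : ∀ k, eLpNorm (u k - x) 1 (volume.restrict (Ioc 0 T)) =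
      ENNReal.ofReal (∫ t in (0 : ℝ)..T, ‖u k t - x t‖) := fun k => by
    rw [intervalIntegral.integral_of_le hT, eLpNorm_one_eq_lintegral_enorm,
      ← ofReal_integral_norm_eq_lintegral_enorm ((h1 k).sub h2)]
    rfl
  simp only [h3]
  simpa using ENNReal.tendsto_ofReal h

/-! ### Limits of stopped paths solve the inclusion while they are not stopped. -/

section RMConsequences

variable {N : ℕ} {Ξ : Type*} [MeasurableSpace Ξ] {γ₀ : ℝ} {μ : Measure Ξ}
  {P : Ioo (0 : ℝ) γ₀ → Kernel (EuclideanSpace ℝ (Fin N)) (EuclideanSpace ℝ (Fin N))}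
  {h : Ioo (0 : ℝ) γ₀ → Ξ → EuclideanSpace ℝ (Fin N) → EuclideanSpace ℝ (Fin N)}
  {H : Ξ → EuclideanSpace ℝ (Fin N) → Set (EuclideanSpace ℝ (Fin N))}

lemma RM.exists_moment_bound (hRM : RM μ P h H) (R : ℝ) :
    ∃ ε : ℝ, 0 < ε ∧ ∃ M : ℝ≥0∞, M ≠ ∞ ∧ ∀ (γ : Ioo (0 : ℝ) γ₀) x, ‖x‖ ≤ R →
      ∫⁻ y, ‖(γ : ℝ)⁻¹ • (y - x)‖ₑ ^ (1 + ε) ∂(P γ x) ≤ M ∧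
      ∫⁻ s, ‖h γ s x‖ₑ ^ (1 + ε) ∂μ ≤ M := by
  obtain ⟨ε, hε, h1, h2⟩ := hRM.moments (Metric.closedBall 0 R) (isCompact_closedBall 0 R)
  refine ⟨ε, hε, _, (max_lt h1 h2).ne, fun γ x hx => ⟨?_, ?_⟩⟩
  · refine le_trans ?_ (le_max_left _ _)
    exact le_iSup₂_of_le x (mem_closedBall_zero_iff.2 hx)
      (le_iSup (fun γ : Ioo (0 : ℝ) γ₀ => ∫⁻ y, ‖(γ : ℝ)⁻¹ • (y - x)‖ₑ ^ (1 + ε) ∂(P γ x)) γ)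
  · refine le_trans ?_ (le_max_right _ _)
    exact le_iSup₂_of_le x (mem_closedBall_zero_iff.2 hx)
      (le_iSup (fun γ : Ioo (0 : ℝ) γ₀ => ∫⁻ s, ‖h γ s x‖ₑ ^ (1 + ε) ∂μ) γ)

lemma norm_integral_le_of_lintegral_rpow_le {Ω F : Type*} [MeasurableSpace Ω]
    [NormedAddCommGroup F] [NormedSpace ℝ F] (m : Measure Ω) [IsProbabilityMeasure m] (v : Ω → F)
    {ε : ℝ} (hε : 0 < ε) {M : ℝ≥0∞} (hM : M ≠ ∞) (hvM : ∫⁻ ω, ‖v ω‖ₑ ^ (1 + ε) ∂m ≤ M) :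
    ‖∫ ω, v ω ∂m‖ ≤ (1 + M).toReal := by
  have h1 : ‖∫ ω, v ω ∂m‖ₑ ≤ 1 + M := by
    refine (enorm_integral_le_lintegral_enorm v).trans ?_
    calc ∫⁻ ω, ‖v ω‖ₑ ∂m ≤ ∫⁻ ω, (1 + ‖v ω‖ₑ ^ (1 + ε)) ∂m := by
          refine lintegral_mono fun ω => ?_
          rcases le_total ‖v ω‖ₑ 1 with h | h
          · exact h.trans le_self_add
          · calc ‖v ω‖ₑ = ‖v ω‖ₑ ^ (1 : ℝ) := (ENNReal.rpow_one _).symm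
              _ ≤ ‖v ω‖ₑ ^ (1 + ε) := ENNReal.rpow_le_rpow_of_exponent_le h (by linarith)
              _ ≤ _ := le_add_self
      _ = 1 + ∫⁻ ω, ‖v ω‖ₑ ^ (1 + ε) ∂m := by
          rw [lintegral_add_left measurable_const]; simp
      _ ≤ 1 + M := by gcongr
  rw [← toReal_enorm]
  exact ENNReal.toReal_mono (ENNReal.add_ne_top.2 ⟨by simp, hM⟩) h1

/-- The mean drift. -/
noncomputable def meanDrift (μ : Measure Ξ)
    (h : Ioo (0 : ℝ) γ₀ → Ξ → EuclideanSpace ℝ (Fin N) → EuclideanSpace ℝ (Fin N))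
    (γ : Ioo (0 : ℝ) γ₀) (x : EuclideanSpace ℝ (Fin N)) : EuclideanSpace ℝ (Fin N) :=
  ∫ s, h γ s x ∂μ

lemma RM.exists_meanDrift_bound [IsProbabilityMeasure μ] (hRM : RM μ P h H) (R : ℝ) :
    ∃ M : ℝ, 0 ≤ M ∧ ∀ (γ : Ioo (0 : ℝ) γ₀) x, ‖x‖ ≤ R → ‖meanDrift μ h γ x‖ ≤ M := by
  obtain ⟨ε, hε, M, hM, hb⟩ := hRM.exists_moment_bound R
  exact ⟨_, ENNReal.toReal_nonneg, fun γ x hx =>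
    norm_integral_le_of_lintegral_rpow_le μ _ hε hM (hb γ x hx).2⟩

/-- The limit of the interpolated paths solves the inclusion as long as the discrete paths have not
been stopped. -/
lemma RM.ae_hasDerivAt_of_alive [IsProbabilityMeasure μ] (hRM : RM μ P h H) {Rad : ℝ → ℝ}
    (hRad : Monotone Rad)
    (γ : ℕ → Ioo (0 : ℝ) γ₀) (hγ : Tendsto (fun k => (γ k : ℝ)) atTop (𝓝 0))
    (ω : ℕ → ℕ → EuclideanSpace ℝ (Fin N)) (x : ℝ → EuclideanSpace ℝ (Fin N))
    (hxc : Continuous x) {τ : ℝ} (hτ : 0 ≤ τ)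
    (hD : ∀ t, 0 ≤ t → Tendsto (fun k => driftPath Rad (γ k) (ω k) (meanDrift μ h (γ k)) t) atTop
      (𝓝 (x t)))
    (hL1 : Tendsto (fun k => ∫ t in (0 : ℝ)..τ, ‖stepFun (γ k) (stopped Rad (γ k) (ω k)) t - x t‖)
      atTop (𝓝 0))
    (halive : ∀ᶠ k in atTop, Alive Rad (γ k) (ω k) ⌊τ / (γ k : ℝ)⌋₊) :
    ∀ᵐ t ∂(volume.restrict (Ioo 0 τ)), ∃ v ∈ selectionIntegral μ (fun s => H s (x t)),
      HasDerivAt x v t := by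
  obtain ⟨ψ, hψ, hae⟩ := exists_subseq_ae_tendsto hτ _ x
    (fun k => intervalIntegrable_stepFun (γ k).2.1 _ _ _) (hxc.intervalIntegrable _ _) hL1
  obtain ⟨n, hn⟩ := eventually_atTop.1 halive
  -- Dropping `n` terms makes every remaining path alive on the whole interval, so stopping can be
  -- ignored and the moment bound on the ball of radius `Rad τ` applies at every time.
  set φ : ℕ → ℕ := fun k => ψ (k + n) with hφ
  have hφt : Tendsto φ atTop atTop := hψ.tendsto_atTop.comp (tendsto_add_atTop_nat n)
  have hal : ∀ k, ∀ t ≤ τ, Alive Rad (γ (φ k)) (ω (φ k)) ⌊t / (γ (φ k) : ℝ)⌋₊ := fun k t ht =>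
    (hn (φ k) ((Nat.le_add_left n k).trans (hψ.id_le _))).mono
      (Nat.floor_le_floor (div_le_div_of_nonneg_right ht (γ (φ k)).2.1.le))
  have hst : ∀ k, ∀ t ≤ τ, stepFun (γ (φ k)) (stopped Rad (γ (φ k)) (ω (φ k))) t =
      ω (φ k) ⌊t / (γ (φ k) : ℝ)⌋₊ := fun k t ht => stopped_eq (hal k t ht)
  obtain ⟨ε, hε, M, hM, hb⟩ := hRM.exists_moment_bound (Rad τ)
  refine ae_hasDerivAt_mem_selectionIntegral μ (fun k => h (γ (φ k)))
    (fun k => hRM.measurable_h _) H hRM.closed_convex ?_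
    (fun k => stepFun (γ (φ k)) (stopped Rad (γ (φ k)) (ω (φ k))))
    (fun k => (stronglyMeasurable_stepFun _ _).measurable) x τ hτ ?_ hε hM ?_ ?_
  · filter_upwards [hRM.tendsto_h] with s hs u u' hu
    exact hs u (fun k => γ (φ k)) u' hu (hγ.comp hφt)
  · filter_upwards [hae] with t ht
    exact ht.comp (tendsto_add_atTop_nat n)
  · intro k t ht
    rw [hst k t ht.2]
    refine (hb _ _ ((hal k t ht.2 _ le_rfl).trans (hRad ?_))).2
    have := Nat.floor_le (div_nonneg ht.1.le (γ (φ k)).2.1.le)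
    rw [le_div_iff₀ (γ (φ k)).2.1] at this
    exact this.trans ht.2
  · intro t ht
    have h1 := ((hD t ht.1).sub (hD 0 le_rfl)).comp hφt
    refine h1.congr fun k => ?_
    simp only [Function.comp, driftPath]
    rw [intervalIntegral.integral_same, add_zero, add_sub_cancel_left]
    rw [intervalIntegral.integral_of_le ht.1, intervalIntegral.integral_of_le ht.1]
    refine setIntegral_congr_fun measurableSet_Ioc fun r hr => ?_
    have hr' : r ≤ τ := hr.2.trans ht.2
    simp only [hst k r hr']
    simp only [stepFun, stopVel, aliveInd_of_alive (hal k r hr'), one_smul]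
    rfl

end RMConsequences

/-- The average of the first `K` values. -/
noncomputable def blockAvg {E : Type*} [AddCommGroup E] [Module ℝ E] (K : ℕ) (ω : ℕ → E) : E :=
  (K : ℝ)⁻¹ • ∑ i ∈ Finset.range K, ω i

/-- With `m * ⌈1 / γ⌉` terms the block lasts `S k`, which lies between `m` and `m * (1 + γ)`. The
block average is therefore a time average of the step path over an interval shrinking to `[0, m]`,
and `L¹` convergence on `[0, m + 1]` suffices. -/
lemma tendsto_blockAvg {E : Type*} [NormedAddCommGroup E] [NormedSpace ℝ E] [CompleteSpace E]
    {Rad : ℝ → ℝ} (γ : ℕ → ℝ) (hγ0 : ∀ k, 0 < γ k) (hγ : Tendsto γ atTop (𝓝 0)) (ω : ℕ → ℕ → E)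
    (x : C(ℝ≥0, E))
    (hL1 : ∀ T : ℝ, 0 ≤ T → Tendsto (fun k => ∫ t in (0 : ℝ)..T,
      ‖stepFun (γ k) (stopped Rad (γ k) (ω k)) t - pathExt x t‖) atTop (𝓝 0))
    (halive : ∀ T : ℝ, 0 ≤ T → ∀ᶠ k in atTop, Alive Rad (γ k) (ω k) ⌊T / γ k⌋₊)
    {m : ℕ} (hm : 0 < m) :
    Tendsto (fun k => blockAvg (m * ⌈(γ k)⁻¹⌉₊) (ω k)) atTop (𝓝 (aver x m)) := by
  have hm' : (0 : ℝ) < m := by exact_mod_cast hm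
  set S : ℕ → ℝ := fun k => ((m * ⌈(γ k)⁻¹⌉₊ : ℕ) : ℝ) * γ k with hS
  have hSlow : ∀ k, (m : ℝ) ≤ S k := fun k => by
    have h1 : (γ k)⁻¹ ≤ ⌈(γ k)⁻¹⌉₊ := Nat.le_ceil _
    have h2 : 1 ≤ (⌈(γ k)⁻¹⌉₊ : ℝ) * γ k := by
      have := mul_le_mul_of_nonneg_right h1 (hγ0 k).le
      rwa [inv_mul_cancel₀ (hγ0 k).ne'] at this
    simp only [hS]; push_cast
    nlinarith
  have hSup : ∀ k, S k ≤ m * (1 + γ k) := fun k => by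
    have h1 : (⌈(γ k)⁻¹⌉₊ : ℝ) < (γ k)⁻¹ + 1 := Nat.ceil_lt_add_one (inv_nonneg.2 (hγ0 k).le)
    have h2 : (⌈(γ k)⁻¹⌉₊ : ℝ) * γ k ≤ 1 + γ k := by
      have := mul_le_mul_of_nonneg_right h1.le (hγ0 k).le
      rwa [add_mul, inv_mul_cancel₀ (hγ0 k).ne', one_mul] at this
    simp only [hS]; push_cast
    nlinarith
  have hSlim : Tendsto S atTop (𝓝 m) := by
    refine tendsto_of_tendsto_of_tendsto_of_le_of_le tendsto_const_nhds ?_ hSlow hSup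
    have := (hγ.const_add 1).const_mul (m : ℝ)
    simpa using this
  set T : ℝ := m + 1 with hT
  have hSle : ∀ᶠ k in atTop, S k ≤ T :=
    (hSlim.eventually (gt_mem_nhds (by simp [hT] : (m : ℝ) < T))).mono fun k hk => hk.le
  have hint : ∀ k a b, IntervalIntegrable (stepFun (γ k) (stopped Rad (γ k) (ω k))) volume a b :=
    fun k a b => intervalIntegrable_stepFun (hγ0 k) _ _ _
  have hxint : ∀ a b, IntervalIntegrable (pathExt x) volume a b := fun a b =>
    (continuous_pathExt x).intervalIntegrable a b
  -- the block average as a time average of the step path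
  have heq : ∀ᶠ k in atTop, blockAvg (m * ⌈(γ k)⁻¹⌉₊) (ω k) =
      (S k)⁻¹ • ∫ t in (0 : ℝ)..(S k), stepFun (γ k) (stopped Rad (γ k) (ω k)) t := by
    filter_upwards [halive T (by positivity), hSle] with k hk hSk
    simp only [hS]
    rw [integral_stepFun (hγ0 k), smul_smul, mul_inv, mul_assoc, inv_mul_cancel₀ (hγ0 k).ne',
      mul_one, blockAvg]
    congr 1
    refine Finset.sum_congr rfl fun i hi => (stopped_eq (hk.mono ?_)).symm
    rw [Nat.le_floor_iff (by have := hγ0 k; positivity), le_div_iff₀ (hγ0 k)]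
    have h1 : (i : ℝ) ≤ (m * ⌈(γ k)⁻¹⌉₊ : ℕ) := by exact_mod_cast (Finset.mem_range.1 hi).le
    exact (mul_le_mul_of_nonneg_right h1 (hγ0 k).le).trans hSk
  refine Tendsto.congr' (heq.mono fun k hk => hk.symm) ?_
  have haver : aver x m = (m : ℝ)⁻¹ • ∫ t in (0 : ℝ)..m, pathExt x t := by
    change averFun x m = _
    rw [averFun, if_neg (by exact_mod_cast hm.ne')]
    simp
  rw [haver]
  refine (hSlim.inv₀ hm'.ne').smul ?_
  have hlim : Tendsto (fun k => ∫ t in (0 : ℝ)..(S k), pathExt x t) atTop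
      (𝓝 (∫ t in (0 : ℝ)..m, pathExt x t)) :=
    ((intervalIntegral.continuous_primitive hxint 0).tendsto _).comp hSlim
  have hdiff : Tendsto (fun k => (∫ t in (0 : ℝ)..(S k),
      stepFun (γ k) (stopped Rad (γ k) (ω k)) t) - ∫ t in (0 : ℝ)..(S k), pathExt x t) atTop
      (𝓝 0) := by
    refine squeeze_zero_norm' ?_ (hL1 T (by positivity))
    filter_upwards [hSle] with k hSk
    have hS0 : 0 ≤ S k := hm'.le.trans (hSlow k)
    rw [← intervalIntegral.integral_sub (hint k _ _) (hxint _ _)]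
    refine (intervalIntegral.norm_integral_le_integral_norm hS0).trans ?_
    exact intervalIntegral.integral_mono_interval le_rfl hS0 hSk
      (Eventually.of_forall fun t => norm_nonneg _) ((hint k _ _).sub (hxint _ _)).norm
  have := hdiff.add hlim
  simpa using this

/-! ### Subsequential limits of discrete paths are global solutions. -/

section LimitPath

variable {N : ℕ} {Ξ : Type*} [MeasurableSpace Ξ] {γ₀ : ℝ} {μ : Measure Ξ} [IsProbabilityMeasure μ]
  {P : Ioo (0 : ℝ) γ₀ → Kernel (EuclideanSpace ℝ (Fin N)) (EuclideanSpace ℝ (Fin N))}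
  {h : Ioo (0 : ℝ) γ₀ → Ξ → EuclideanSpace ℝ (Fin N) → EuclideanSpace ℝ (Fin N)}
  {H : Ξ → EuclideanSpace ℝ (Fin N) → Set (EuclideanSpace ℝ (Fin N))}

/-- Subsequences of the drift paths converge, and the stopped paths follow. -/
lemma RM.exists_subseq_tendsto_driftPath (hRM : RM μ P h H) {Rad : ℝ → ℝ} (hRad : Monotone Rad)
    (γ : ℕ → Ioo (0 : ℝ) γ₀) (hγ : Tendsto (fun k => (γ k : ℝ)) atTop (𝓝 0))
    (ω : ℕ → ℕ → EuclideanSpace ℝ (Fin N)) {r : ℝ} (h0 : ∀ k, ‖ω k 0‖ ≤ r)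
    (herr : ∀ T : ℕ, Tendsto (fun k => (γ k : ℝ) * ∑ i ∈ Finset.range (⌊T / (γ k : ℝ)⌋₊ + 1),
      ‖stopErr Rad (γ k) (ω k) (meanDrift μ h (γ k)) i‖) atTop (𝓝 0)) :
    ∃ φ : ℕ → ℕ, StrictMono φ ∧ ∃ x : C(ℝ≥0, EuclideanSpace ℝ (Fin N)), ‖x 0‖ ≤ r ∧
      (∀ T : ℝ, 0 < T → ∃ K, LipschitzOnWith K (pathExt x) (Icc 0 T)) ∧
      (∀ t, 0 ≤ t → Tendsto (fun k => driftPath Rad (γ (φ k)) (ω (φ k))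
        (meanDrift μ h (γ (φ k))) t) atTop (𝓝 (pathExt x t))) ∧
      ∀ T : ℝ, 0 ≤ T → Tendsto (fun k => ∫ t in (0 : ℝ)..T,
        ‖stepFun (γ (φ k)) (stopped Rad (γ (φ k)) (ω (φ k))) t - pathExt x t‖) atTop (𝓝 0) := by
  -- Freezing bounds the velocity on `[0, T]` by `M T` for every path and every step size, so the
  -- drift paths lie in one Arzelà–Ascoli compact set.
  choose M hM0 hM using fun T : ℕ => hRM.exists_meanDrift_bound (Rad T)
  set D : ℕ → ℝ → EuclideanSpace ℝ (Fin N) := fun k =>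
    driftPath Rad (γ k) (ω k) (meanDrift μ h (γ k)) with hDdef
  have hDc : ∀ k, Continuous (D k) := fun k => continuous_driftPath (γ k).2.1
  have hDlip : ∀ k (T : ℕ) s t, s ∈ Icc (0 : ℝ) T → t ∈ Icc (0 : ℝ) T →
      ‖D k t - D k s‖ ≤ M T * |t - s| := fun k T s t hs ht =>
    norm_driftPath_sub_le hRad (γ k).2.1 (hM0 T) (hM T (γ k)) hs ht
  have hD0 : ∀ k, D k 0 = ω k 0 := fun k => by simp [hDdef, driftPath]
  let Dp : ℕ → C(ℝ≥0, EuclideanSpace ℝ (Fin N)) := fun k =>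
    ⟨fun t => D k t, (hDc k).comp NNReal.continuous_coe⟩
  have hmem : ∀ k, Dp k ∈ {x : C(ℝ≥0, EuclideanSpace ℝ (Fin N)) | ‖x 0‖ ≤ r ∧
      ∀ T : ℕ, ∀ s t : ℝ≥0, s ≤ T → t ≤ T → dist (x s) (x t) ≤ M T * dist s t} := by
    intro k
    refine ⟨?_, fun T s t hs ht => ?_⟩
    · change ‖D k ((0 : ℝ≥0) : ℝ)‖ ≤ r
      rw [NNReal.coe_zero, hD0]; exact h0 k
    · rw [dist_eq_norm, NNReal.dist_eq]
      exact hDlip k T t s ⟨t.2, by exact_mod_cast ht⟩ ⟨s.2, by exact_mod_cast hs⟩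
  obtain ⟨x, hx, φ, hφ, hlim⟩ := (isCompact_lipschitz_paths r M).tendsto_subseq hmem
  have hpt : ∀ t, 0 ≤ t → Tendsto (fun k => D (φ k) t) atTop (𝓝 (pathExt x t)) := by
    intro t ht
    have h1 := ((ContinuousEvalConst.continuous_eval_const t.toNNReal).tendsto x).comp hlim
    refine h1.congr fun k => ?_
    change D (φ k) (t.toNNReal : ℝ) = _
    rw [Real.coe_toNNReal _ ht]
  refine ⟨φ, hφ, x, hx.1, fun T hT => ?_, hpt, fun T hT => ?_⟩
  · obtain ⟨n, hn⟩ := exists_nat_ge T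
    refine ⟨⟨M n, hM0 n⟩, LipschitzOnWith.of_dist_le_mul fun s hs t ht => ?_⟩
    have hb : ∀ s ∈ Icc 0 T, s.toNNReal ≤ (n : ℝ≥0) := fun s hs => by
      rw [Real.toNNReal_le_iff_le_coe]; push_cast; exact hs.2.trans hn
    have h1 := hx.2 n s.toNNReal t.toNNReal (hb s hs) (hb t ht)
    rwa [NNReal.dist_eq, Real.coe_toNNReal _ hs.1, Real.coe_toNNReal _ ht.1,
      ← Real.dist_eq] at h1
  · obtain ⟨n, hn⟩ := exists_nat_ge T
    have hγφ := hγ.comp hφ.tendsto_atTop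
    -- the drift paths converge in `L¹`
    have hA : Tendsto (fun k => ∫ t in (0 : ℝ)..T, ‖D (φ k) t - pathExt x t‖) atTop (𝓝 0) := by
      have h1 : Tendsto (fun k => ∫ t in (0 : ℝ)..T, ‖D (φ k) t - pathExt x t‖) atTop
          (𝓝 (∫ t in (0 : ℝ)..T, (0 : ℝ))) := by
        refine intervalIntegral.tendsto_integral_filter_of_dominated_convergence
          (fun t => (r + M n * n) + ‖pathExt x t‖) ?_ ?_ ?_ ?_
        · exact Eventually.of_forall fun k =>
            ((hDc _).sub (continuous_pathExt x)).norm.aestronglyMeasurable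
        · refine Eventually.of_forall fun k => Eventually.of_forall fun t ht => ?_
          rw [uIoc_of_le hT] at ht
          rw [norm_norm]
          refine (norm_sub_le _ _).trans ?_
          gcongr
          have h2 := hDlip (φ k) n 0 t ⟨le_rfl, Nat.cast_nonneg n⟩ ⟨ht.1.le, ht.2.trans hn⟩
          rw [hD0, sub_zero, abs_of_pos ht.1] at h2
          have h3 : ‖D (φ k) t‖ ≤ ‖ω (φ k) 0‖ + ‖D (φ k) t - ω (φ k) 0‖ := by
            have := norm_add_le (ω (φ k) 0) (D (φ k) t - ω (φ k) 0)
            simpa using this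
          have h4 : M n * t ≤ M n * n := mul_le_mul_of_nonneg_left (ht.2.trans hn) (hM0 n)
          linarith [h0 (φ k)]
        · exact (continuous_const.add (continuous_pathExt x).norm).intervalIntegrable _ _
        · refine Eventually.of_forall fun t ht => ?_
          rw [uIoc_of_le hT] at ht
          have := (hpt t ht.1.le).sub_const (pathExt x t)
          rw [sub_self] at this
          simpa using this.norm
      simpa using h1
    have hB : Tendsto (fun k => ∫ t in (0 : ℝ)..T,
        ‖stepFun (γ (φ k)) (stopped Rad (γ (φ k)) (ω (φ k))) t - D (φ k) t‖) atTop (𝓝 0) := by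
      have h1 : Tendsto (fun k => (γ (φ k) : ℝ) *
          ∑ i ∈ Finset.range (⌊(n : ℝ) / (γ (φ k) : ℝ)⌋₊ + 1),
            ‖stopErr Rad (γ (φ k)) (ω (φ k)) (meanDrift μ h (γ (φ k))) i‖ +
          n * (M n * (γ (φ k) : ℝ))) atTop (𝓝 (0 + n * (M n * 0))) :=
        ((herr n).comp hφ.tendsto_atTop).add ((hγφ.const_mul (M n)).const_mul (n : ℝ))
      have h2 : (0 : ℝ) + n * (M n * 0) = 0 := by ring
      rw [h2] at h1
      refine squeeze_zero (fun k => intervalIntegral.integral_nonneg hT fun _ _ => norm_nonneg _)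
        (fun k => ?_) h1
      refine le_trans ?_ (integral_norm_stopped_sub_driftPath_le (Nat.cast_nonneg n) hRad
        (γ (φ k)).2.1 (hM0 n) (hM n (γ (φ k))))
      exact intervalIntegral.integral_mono_interval le_rfl hT hn
        (Eventually.of_forall fun t => norm_nonneg _)
        ((intervalIntegrable_stepFun (γ (φ k)).2.1 _ _ _).sub
          ((hDc _).intervalIntegrable _ _)).norm
    refine squeeze_zero (fun k => intervalIntegral.integral_nonneg hT fun _ _ => norm_nonneg _)
      (fun k => ?_) (by simpa using hB.add hA)
    have hi1 : IntervalIntegrable (fun t => ‖stepFun (γ (φ k))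
        (stopped Rad (γ (φ k)) (ω (φ k))) t - D (φ k) t‖) volume 0 T :=
      ((intervalIntegrable_stepFun (γ (φ k)).2.1 _ _ _).sub ((hDc _).intervalIntegrable _ _)).norm
    have hi2 : IntervalIntegrable (fun t => ‖D (φ k) t - pathExt x t‖) volume 0 T :=
      ((hDc _).sub (continuous_pathExt x)).norm.intervalIntegrable _ _
    rw [← intervalIntegral.integral_add hi1 hi2]
    refine intervalIntegral.integral_mono_on hT ?_ (hi1.add hi2) fun t _ => ?_
    · exact ((intervalIntegrable_stepFun (γ (φ k)).2.1 _ _ _).sub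
        ((continuous_pathExt x).intervalIntegrable _ _)).norm
    · exact norm_sub_le_norm_sub_add_norm_sub _ _ _

/-- If the a priori bounds on the solutions are below the stopping radius, then the limit path is
never stopped. -/
lemma RM.eventually_alive (hRM : RM μ P h H) {Rad : ℝ → ℝ} (hRad : Monotone Rad) {r : ℝ}
    (hbound : ∀ a, ‖a‖ ≤ r → ∀ x ∈ solutions (fun x => selectionIntegral μ (fun s => H s x)) a,
      ∀ t : ℝ≥0, ‖x t‖ + 1 ≤ Rad (t - 1))
    (γ : ℕ → Ioo (0 : ℝ) γ₀) (hγ : Tendsto (fun k => (γ k : ℝ)) atTop (𝓝 0))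
    (ω : ℕ → ℕ → EuclideanSpace ℝ (Fin N))
    (x : C(ℝ≥0, EuclideanSpace ℝ (Fin N))) (hx0 : ‖x 0‖ ≤ r)
    (hlip : ∀ T : ℝ, 0 < T → ∃ K, LipschitzOnWith K (pathExt x) (Icc 0 T))
    (hD : ∀ t, 0 ≤ t → Tendsto (fun k => driftPath Rad (γ k) (ω k) (meanDrift μ h (γ k)) t) atTop
      (𝓝 (pathExt x t)))
    (hL1 : ∀ T : ℝ, 0 ≤ T → Tendsto (fun k => ∫ t in (0 : ℝ)..T,
        ‖stepFun (γ k) (stopped Rad (γ k) (ω k)) t - pathExt x t‖) atTop (𝓝 0)) (τ : ℝ) :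
    ∀ᶠ k in atTop, Alive Rad (γ k) (ω k) ⌊τ / (γ k : ℝ)⌋₊ := by
  by_contra hτ
  -- `ζ = sSup Z` is the first time at which survival fails along infinitely many indices. The limit
  -- path solves the inclusion before `ζ`, hence is below the radius there by a margin, while the
  -- stopped paths are frozen outside of the ball just after `ζ`.
  set Z : Set ℝ := {t | 0 ≤ t ∧ ∀ᶠ k in atTop, Alive Rad (γ k) (ω k) ⌊t / (γ k : ℝ)⌋₊} with hZ
  have hdown : ∀ s t, 0 ≤ s → s ≤ t → t ∈ Z → s ∈ Z := fun s t hs hst ht =>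
    ⟨hs, ht.2.mono fun k hk => hk.mono
      (Nat.floor_le_floor (div_le_div_of_nonneg_right hst (γ k).2.1.le))⟩
  have hτZ : max τ 0 ∉ Z := fun hmem => hτ (hmem.2.mono fun k hk => hk.mono
      (Nat.floor_le_floor (div_le_div_of_nonneg_right (le_max_left _ _) (γ k).2.1.le)))
  have hbdd : BddAbove Z := ⟨max τ 0, fun t ht => by
    by_contra hlt
    exact hτZ (hdown _ _ (le_max_right _ _) (not_le.1 hlt).le ht)⟩
  set ζ := sSup Z with hζ
  have hζ0 : 0 ≤ ζ := Real.sSup_nonneg fun t ht => ht.1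
  have hlt : ∀ t, 0 ≤ t → t < ζ → t ∈ Z := fun t ht0 ht => by
    have hne : Z.Nonempty := by
      by_contra hne
      rw [not_nonempty_iff_eq_empty] at hne
      rw [hζ, hne, Real.sSup_empty] at ht
      exact absurd ht (not_lt.2 ht0)
    obtain ⟨s, hs, hts⟩ := exists_lt_of_lt_csSup hne ht
    exact hdown _ _ ht0 hts.le hs
  have hgt : ∀ t, ζ < t → t ∉ Z := fun t ht hmem => absurd (le_csSup hbdd hmem) (not_le.2 ht)
  set Z0 : ℝ≥0 := ⟨ζ, hζ0⟩ with hZ0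
  have hZ0c : (Z0 : ℝ) = ζ := rfl
  -- the limit path is a solution before `ζ`
  have hsol : ∀ᵐ t ∂(volume.restrict (Ioo (0 : ℝ) Z0)),
      ∃ v ∈ selectionIntegral μ (fun s => H s (pathExt x t)), HasDerivAt (pathExt x) v t := by
    rw [ae_restrict_iff' measurableSet_Ioo]
    have h1 : ∀ n : ℕ, ∀ᵐ t : ℝ, t ∈ Ioo 0 (ζ - 1 / ((n : ℝ) + 1)) →
        ∃ v ∈ selectionIntegral μ (fun s => H s (pathExt x t)), HasDerivAt (pathExt x) v t := by
      intro n
      have hpos : (0 : ℝ) < 1 / ((n : ℝ) + 1) := by positivity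
      rcases le_total 0 (ζ - 1 / ((n : ℝ) + 1)) with hle | hle
      · rw [← ae_restrict_iff' measurableSet_Ioo]
        exact hRM.ae_hasDerivAt_of_alive hRad γ hγ ω (pathExt x) (continuous_pathExt x) hle hD
          (hL1 _ hle) (hlt _ hle (by linarith)).2
      · exact Eventually.of_forall fun t ht => absurd (ht.1.trans ht.2) (not_lt.2 hle)
    filter_upwards [ae_all_iff.2 h1] with t ht htm
    obtain ⟨n, hn⟩ := exists_nat_one_div_lt (sub_pos.2 htm.2)
    refine ht n ⟨htm.1, ?_⟩
    rw [hZ0c] at hn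
    linarith
  obtain ⟨y, hy⟩ := hRM.solutions_nonempty (x Z0)
  -- The a priori bound concerns solutions on all of `ℝ₊`, so the limit path is first continued past
  -- `ζ`.
  obtain ⟨z, hz, hzx⟩ := exists_solution_concat _ x Z0 hlip hsol y hy
  have hxζ : ‖x Z0‖ + 1 ≤ Rad (ζ - 1) := by
    rw [← hzx Z0 le_rfl]; exact hbound _ hx0 z hz Z0
  -- but after `ζ` the path lies outside of the ball
  have hout : ∀ t, ζ < t → ∃ᶠ k in atTop, ∀ s ≥ t,
      Rad (ζ - 1) ≤ ‖stepFun (γ k) (stopped Rad (γ k) (ω k)) s‖ := by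
    intro t ht
    have h1 : ∃ᶠ k in atTop, ¬ Alive Rad (γ k) (ω k) ⌊t / (γ k : ℝ)⌋₊ := fun hev =>
      hgt t ht ⟨hζ0.trans ht.le, hev.mono fun k hk => not_not.1 hk⟩
    have h2 : ∀ᶠ k in atTop, 0 ≤ ζ - 1 → Alive Rad (γ k) (ω k) ⌊(ζ - 1) / (γ k : ℝ)⌋₊ := by
      rcases le_or_gt 0 (ζ - 1) with hle | hle
      · exact (hlt _ hle (by linarith)).2.mono fun k hk _ => hk
      · exact Eventually.of_forall fun k h => absurd h (not_le.2 hle)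
    -- The delay by `1` in `Rad (ζ - 1)` is used here: the exit time need only be later than `ζ -
    -- 1`, where survival is already known, so no continuity of `Rad` is required. For `ζ < 1`
    -- nonnegativity of time suffices.
    refine (h1.and_eventually h2).mono fun k ⟨hk1, hk2⟩ s hs => ?_
    obtain ⟨z, hz, -, hza, hzn, hst⟩ := exists_stopped_eq_of_not_alive hk1
    have hsz : stepFun (γ k) (stopped Rad (γ k) (ω k)) s = ω k z :=
      hst _ (hz.trans (Nat.floor_le_floor (div_le_div_of_nonneg_right hs (γ k).2.1.le)))
    rw [hsz]
    refine le_trans (hRad ?_) hzn.le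
    rcases le_or_gt 0 (ζ - 1) with hle | hle
    · by_contra hcon
      refine hza ((hk2 hle).mono ?_)
      rw [Nat.le_floor_iff (div_nonneg hle (γ k).2.1.le), le_div_iff₀ (γ k).2.1]
      exact (not_le.1 hcon).le
    · exact hle.le.trans (mul_nonneg (Nat.cast_nonneg _) (γ k).2.1.le)
  have hcont : ∀ᶠ s in 𝓝 ζ, ‖pathExt x s‖ < Rad (ζ - 1) := by
    have h1 : ‖pathExt x ζ‖ < Rad (ζ - 1) := by
      rw [← hZ0c, pathExt_coe, hZ0c]; linarith
    exact ((continuous_pathExt x).norm.tendsto ζ).eventually (gt_mem_nhds h1)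
  obtain ⟨δ, hδ, hball⟩ := Metric.eventually_nhds_iff.1 hcont
  -- On `(t, T)` continuity keeps `x` strictly inside the radius `Rad (ζ - 1)`, whereas an almost
  -- everywhere limit of the frozen paths lies at or beyond it; the interval would have to be null.
  set t := ζ + δ / 2 with ht
  set T := ζ + δ with hT
  have hT0 : 0 ≤ T := by linarith
  obtain ⟨ψ, hψ, hψout⟩ := extraction_of_frequently_atTop (hout t (by linarith))
  obtain ⟨χ, hχ, hae⟩ := exists_subseq_ae_tendsto hT0 _ (pathExt x)
    (fun k => intervalIntegrable_stepFun (γ (ψ k)).2.1 (stopped Rad (γ (ψ k)) (ω (ψ k))) _ _)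
    ((continuous_pathExt x).intervalIntegrable _ _) ((hL1 T hT0).comp hψ.tendsto_atTop)
  have hsub : Ioo t T ⊆ Ioc 0 T := fun s hs => ⟨by linarith [hs.1], hs.2.le⟩
  have hae' : ∀ᵐ s ∂(volume.restrict (Ioo t T)), False := by
    filter_upwards [ae_mono (Measure.restrict_mono hsub le_rfl) hae,
      ae_restrict_mem measurableSet_Ioo] with s hs hsm
    have h1 : Rad (ζ - 1) ≤ ‖pathExt x s‖ :=
      ge_of_tendsto hs.norm (Eventually.of_forall fun k => hψout (χ k) s hsm.1.le)
    have h2 : ‖pathExt x s‖ < Rad (ζ - 1) := by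
      apply hball
      rw [Real.dist_eq, abs_lt]
      constructor <;> linarith [hsm.1, hsm.2]
    exact absurd h1 (not_le.2 h2)
  rw [eventually_false_iff_eq_bot, ae_eq_bot, Measure.restrict_eq_zero, Real.volume_Ioo] at hae'
  rw [ENNReal.ofReal_eq_zero] at hae'
  linarith

/-- Discrete paths whose increments deviate little from the mean drift are asymptotically close to
solutions of the differential inclusion. -/
theorem RM.exists_solution_tendsto_blockAvg (hRM : RM μ P h H) {Rad : ℝ → ℝ}
    (hRad : Monotone Rad) {r : ℝ}
    (hbound : ∀ a, ‖a‖ ≤ r → ∀ x ∈ solutions (fun x => selectionIntegral μ (fun s => H s x)) a,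
      ∀ t : ℝ≥0, ‖x t‖ + 1 ≤ Rad (t - 1))
    (γ : ℕ → Ioo (0 : ℝ) γ₀) (hγ : Tendsto (fun k => (γ k : ℝ)) atTop (𝓝 0))
    (ω : ℕ → ℕ → EuclideanSpace ℝ (Fin N)) (h0 : ∀ k, ‖ω k 0‖ ≤ r)
    (herr : ∀ T : ℕ, Tendsto (fun k => (γ k : ℝ) * ∑ i ∈ Finset.range (⌊T / (γ k : ℝ)⌋₊ + 1),
      ‖stopErr Rad (γ k) (ω k) (meanDrift μ h (γ k)) i‖) atTop (𝓝 0)) :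
    ∃ φ : ℕ → ℕ, StrictMono φ ∧ ∃ a, ∃ x ∈ solutions (fun x => selectionIntegral μ
      (fun s => H s x)) a, ∀ m : ℕ, 0 < m →
        Tendsto (fun k => blockAvg (m * ⌈(γ (φ k) : ℝ)⁻¹⌉₊) (ω (φ k))) atTop (𝓝 (aver x m)) := by
  obtain ⟨φ, hφ, x, hx0, hlip, hD, hL1⟩ :=
    hRM.exists_subseq_tendsto_driftPath hRad γ hγ ω h0 herr
  have hγφ := hγ.comp hφ.tendsto_atTop
  have halive := hRM.eventually_alive hRad hbound (fun k => γ (φ k)) hγφ (fun k => ω (φ k)) x hx0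
    hlip hD hL1
  refine ⟨φ, hφ, x 0, x, ⟨rfl, fun T hT => ?_, ?_⟩, fun m hm =>
    tendsto_blockAvg _ (fun k => (γ (φ k)).2.1) hγφ _ x hL1 (fun T _ => halive T) hm⟩
  · obtain ⟨K, hK⟩ := hlip T hT
    rw [← uIcc_of_le hT.le] at hK
    exact hK.absolutelyContinuousOnInterval
  · rw [ae_restrict_iff' measurableSet_Ioi]
    have h1 : ∀ n : ℕ, ∀ᵐ t : ℝ, t ∈ Ioo (0 : ℝ) n →
        ∃ v ∈ selectionIntegral μ (fun s => H s (pathExt x t)), HasDerivAt (pathExt x) v t :=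
      fun n => by
        rw [← ae_restrict_iff' measurableSet_Ioo]
        exact hRM.ae_hasDerivAt_of_alive hRad _ hγφ _ (pathExt x) (continuous_pathExt x)
          (Nat.cast_nonneg n) hD (hL1 _ (Nat.cast_nonneg n)) (halive n)
    filter_upwards [ae_all_iff.2 h1] with t ht htm
    obtain ⟨n, hn⟩ := exists_nat_gt t
    exact ht n ⟨htm, hn⟩

end LimitPath

/-! ### Von Neumann's mean ergodic theorem for a Hilbertian seminorm. -/

section MeanErgodic

variable {V : Type*} [AddCommGroup V] [Module ℝ V]

/-- The Cesàro means of the iterates of a linear map. -/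
noncomputable def ergodicAvg (U : V →ₗ[ℝ] V) (n : ℕ) : V →ₗ[ℝ] V :=
  (n : ℝ)⁻¹ • ∑ i ∈ Finset.range n, U ^ i

lemma ergodicAvg_apply (U : V →ₗ[ℝ] V) (n : ℕ) (v : V) :
    ergodicAvg U n v = (n : ℝ)⁻¹ • ∑ i ∈ Finset.range n, (U ^ i) v := by
  simp [ergodicAvg]

variable {p : Seminorm ℝ V} {U : V →ₗ[ℝ] V}

lemma seminorm_pow_le (hU : ∀ v, p (U v) ≤ p v) (i : ℕ) (v : V) : p ((U ^ i) v) ≤ p v := by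
  induction i with
  | zero => simp
  | succ i ih => rw [pow_succ', Module.End.mul_apply]; exact (hU _).trans ih

lemma seminorm_ergodicAvg_le (hU : ∀ v, p (U v) ≤ p v) {n : ℕ} (hn : 0 < n) (v : V) :
    p (ergodicAvg U n v) ≤ p v := by
  have hn' : (0 : ℝ) < n := by exact_mod_cast hn
  rw [ergodicAvg_apply, map_smul_eq_mul, Real.norm_of_nonneg (by positivity), inv_mul_le_iff₀ hn']
  have h1 : ∀ s : Finset ℕ, p (∑ i ∈ s, (U ^ i) v) ≤ s.card * p v := by
    intro s
    induction s using Finset.induction_on with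
    | empty => simp
    | insert a s ha ih =>
      rw [Finset.sum_insert ha, Finset.card_insert_of_notMem ha]
      push_cast
      linarith [map_add_le_add p ((U ^ a) v) (∑ i ∈ s, (U ^ i) v), seminorm_pow_le hU a v]
  simpa using h1 (Finset.range n)

lemma seminorm_ergodicAvg_comp_sub_le (hU : ∀ v, p (U v) ≤ p v) (n : ℕ) (v : V) :
    p (ergodicAvg U n (U v) - ergodicAvg U n v) ≤ (n : ℝ)⁻¹ * (2 * p v) := by
  have h1 : ergodicAvg U n (U v) - ergodicAvg U n v = (n : ℝ)⁻¹ • ((U ^ n) v - v) := by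
    rw [ergodicAvg_apply, ergodicAvg_apply, ← smul_sub]
    congr 1
    have : ∀ i, (U ^ i) (U v) = (U ^ (i + 1)) v := fun i => by
      rw [pow_succ, Module.End.mul_apply]
    simp only [this]
    rw [← Finset.sum_sub_distrib, Finset.sum_range_sub (fun i => (U ^ i) v)]
    simp
  rw [h1, map_smul_eq_mul, Real.norm_of_nonneg (by positivity)]
  gcongr
  linarith [map_sub_le_add p ((U ^ n) v) v, seminorm_pow_le hU n v]

/-- Averages asymptotically ignore one application of `U`, since the difference telescopes to two
terms divided by `n`. Iterating and taking convex combinations preserves this. -/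
lemma tendsto_seminorm_ergodicAvg_sub (hU : ∀ v, p (U v) ≤ p v) (f : V) {g : V}
    (hg : g ∈ convexHull ℝ (range fun i : ℕ => (U ^ i) f)) :
    Tendsto (fun n => p (ergodicAvg U n g - ergodicAvg U n f)) atTop (𝓝 0) := by
  have hsub : convexHull ℝ (range fun i : ℕ => (U ^ i) f) ⊆
      {g | Tendsto (fun n => p (ergodicAvg U n g - ergodicAvg U n f)) atTop (𝓝 0)} := by
    refine convexHull_min ?_ ?_
    · rintro _ ⟨i, rfl⟩
      induction i with
      | zero => simp
      | succ i ih =>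
        have h1 : Tendsto (fun n : ℕ => (n : ℝ)⁻¹ * (2 * p ((U ^ i) f)) +
            p (ergodicAvg U n ((U ^ i) f) - ergodicAvg U n f)) atTop (𝓝 0) := by
          have := (tendsto_inv_atTop_nhds_zero_nat (𝕜 := ℝ)).mul_const (2 * p ((U ^ i) f))
          simpa using this.add ih
        refine squeeze_zero (fun n => apply_nonneg p _) (fun n => ?_) h1
        have h2 := seminorm_ergodicAvg_comp_sub_le hU n ((U ^ i) f)
        have h3 : (U ^ (i + 1)) f = U ((U ^ i) f) := by rw [pow_succ', Module.End.mul_apply]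
        simp only [h3]
        calc p (ergodicAvg U n (U ((U ^ i) f)) - ergodicAvg U n f)
            = p ((ergodicAvg U n (U ((U ^ i) f)) - ergodicAvg U n ((U ^ i) f)) +
              (ergodicAvg U n ((U ^ i) f) - ergodicAvg U n f)) := by congr 1; abel
          _ ≤ _ := (map_add_le_add p _ _).trans (by gcongr)
    · intro g hg g' hg' a b ha hb hab
      have h1 := (hg.const_mul a).add (hg'.const_mul b)
      simp only [mul_zero, add_zero] at h1
      refine squeeze_zero (fun n => apply_nonneg p _) (fun n => ?_) h1
      have h2 : ergodicAvg U n (a • g + b • g') - ergodicAvg U n f =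
          a • (ergodicAvg U n g - ergodicAvg U n f) +
          b • (ergodicAvg U n g' - ergodicAvg U n f) := by
        rw [map_add, map_smul, map_smul, smul_sub, smul_sub]
        have : ergodicAvg U n f = a • ergodicAvg U n f + b • ergodicAvg U n f := by
          rw [← add_smul, hab, one_smul]
        conv_lhs => rw [this]
        abel
      rw [h2]
      refine (map_add_le_add p _ _).trans (le_of_eq ?_)
      rw [map_smul_eq_mul, map_smul_eq_mul, Real.norm_of_nonneg ha, Real.norm_of_nonneg hb]
  exact hsub hg

/-- The mean ergodic theorem for a contraction of a Hilbertian seminorm: the Cesàro means form a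
Cauchy sequence. -/
theorem exists_seminorm_ergodicAvg_sub_le
    (hpar : ∀ v w, p (v - w) ^ 2 = 2 * p v ^ 2 + 2 * p w ^ 2 - p (v + w) ^ 2)
    (hU : ∀ v, p (U v) ≤ p v) (f : V) {δ : ℝ} (hδ : 0 < δ) :
    ∃ m₀ : ℕ, ∀ m ≥ m₀, ∀ n ≥ m₀, p (ergodicAvg U m f - ergodicAvg U n f) ≤ δ := by
  set C := convexHull ℝ (range fun i : ℕ => (U ^ i) f) with hC
  have hCne : (p '' C).Nonempty := ⟨_, _, subset_convexHull ℝ _ ⟨0, rfl⟩, rfl⟩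
  have hCbdd : BddBelow (p '' C) := ⟨0, by rintro _ ⟨g, -, rfl⟩; exact apply_nonneg p _⟩
  set a := sInf (p '' C) with ha
  have ha0 : 0 ≤ a := Real.sInf_nonneg (by rintro _ ⟨g, -, rfl⟩; exact apply_nonneg p _)
  have hmem : ∀ n, 0 < n → ergodicAvg U n f ∈ C := by
    intro n hn
    have hn' : (n : ℝ) ≠ 0 := by exact_mod_cast hn.ne'
    rw [ergodicAvg_apply, Finset.smul_sum]
    refine (convex_convexHull ℝ _).sum_mem (fun _ _ => by positivity) ?_
      fun i _ => subset_convexHull ℝ _ ⟨i, rfl⟩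
    simp [hn']
  -- Long averages have seminorm at most `a + 2ε` while their midpoints have at least `a`, so the
  -- parallelogram identity bounds the squared difference by `16aε + 16ε²`, hence by `δ²` for this
  -- `ε`.
  set ε := min 1 (δ ^ 2 / (16 * a + 16)) with hε
  have hε0 : 0 < ε := lt_min one_pos (by positivity)
  obtain ⟨_, ⟨g, hg, rfl⟩, hga⟩ := exists_lt_of_csInf_lt hCne (show a < a + ε by linarith)
  obtain ⟨m₁, hm₁⟩ := eventually_atTop.1
    ((tendsto_seminorm_ergodicAvg_sub hU f hg).eventually (gt_mem_nhds hε0))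
  refine ⟨max m₁ 1, fun m hm n hn => ?_⟩
  -- The average of `f` is close to that of the near-minimiser `g`, and averaging does not increase
  -- the seminorm.
  have hup : ∀ k ≥ max m₁ 1, p (ergodicAvg U k f) ≤ a + 2 * ε := by
    intro k hk
    have h1 := hm₁ k ((le_max_left _ _).trans hk)
    have h2 := seminorm_ergodicAvg_le hU ((le_max_right _ _).trans hk : 0 < k) g
    have h3 : p (ergodicAvg U k f) ≤ p (ergodicAvg U k g) +
        p (ergodicAvg U k g - ergodicAvg U k f) := by
      have := map_sub_le_add p (ergodicAvg U k g) (ergodicAvg U k g - ergodicAvg U k f)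
      rwa [sub_sub_cancel] at this
    linarith
  have hmid : 2 * a ≤ p (ergodicAvg U m f + ergodicAvg U n f) := by
    have h1 : a ≤ p ((2 : ℝ)⁻¹ • ergodicAvg U m f + (2 : ℝ)⁻¹ • ergodicAvg U n f) := by
      refine csInf_le hCbdd ⟨_, ?_, rfl⟩
      exact convex_convexHull ℝ _ (hmem m ((le_max_right _ _).trans hm))
        (hmem n ((le_max_right _ _).trans hn)) (by norm_num) (by norm_num) (by norm_num)
    rw [← smul_add, map_smul_eq_mul, Real.norm_of_nonneg (by norm_num)] at h1
    linarith
  refine abs_le_of_sq_le_sq' ?_ hδ.le |>.2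
  rw [hpar]
  have e1 := pow_le_pow_left₀ (apply_nonneg p _) (hup m hm) 2
  have e2 := pow_le_pow_left₀ (apply_nonneg p _) (hup n hn) 2
  have e3 := pow_le_pow_left₀ (by positivity) hmid 2
  have e4 : ε ≤ 1 := min_le_left _ _
  have e5 : ε * (16 * a + 16) ≤ δ ^ 2 := (le_div_iff₀ (by positivity)).1 (min_le_right _ _)
  nlinarith

end MeanErgodic

/-! ### Mean ergodic theorem for asymptotically stationary sequences. -/

section AsymptoticMeanErgodic

variable {Ω : Type*} [MeasurableSpace Ω] {E : Type*} [NormedAddCommGroup E]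
  [InnerProductSpace ℝ E]

lemma exists_tendsto_of_abs_le (U : Ultrafilter ℕ) (c : ℕ → ℝ) (B : ℝ) (hc : ∀ j, |c j| ≤ B) :
    ∃ l, Tendsto c U (𝓝 l) := by
  have h1 : Icc (-B) B ∈ U.map c := by
    rw [Ultrafilter.mem_map]
    exact Filter.mem_of_superset Filter.univ_mem fun j _ => abs_le.1 (hc j)
  obtain ⟨l, -, hl⟩ := isCompact_Icc.ultrafilter_le_nhds' (U.map c) h1
  exact ⟨l, hl⟩

/-- The combinations `∑ v i • g i` as elements of `L²`. -/
noncomputable def combL2 (m : Measure Ω) (g : ℕ → Ω → E) (hg : ∀ i, MemLp (g i) 2 m) :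
    (ℕ →₀ ℝ) →ₗ[ℝ] Lp E 2 m :=
  Finsupp.linearCombination ℝ fun i => (hg i).toLp (g i)

lemma coeFn_combL2 (m : Measure Ω) (g : ℕ → Ω → E) (hg : ∀ i, MemLp (g i) 2 m) (v : ℕ →₀ ℝ) :
    combL2 m g hg v =ᵐ[m] fun ω => ∑ i ∈ v.support, v i • g i ω := by
  rw [combL2, Finsupp.linearCombination_apply, Finsupp.sum]
  refine (Lp.coeFn_finsetSum _ _).trans ?_
  have h1 : ∀ᵐ ω ∂m, ∀ i, (v i • (hg i).toLp (g i) : Lp E 2 m) ω = v i • g i ω := by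
    refine ae_all_iff.2 fun i => ?_
    filter_upwards [Lp.coeFn_smul (v i) ((hg i).toLp (g i)), (hg i).coeFn_toLp] with ω h1 h2
    rw [h1, Pi.smul_apply, h2]
  filter_upwards [h1] with ω h
  simp only [Finset.sum_apply, h]

lemma norm_combL2_le (m : Measure Ω) [IsProbabilityMeasure m] (g : ℕ → Ω → E)
    (hg : ∀ i, MemLp (g i) 2 m) {L : ℝ} (hL : ∀ i ω, ‖g i ω‖ ≤ L) (v : ℕ →₀ ℝ) :
    ‖combL2 m g hg v‖ ≤ ∑ i ∈ v.support, |v i| * L := by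
  have hL0 : 0 ≤ L := by
    obtain ⟨ω⟩ : Nonempty Ω := m.nonempty_of_neZero
    exact (norm_nonneg _).trans (hL 0 ω)
  rw [combL2, Finsupp.linearCombination_apply, Finsupp.sum]
  refine (norm_sum_le _ _).trans (Finset.sum_le_sum fun i _ => ?_)
  rw [norm_smul, Real.norm_eq_abs]
  gcongr
  have h1 := Lp.norm_le_of_ae_bound (f := (hg i).toLp (g i)) hL0 (by
    filter_upwards [(hg i).coeFn_toLp] with ω h
    rw [h]; exact hL i ω)
  simpa [measureUnivNNReal] using h1

lemma sq_norm_combL2 (m : Measure Ω) (g : ℕ → Ω → E)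
    (hg : ∀ i, MemLp (g i) 2 m) (v : ℕ →₀ ℝ) :
    ‖combL2 m g hg v‖ ^ 2 = ∫ ω, ‖∑ i ∈ v.support, v i • g i ω‖ ^ 2 ∂m := by
  rw [← real_inner_self_eq_norm_sq, L2.inner_def]
  refine integral_congr_ae ?_
  filter_upwards [coeFn_combL2 m g hg v] with ω h
  rw [h, real_inner_self_eq_norm_sq]

/-- Mean ergodic theorem for asymptotically stationary bounded random variables. -/
theorem exists_forall_integral_norm_avg_sub_le [MeasurableSpace E] [BorelSpace E]
    [SecondCountableTopology E] (𝒰 : Ultrafilter ℕ) (Q : ℕ → Measure Ω)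
    [∀ j, IsProbabilityMeasure (Q j)] (θ : ℕ → Ω → Ω)
    (g : ℕ → ℕ → Ω → E) (hg : ∀ j i, Measurable (g j i)) (L : ℝ) (hL : ∀ j i ω, ‖g j i ω‖ ≤ L)
    (hθ : ∀ j i ω, g j (i + 1) ω = g j i (θ j ω))
    (hinv : ∀ (F : ℕ → Ω → ℝ) (B : ℝ), (∀ j, Measurable (F j)) → (∀ j ω, |F j ω| ≤ B) →
      Tendsto (fun j => ∫ ω, F j (θ j ω) ∂(Q j) - ∫ ω, F j ω ∂(Q j)) 𝒰 (𝓝 0))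
    {δ : ℝ} (hδ : 0 < δ) :
    ∃ m₀ : ℕ, ∀ m ≥ m₀, ∀ n ≥ m₀, ∀ᶠ j in 𝒰, ∫ ω, ‖(m : ℝ)⁻¹ • ∑ i ∈ Finset.range m, g j i ω -
      (n : ℝ)⁻¹ • ∑ i ∈ Finset.range n, g j i ω‖ ∂(Q j) ≤ δ := by
  have hmem : ∀ j i, MemLp (g j i) 2 (Q j) := fun j i =>
    MemLp.of_bound (hg j i).aestronglyMeasurable L (Eventually.of_forall (hL j i))
  set T : ∀ j, (ℕ →₀ ℝ) →ₗ[ℝ] Lp E 2 (Q j) := fun j => combL2 (Q j) (g j) (hmem j) with hT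
  have hTb : ∀ v j, |‖T j v‖| ≤ ∑ i ∈ v.support, |v i| * L := fun v j => by
    rw [abs_norm]; exact norm_combL2_le _ _ _ (hL j) v
  choose N hN using fun v => exists_tendsto_of_abs_le 𝒰 (fun j => ‖T j v‖) _ (hTb v)
  -- All the `L²` spaces are replaced by one space of finite coefficient sequences, seminormed by
  -- the limit of the `L²(Q j)` norms along the ultrafilter. The parallelogram identity survives in
  -- the limit.
  let p : Seminorm ℝ (ℕ →₀ ℝ) := Seminorm.of N
    (fun v w => le_of_tendsto_of_tendsto' (hN (v + w)) ((hN v).add (hN w)) fun j => by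
      rw [map_add]; exact norm_add_le _ _)
    (fun a v => tendsto_nhds_unique (hN (a • v)) (((hN v).const_mul ‖a‖).congr fun j => by
      rw [map_smul, norm_smul]))
  have hp : ∀ v, Tendsto (fun j => ‖T j v‖) 𝒰 (𝓝 (p v)) := hN
  set S : (ℕ →₀ ℝ) →ₗ[ℝ] (ℕ →₀ ℝ) := Finsupp.lmapDomain ℝ ℝ Nat.succ with hS
  have hpar : ∀ v w, p (v - w) ^ 2 = 2 * p v ^ 2 + 2 * p w ^ 2 - p (v + w) ^ 2 := by
    intro v w
    refine tendsto_nhds_unique ((hp (v - w)).pow 2)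
      (((((hp v).pow 2).const_mul 2).add (((hp w).pow 2).const_mul 2)).sub
        ((hp (v + w)).pow 2) |>.congr fun j => ?_)
    rw [map_add, map_sub]
    have := parallelogram_law_with_norm ℝ (T j v) (T j w)
    nlinarith
  have hSsum : ∀ v j ω, ∑ i ∈ (S v).support, S v i • g j i ω =
      ∑ i ∈ v.support, v i • g j (i + 1) ω := by
    intro v j ω
    have h1 := Finsupp.sum_mapDomain_index_inj (f := Nat.succ) (s := v)
      (h := fun i (a : ℝ) => a • g j i ω) Nat.succ_injective
    exact h1
  -- Shifting the coefficients amounts to composing the random variable with `θ j`; asymptotic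
  -- invariance, applied to bounded squared norms, makes the shift an isometry of the limit
  -- seminorm.
  have hSp : ∀ v, p (S v) ≤ p v := by
    intro v
    set B := ∑ i ∈ v.support, |v i| * L with hB
    have hb : ∀ j ω, ‖∑ i ∈ v.support, v i • g j i ω‖ ≤ B := fun j ω => by
      refine (norm_sum_le _ _).trans (Finset.sum_le_sum fun i _ => ?_)
      rw [norm_smul, Real.norm_eq_abs]
      gcongr
      exact hL j i ω
    have h1 := hinv (fun j ω => ‖∑ i ∈ v.support, v i • g j i ω‖ ^ 2) (B ^ 2)
      (fun j => ((Finset.measurable_sum _ fun i _ => (hg j i).const_smul (v i)).norm).pow_const 2)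
      (fun j ω => by
        rw [abs_of_nonneg (by positivity)]
        exact pow_le_pow_left₀ (norm_nonneg _) (hb j ω) 2)
    have h2 : Tendsto (fun j => ‖T j (S v)‖ ^ 2 - ‖T j v‖ ^ 2) 𝒰 (𝓝 0) := by
      refine h1.congr fun j => ?_
      rw [hT]
      simp only
      rw [sq_norm_combL2, sq_norm_combL2]
      congr 1
      refine integral_congr_ae (Eventually.of_forall fun ω => ?_)
      simp only [hSsum, hθ]
    have h3 := tendsto_nhds_unique h2 (((hp (S v)).pow 2).sub ((hp v).pow 2))
    exact abs_le_of_sq_le_sq' (by linarith) (apply_nonneg p v) |>.2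
  obtain ⟨m₀, hm₀⟩ := exists_seminorm_ergodicAvg_sub_le hpar hSp (Finsupp.single 0 1)
    (half_pos hδ)
  refine ⟨m₀, fun m hm n hn => ?_⟩
  have hpow : ∀ i : ℕ, (S ^ i) (Finsupp.single 0 1) = Finsupp.single i (1 : ℝ) := by
    intro i
    induction i with
    | zero => simp
    | succ i ih =>
      rw [pow_succ', Module.End.mul_apply, ih, hS, Finsupp.lmapDomain_apply,
        Finsupp.mapDomain_single]
  have hTavg : ∀ j k, T j (ergodicAvg S k (Finsupp.single 0 1)) =
      (k : ℝ)⁻¹ • ∑ i ∈ Finset.range k, (hmem j i).toLp (g j i) := by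
    intro j k
    rw [ergodicAvg_apply, map_smul, map_sum]
    congr 1
    refine Finset.sum_congr rfl fun i _ => ?_
    rw [hpow, hT]
    simp [combL2]
  have hcoe : ∀ j k, (T j (ergodicAvg S k (Finsupp.single 0 1)) : Ω → E) =ᵐ[Q j]
      fun ω => (k : ℝ)⁻¹ • ∑ i ∈ Finset.range k, g j i ω := by
    intro j k
    rw [hTavg]
    have h1 : ∀ᵐ ω ∂(Q j), ∀ i, (hmem j i).toLp (g j i) ω = g j i ω :=
      ae_all_iff.2 fun i => (hmem j i).coeFn_toLp
    filter_upwards [Lp.coeFn_smul (k : ℝ)⁻¹ (∑ i ∈ Finset.range k, (hmem j i).toLp (g j i)),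
      Lp.coeFn_finsetSum (Finset.range k) (fun i => (hmem j i).toLp (g j i)), h1] with ω e1 e2 e3
    rw [e1, Pi.smul_apply, e2]
    simp only [Finset.sum_apply, e3]
  have hlt : p (ergodicAvg S m (Finsupp.single 0 1) - ergodicAvg S n (Finsupp.single 0 1)) < δ :=
    (hm₀ m hm n hn).trans_lt (half_lt_self hδ)
  filter_upwards [(hp _).eventually (gt_mem_nhds hlt)] with j hj
  refine le_trans ?_ hj.le
  rw [map_sub]
  set w := T j (ergodicAvg S m (Finsupp.single 0 1)) - T j (ergodicAvg S n (Finsupp.single 0 1))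
  have hw : (w : Ω → E) =ᵐ[Q j] fun ω => (m : ℝ)⁻¹ • ∑ i ∈ Finset.range m, g j i ω -
      (n : ℝ)⁻¹ • ∑ i ∈ Finset.range n, g j i ω := by
    filter_upwards [Lp.coeFn_sub (T j (ergodicAvg S m (Finsupp.single 0 1)))
      (T j (ergodicAvg S n (Finsupp.single 0 1))), hcoe j m, hcoe j n] with ω e1 e2 e3
    rw [e1, Pi.sub_apply, e2, e3]
  have h1 : ∫ ω, ‖(m : ℝ)⁻¹ • ∑ i ∈ Finset.range m, g j i ω -
      (n : ℝ)⁻¹ • ∑ i ∈ Finset.range n, g j i ω‖ ∂(Q j) = (eLpNorm w 1 (Q j)).toReal := by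
    rw [eLpNorm_one_eq_lintegral_enorm, ← integral_norm_eq_lintegral_enorm (Lp.memLp w).1]
    refine integral_congr_ae ?_
    filter_upwards [hw] with ω e
    rw [e]
  rw [h1, Lp.norm_def]
  exact ENNReal.toReal_mono (Lp.eLpNorm_ne_top w)
    (eLpNorm_le_eLpNorm_of_exponent_le (by norm_num) (Lp.memLp w).1)

end AsymptoticMeanErgodic

/-! ### One-step conditioning for the chain. -/

section MarkovChain

section AdaptedFunctions

variable {E : Type*} [Zero E]

/-- Extension of a finite path by zero. -/
def extendPath (n : ℕ) (z : Finset.Iic n → E) (i : ℕ) : E :=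
  if h : i ≤ n then z ⟨i, Finset.mem_Iic.2 h⟩ else 0

lemma measurable_extendPath [MeasurableSpace E] (n : ℕ) : Measurable (extendPath (E := E) n) := by
  refine measurable_pi_lambda _ fun i => ?_
  unfold extendPath
  split_ifs with h
  · exact measurable_pi_apply _
  · exact measurable_const

/-- The function `F` of a path and a further point depends only on the path up to time `n`. -/
def AdaptedTo {G : Type*} (n : ℕ) (F : (ℕ → E) × E → G) : Prop :=
  ∀ ω ω' y, (∀ i ≤ n, ω i = ω' i) → F (ω, y) = F (ω', y)

lemma AdaptedTo.eq_extendPath {G : Type*} {n : ℕ} {F : (ℕ → E) × E → G} (hF : AdaptedTo n F)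
    (ω : ℕ → E) (y : E) : F (ω, y) = F (extendPath n (Preorder.frestrictLe n ω), y) := by
  refine hF _ _ _ fun i hi => ?_
  simp [extendPath, hi]

end AdaptedFunctions

variable {E : Type*} [MeasurableSpace E] (ν : Measure E) (P : Kernel E E) [IsMarkovKernel P]

instance [IsProbabilityMeasure ν] : IsProbabilityMeasure (chainLaw ν P) := by
  unfold chainLaw; infer_instance

lemma map_zero_chainLaw : (chainLaw ν P).map (fun ω => ω 0) = ν := by
  have h1 : (fun ω : ℕ → E => ω 0) = (MeasurableEquiv.piUnique (fun _ : Finset.Iic 0 => E)) ∘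
      (Preorder.frestrictLe (π := fun _ : ℕ => E) 0) := rfl
  rw [h1, ← Measure.map_map (by fun_prop) (by fun_prop), chainLaw, Kernel.trajMeasure,
    Measure.map_comp _ _ (by fun_prop), Kernel.traj_map_frestrictLe, Kernel.partialTraj_self,
    Measure.id_comp]
  exact MeasurableEquiv.map_apply_eq_iff_map_symm_apply_eq _ |>.2 rfl

lemma chainLaw_compProd [IsProbabilityMeasure ν] (n : ℕ) :
    (chainLaw ν P).map (Preorder.frestrictLe n) ⊗ₘ
      (P.comap (fun x : Finset.Iic n → E => x ⟨n, Finset.mem_Iic.2 le_rfl⟩)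
        (measurable_pi_apply _)) =
      (chainLaw ν P).map fun ω => (Preorder.frestrictLe n ω, ω (n + 1)) :=
  Kernel.map_frestrictLe_trajMeasure_compProd_eq_map_trajMeasure

variable [Zero E] [IsProbabilityMeasure ν]

/-- This is the Markov property. An adapted function factors through the path up to time `n`, with
zero extension as a measurable section, so the disintegration of the law of that path and the next
point applies. -/
lemma lintegral_chainLaw_succ {n : ℕ} {F : (ℕ → E) × E → ℝ≥0∞} (hFm : Measurable F)
    (hF : AdaptedTo n F) :
    ∫⁻ ω, F (ω, ω (n + 1)) ∂(chainLaw ν P) =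
      ∫⁻ ω, ∫⁻ y, F (ω, y) ∂(P (ω n)) ∂(chainLaw ν P) := by
  have hm : Measurable fun q : (Finset.Iic n → E) × E => F (extendPath n q.1, q.2) :=
    hFm.comp (((measurable_extendPath n).comp measurable_fst).prodMk measurable_snd)
  have h1 : ∫⁻ ω, F (ω, ω (n + 1)) ∂(chainLaw ν P) = ∫⁻ q, F (extendPath n q.1, q.2)
      ∂((chainLaw ν P).map fun ω => (Preorder.frestrictLe n ω, ω (n + 1))) := by
    rw [lintegral_map hm (by fun_prop)]
    exact lintegral_congr fun ω => hF.eq_extendPath _ _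
  rw [h1, ← chainLaw_compProd, Measure.lintegral_compProd hm,
    lintegral_map hm.lintegral_kernel_prod_right' (by fun_prop)]
  refine lintegral_congr fun ω => ?_
  simp only [Kernel.comap_apply]
  exact lintegral_congr fun y => (hF.eq_extendPath _ _).symm

lemma integral_chainLaw_succ {G : Type*} [NormedAddCommGroup G] [NormedSpace ℝ G] [CompleteSpace G]
    {n : ℕ} {F : (ℕ → E) × E → G} (hFm : StronglyMeasurable F) (hF : AdaptedTo n F)
    (hint : Integrable (fun ω => F (ω, ω (n + 1))) (chainLaw ν P)) :
    Integrable (fun ω => ∫ y, F (ω, y) ∂(P (ω n))) (chainLaw ν P) ∧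
    ∫ ω, F (ω, ω (n + 1)) ∂(chainLaw ν P) =
      ∫ ω, ∫ y, F (ω, y) ∂(P (ω n)) ∂(chainLaw ν P) := by
  have hm : StronglyMeasurable fun q : (Finset.Iic n → E) × E => F (extendPath n q.1, q.2) :=
    hFm.comp_measurable (((measurable_extendPath n).comp measurable_fst).prodMk measurable_snd)
  have hmap : Measurable fun ω : ℕ → E => (Preorder.frestrictLe (π := fun _ => E) n ω, ω (n + 1)) :=
    by fun_prop
  have heq : (fun ω => F (ω, ω (n + 1))) = (fun q : (Finset.Iic n → E) × E =>
      F (extendPath n q.1, q.2)) ∘ fun ω => (Preorder.frestrictLe n ω, ω (n + 1)) :=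
    funext fun ω => hF.eq_extendPath _ _
  have hi : Integrable (fun q : (Finset.Iic n → E) × E => F (extendPath n q.1, q.2))
      ((chainLaw ν P).map (Preorder.frestrictLe n) ⊗ₘ
      (P.comap (fun x : Finset.Iic n → E => x ⟨n, Finset.mem_Iic.2 le_rfl⟩)
        (measurable_pi_apply _))) := by
    rw [chainLaw_compProd, integrable_map_measure hm.aestronglyMeasurable hmap.aemeasurable, ← heq]
    exact hint
  have hinner : ∀ ω : ℕ → E, ∫ y, F (extendPath n (Preorder.frestrictLe n ω), y)
      ∂(P.comap (fun x : Finset.Iic n → E => x ⟨n, Finset.mem_Iic.2 le_rfl⟩)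
        (measurable_pi_apply _) (Preorder.frestrictLe n ω)) = ∫ y, F (ω, y) ∂(P (ω n)) := by
    intro ω
    simp only [Kernel.comap_apply]
    exact integral_congr_ae (Eventually.of_forall fun y => (hF.eq_extendPath _ _).symm)
  have hi2 : Integrable (fun z => ∫ y, F (extendPath n z, y)
      ∂(P.comap (fun x : Finset.Iic n → E => x ⟨n, Finset.mem_Iic.2 le_rfl⟩)
        (measurable_pi_apply _) z)) ((chainLaw ν P).map (Preorder.frestrictLe n)) :=
    Integrable.integral_compProd (κ := Kernel.const Unit _) (a := ()) hi
  have hi3 := hi2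
  rw [integrable_map_measure hi2.1 (by fun_prop)] at hi2
  refine ⟨hi2.congr (Eventually.of_forall fun ω => hinner ω), ?_⟩
  have h1 : ∫ ω, F (ω, ω (n + 1)) ∂(chainLaw ν P) = ∫ q, F (extendPath n q.1, q.2)
      ∂((chainLaw ν P).map fun ω => (Preorder.frestrictLe n ω, ω (n + 1))) := by
    rw [integral_map hmap.aemeasurable hm.aestronglyMeasurable]
    exact integral_congr_ae (Eventually.of_forall fun ω => hF.eq_extendPath _ _)
  rw [h1, ← chainLaw_compProd, Measure.integral_compProd hi,
    integral_map (by fun_prop) hi3.1]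
  exact integral_congr_ae (Eventually.of_forall hinner)

end MarkovChain

/-! ### Consequences of the Lyapunov inequality. -/

section Lyapunov

/-- Nonnegativity of `P V` turns the drift inequality into a pointwise bound of `ψ` by an affine
function of `V`, which transfers integrability from `V` to `ψ`. -/
lemma psi_le {E : Type*} [MeasurableSpace E] (P : Kernel E E) {V ψ : E → ℝ} {a b : ℝ}
    (hV0 : ∀ x, 0 ≤ V x) (ha : 0 < a)
    (hlyap : ∀ x, Integrable V (P x) ∧ ∫ y, V y ∂(P x) ≤ V x - a * ψ x + b) (x : E) :
    ψ x ≤ a⁻¹ * (V x + b) := by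
  have h1 : 0 ≤ ∫ y, V y ∂(P x) := integral_nonneg hV0
  rw [le_inv_mul_iff₀ ha]
  linarith [(hlyap x).2]

variable {E : Type*} [MeasurableSpace E] [Zero E] (ν : Measure E) [IsProbabilityMeasure ν]
  (P : Kernel E E) [IsMarkovKernel P] {V ψ : E → ℝ} {a b : ℝ}

lemma integrable_V_chainLaw (hVm : Measurable V) (hV0 : ∀ x, 0 ≤ V x) (hψ0 : ∀ x, 0 ≤ ψ x)
    (ha : 0 < a) (hlyap : ∀ x, Integrable V (P x) ∧ ∫ y, V y ∂(P x) ≤ V x - a * ψ x + b)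
    (hν : Integrable V ν) (n : ℕ) : Integrable (fun ω => V (ω n)) (chainLaw ν P) := by
  induction n with
  | zero =>
    have h1 : Integrable V ((chainLaw ν P).map fun ω => ω 0) := by rwa [map_zero_chainLaw]
    exact (integrable_map_measure h1.1 (measurable_pi_apply 0).aemeasurable).1 h1
  | succ n ih =>
    refine ⟨(hVm.comp (measurable_pi_apply _)).aestronglyMeasurable, ?_⟩
    have h1 : ∫⁻ ω, ‖V (ω (n + 1))‖ₑ ∂(chainLaw ν P) =
        ∫⁻ ω, ∫⁻ y, ‖V y‖ₑ ∂(P (ω n)) ∂(chainLaw ν P) :=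
      lintegral_chainLaw_succ ν P (n := n) (F := fun p => ‖V p.2‖ₑ)
        (hVm.comp measurable_snd).enorm (fun _ _ _ _ => rfl)
    rw [hasFiniteIntegral_def, h1]
    have h2 : ∀ x, ∫⁻ y, ‖V y‖ₑ ∂(P x) ≤ ‖V x + |b|‖ₑ := by
      intro x
      rw [← ofReal_integral_norm_eq_lintegral_enorm (hlyap x).1, ← ofReal_norm]
      refine ENNReal.ofReal_le_ofReal ?_
      have h3 : ∫ y, ‖V y‖ ∂(P x) = ∫ y, V y ∂(P x) :=
        integral_congr_ae (Eventually.of_forall fun y => Real.norm_of_nonneg (hV0 y))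
      rw [h3, Real.norm_of_nonneg (add_nonneg (hV0 x) (abs_nonneg b))]
      have := (hlyap x).2
      linarith [mul_nonneg ha.le (hψ0 x), le_abs_self b]
    exact (lintegral_mono fun ω : ℕ → E => h2 (ω n)).trans_lt (ih.add (integrable_const |b|)).2

lemma integrable_psi_chainLaw (hVm : Measurable V) (hψm : Measurable ψ) (hV0 : ∀ x, 0 ≤ V x)
    (hψ0 : ∀ x, 0 ≤ ψ x) (ha : 0 < a)
    (hlyap : ∀ x, Integrable V (P x) ∧ ∫ y, V y ∂(P x) ≤ V x - a * ψ x + b)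
    (hν : Integrable V ν) (n : ℕ) : Integrable (fun ω => ψ (ω n)) (chainLaw ν P) := by
  refine Integrable.mono' (((integrable_V_chainLaw ν P hVm hV0 hψ0 ha hlyap hν n).add
    (integrable_const b)).const_mul a⁻¹)
    (hψm.comp (measurable_pi_apply _)).aestronglyMeasurable (Eventually.of_forall fun ω => ?_)
  rw [Real.norm_of_nonneg (hψ0 _)]
  exact psi_le P hV0 ha hlyap _

/-- The Pakes–Has'minskii bound on the occupation measures. -/
lemma sum_integral_psi_le (hVm : Measurable V) (hψm : Measurable ψ) (hV0 : ∀ x, 0 ≤ V x)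
    (hψ0 : ∀ x, 0 ≤ ψ x) (ha : 0 < a)
    (hlyap : ∀ x, Integrable V (P x) ∧ ∫ y, V y ∂(P x) ≤ V x - a * ψ x + b)
    (hν : Integrable V ν) (n : ℕ) :
    a * ∑ k ∈ Finset.range n, ∫ ω, ψ (ω k) ∂(chainLaw ν P) ≤ ∫ x, V x ∂ν + n * b := by
  have hVi := integrable_V_chainLaw ν P hVm hV0 hψ0 ha hlyap hν
  have hψi := integrable_psi_chainLaw ν P hVm hψm hV0 hψ0 ha hlyap hν
  -- The expectation of `V` at time `n` is retained on the left so that the induction telescopes; it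
  -- is dropped only at the end.
  have key : a * ∑ k ∈ Finset.range n, ∫ ω, ψ (ω k) ∂(chainLaw ν P) +
      ∫ ω, V (ω n) ∂(chainLaw ν P) ≤ ∫ x, V x ∂ν + n * b := by
    induction n with
    | zero =>
      have h1 : ∫ ω, V (ω 0) ∂(chainLaw ν P) = ∫ x, V x ∂ν := by
        conv_rhs => rw [← map_zero_chainLaw ν P]
        rw [integral_map (measurable_pi_apply 0).aemeasurable hVm.aestronglyMeasurable]
      simp [h1]
    | succ n ih =>
      obtain ⟨h1, h2⟩ := integral_chainLaw_succ ν P (n := n) (F := fun p => V p.2)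
        (hVm.comp measurable_snd).stronglyMeasurable (fun _ _ _ _ => rfl) (hVi (n + 1))
      simp only at h1 h2
      have hs : Integrable (fun ω => V (ω n) - a * ψ (ω n)) (chainLaw ν P) :=
        (hVi n).sub ((hψi n).const_mul a)
      have h3 : ∫ ω, V (ω (n + 1)) ∂(chainLaw ν P) ≤
          ∫ ω, (V (ω n) - a * ψ (ω n) + b) ∂(chainLaw ν P) := by
        rw [h2]
        exact integral_mono h1 (hs.add (integrable_const b))
          fun ω => (hlyap (ω n)).2
      rw [integral_add hs (integrable_const b),
        integral_sub (hVi n) ((hψi n).const_mul a), integral_const_mul] at h3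
      simp only [integral_const, probReal_univ, one_smul] at h3
      rw [Finset.sum_range_succ, mul_add]
      push_cast
      linarith
  have : 0 ≤ ∫ ω, V (ω n) ∂(chainLaw ν P) := integral_nonneg fun ω => hV0 _
  linarith

end Lyapunov

/-- The path shifted by `k`. -/
def shiftPath {E : Type*} (k : ℕ) (ω : ℕ → E) : ℕ → E := fun i => ω (k + i)

lemma measurable_shiftPath {E : Type*} [MeasurableSpace E] (k : ℕ) :
    Measurable (shiftPath (E := E) k) :=
  measurable_pi_lambda _ fun _ => measurable_pi_apply _

/-! ### Second moments of martingale sums. -/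

section MartingaleBound

lemma lintegral_enorm_le_of_integral_sq_le {Ω : Type*} [MeasurableSpace Ω] (m : Measure Ω)
    [IsProbabilityMeasure m] {E : Type*}
    [NormedAddCommGroup E] {Z : Ω → E} (hZ : AEStronglyMeasurable Z m) {c : ℝ} (hc : 0 ≤ c)
    {b : ℝ} (hb : ∀ ω, ‖Z ω‖ ≤ b) (h : ∫ ω, ‖Z ω‖ ^ 2 ∂m ≤ c ^ 2) :
    ∫⁻ ω, ‖Z ω‖ₑ ∂m ≤ ENNReal.ofReal c := by
  have hmem : MemLp Z 2 m := MemLp.of_bound hZ b (Eventually.of_forall hb)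
  have h1 : eLpNorm Z 1 m ≤ eLpNorm Z 2 m := eLpNorm_le_eLpNorm_of_exponent_le (by norm_num) hZ
  rw [eLpNorm_one_eq_lintegral_enorm] at h1
  refine h1.trans ?_
  rw [hmem.eLpNorm_eq_integral_rpow_norm (by norm_num) (by norm_num)]
  refine ENNReal.ofReal_le_ofReal ?_
  have h2 : (2 : ℝ≥0∞).toReal = ((2 : ℕ) : ℝ) := by simp
  simp only [h2, Real.rpow_natCast]
  rw [Nat.cast_ofNat, ← one_div, ← Real.sqrt_eq_rpow]
  exact Real.sqrt_le_iff.2 ⟨hc, h⟩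

variable {E : Type*} [NormedAddCommGroup E] [InnerProductSpace ℝ E] [CompleteSpace E]
  [MeasurableSpace E] [BorelSpace E] [SecondCountableTopology E] (ν : Measure E)
  [IsProbabilityMeasure ν] (P : Kernel E E) [IsMarkovKernel P]

/-- Orthogonality of martingale increments. -/
lemma integral_sq_norm_martingale_le (g : E × E → E) (hg : Measurable g) {B : ℝ}
    (hgB : ∀ q, ‖g q‖ ≤ B) (hg0 : ∀ x, ∫ y, g (x, y) ∂(P x) = 0) (k : ℕ)
    (J : ℕ → (ℕ → E) → ℝ) (hJm : ∀ l, Measurable (J l)) (hJ1 : ∀ l ω, |J l ω| ≤ 1)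
    (hJ : ∀ l ω ω', (∀ i ≤ k + l, ω i = ω' i) → J l ω = J l ω') (n : ℕ) :
    ∫ ω, ‖∑ l ∈ Finset.range n, J l ω • g (ω (k + l), ω (k + l + 1))‖ ^ 2 ∂(chainLaw ν P) ≤
      n * B ^ 2 := by
  have hB : 0 ≤ B := (norm_nonneg _).trans (hgB (0, 0))
  set Z : ℕ → (ℕ → E) → E := fun n ω => ∑ l ∈ Finset.range n, J l ω • g (ω (k + l), ω (k + l + 1))
    with hZ
  have hZm : ∀ n, Measurable (Z n) := fun n =>
    Finset.measurable_sum _ fun l _ => (hJm l).smul (hg.comp (by fun_prop))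
  have hincr : ∀ l ω y, ‖J l ω • g (ω (k + l), y)‖ ≤ B := fun l ω y => by
    rw [norm_smul, Real.norm_eq_abs]
    calc |J l ω| * ‖g (ω (k + l), y)‖ ≤ 1 * B :=
          mul_le_mul (hJ1 l ω) (hgB _) (norm_nonneg _) zero_le_one
      _ = B := one_mul B
  have hZb : ∀ n ω, ‖Z n ω‖ ≤ n * B := fun n ω => by
    refine (norm_sum_le _ _).trans ?_
    refine (Finset.sum_le_card_nsmul _ _ B fun l _ => hincr l ω _).trans ?_
    simp
  have hZsq : ∀ n, Integrable (fun ω => ‖Z n ω‖ ^ 2) (chainLaw ν P) := fun n =>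
    Integrable.of_bound ((hZm n).norm.pow_const 2).aestronglyMeasurable ((n * B) ^ 2)
      (Eventually.of_forall fun ω => by
        rw [Real.norm_of_nonneg (by positivity)]
        exact pow_le_pow_left₀ (norm_nonneg _) (hZb n ω) 2)
  change ∫ ω, ‖Z n ω‖ ^ 2 ∂(chainLaw ν P) ≤ n * B ^ 2
  induction n with
  | zero => simp [hZ]
  | succ n ih =>
    -- `F` is the cross term in the expansion of the squared norm. The past is frozen when the last
    -- point is integrated, so centring of `g` makes its mean zero.
    set F : (ℕ → E) × E → ℝ := fun q => inner ℝ (Z n q.1) (J n q.1 • g (q.1 (k + n), q.2)) with hF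
    have hFm : Measurable F := by
      refine ((hZm n).comp measurable_fst).inner (((hJm n).comp measurable_fst).smul
        (hg.comp ?_))
      exact ((measurable_pi_apply _).comp measurable_fst).prodMk measurable_snd
    have hFa : AdaptedTo (k + n) F := by
      intro ω ω' y h
      have h1 : Z n ω = Z n ω' := by
        refine Finset.sum_congr rfl fun l hl => ?_
        have hl' := Finset.mem_range.1 hl
        rw [hJ l ω ω' fun i hi => h i (by omega), h (k + l) (by omega), h (k + l + 1) (by omega)]
      simp only [hF]
      rw [h1, hJ n ω ω' h, h (k + n) le_rfl]
    have hFb : ∀ q, ‖F q‖ ≤ n * B * B := fun q =>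
      (norm_inner_le_norm _ _).trans
        (mul_le_mul (hZb n _) (hincr n _ _) (norm_nonneg _) (by positivity))
    have hFi : Integrable (fun ω => F (ω, ω (k + n + 1))) (chainLaw ν P) :=
      Integrable.of_bound (hFm.comp (by fun_prop)).aestronglyMeasurable _
        (Eventually.of_forall fun ω => hFb _)
    have hF0 : ∫ ω, F (ω, ω (k + n + 1)) ∂(chainLaw ν P) = 0 := by
      rw [(integral_chainLaw_succ ν P hFm.stronglyMeasurable hFa hFi).2]
      have : ∀ ω : ℕ → E, ∫ y, F (ω, y) ∂(P (ω (k + n))) = 0 := fun ω => by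
        have hgi : Integrable (fun y => J n ω • g (ω (k + n), y)) (P (ω (k + n))) :=
          Integrable.of_bound ((hg.comp measurable_prodMk_left).const_smul _).aestronglyMeasurable
            B (Eventually.of_forall fun y => hincr n ω y)
        simp only [hF]
        rw [integral_inner hgi, integral_smul, hg0, smul_zero, inner_zero_right]
      simp [this]
    have hexp : ∀ ω, ‖Z (n + 1) ω‖ ^ 2 ≤ ‖Z n ω‖ ^ 2 + 2 * F (ω, ω (k + n + 1)) + B ^ 2 := by
      intro ω
      have h1 : Z (n + 1) ω = Z n ω + J n ω • g (ω (k + n), ω (k + n + 1)) :=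
        Finset.sum_range_succ _ _
      rw [h1, norm_add_sq_real]
      gcongr
      exact hincr n ω _
    have hi1 : Integrable (fun ω => 2 * F (ω, ω (k + n + 1))) (chainLaw ν P) := hFi.const_mul 2
    have hi2 : Integrable (fun ω => ‖Z n ω‖ ^ 2 + 2 * F (ω, ω (k + n + 1))) (chainLaw ν P) :=
      (hZsq n).add hi1
    have hi3 : Integrable (fun ω => ‖Z n ω‖ ^ 2 + 2 * F (ω, ω (k + n + 1)) + B ^ 2)
        (chainLaw ν P) := hi2.add (integrable_const _)
    clear_value F Z
    calc ∫ ω, ‖Z (n + 1) ω‖ ^ 2 ∂(chainLaw ν P)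
        ≤ ∫ ω, (‖Z n ω‖ ^ 2 + 2 * F (ω, ω (k + n + 1)) + B ^ 2) ∂(chainLaw ν P) :=
          integral_mono (hZsq _) hi3 hexp
      _ = ∫ ω, ‖Z n ω‖ ^ 2 ∂(chainLaw ν P) + B ^ 2 := by
          rw [integral_add hi2 (integrable_const _), integral_add (hZsq n) hi1,
            integral_const_mul, hF0]
          simp
      _ ≤ ((n + 1 : ℕ) : ℝ) * B ^ 2 := by push_cast; linarith

end MartingaleBound

/-! ### Mean size of the stopped noise. -/

section StopErrBound

section Measurability

variable {E : Type*} [NormedAddCommGroup E] [MeasurableSpace E] [BorelSpace E]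

lemma measurableSet_alive (Rad : ℝ → ℝ) (γ : ℝ) (l : ℕ) :
    MeasurableSet {ω : ℕ → E | Alive Rad γ ω l} := by
  have : {ω : ℕ → E | Alive Rad γ ω l} = ⋂ i ∈ Finset.range (l + 1), {ω | ‖ω i‖ ≤ Rad (i * γ)} := by
    ext ω; simp [Alive]
  rw [this]
  exact Finset.measurableSet_biInter _ fun i _ =>
    measurableSet_le (measurable_pi_apply i).norm measurable_const

lemma measurable_aliveInd (Rad : ℝ → ℝ) (γ : ℝ) (l : ℕ) :
    Measurable fun ω : ℕ → E => aliveInd Rad γ ω l := by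
  unfold aliveInd
  exact Measurable.ite (measurableSet_alive Rad γ l) measurable_const measurable_const

end Measurability

lemma aliveInd_shiftPath_congr {E : Type*} [NormedAddCommGroup E] (Rad : ℝ → ℝ) (γ : ℝ) (k l : ℕ)
    (ω ω' : ℕ → E)
    (h : ∀ i ≤ k + l, ω i = ω' i) :
    aliveInd Rad γ (shiftPath k ω) l = aliveInd Rad γ (shiftPath k ω') l := by
  have : Alive Rad γ (shiftPath k ω) l ↔ Alive Rad γ (shiftPath k ω') l := by
    refine forall₂_congr fun i hi => ?_
    rw [shiftPath, shiftPath, h (k + i) (by omega)]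
  by_cases hω : Alive Rad γ (shiftPath k ω) l
  · rw [aliveInd_of_alive hω, aliveInd_of_alive (this.1 hω)]
  · rw [aliveInd_of_not_alive hω, aliveInd_of_not_alive fun hc => hω (this.2 hc)]

variable {E : Type*} [NormedAddCommGroup E] [InnerProductSpace ℝ E]
  [MeasurableSpace E] [BorelSpace E] [SecondCountableTopology E]

lemma measurable_stopErr (Rad : ℝ → ℝ) (γ : ℝ) {b : E → E} (hb : Measurable b) (i : ℕ) :
    Measurable fun ω : ℕ → E => stopErr Rad γ ω b i := by
  unfold stopErr
  refine Finset.measurable_sum _ fun l _ => (measurable_aliveInd Rad γ l).smul ?_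
  have h : Measurable fun ω : ℕ → E => γ • b (ω l) := (hb.comp (measurable_pi_apply l)).const_smul γ
  have h' : Measurable fun ω : ℕ → E => ω (l + 1) - ω l := by fun_prop
  exact h'.sub h

/-- Second moments may be infinite, so the scaled increments are truncated at `Λ`. The truncated,
recentred part is a martingale sum of mean norm at most `2Λ√n`; the discarded tail and the bias it
causes cost at most `Λ^(-ε) M` each per step. The stopping indicator confines the current state to
the ball where the moment bound holds. -/
lemma lintegral_enorm_stopErr_le [CompleteSpace E] (ν : Measure E) [IsProbabilityMeasure ν]
    (P : Kernel E E)
    [IsMarkovKernel P] {γ : ℝ} (hγ : 0 < γ) {b : E → E} (hbm : Measurable b)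
    (hb : ∀ x, b x = ∫ y, γ⁻¹ • (y - x) ∂(P x)) (Rad : ℝ → ℝ) {R ε Λ : ℝ} (hε : 0 < ε) (hΛ : 0 < Λ)
    {M : ℝ≥0∞} (hM : M ≠ ∞)
    (hmom : ∀ x, ‖x‖ ≤ R → ∫⁻ y, ‖γ⁻¹ • (y - x)‖ₑ ^ (1 + ε) ∂(P x) ≤ M) (k n : ℕ)
    (hR : ∀ l < n, Rad (l * γ) ≤ R) :
    ∫⁻ ω, ‖stopErr Rad γ (shiftPath k ω) b n‖ₑ ∂(chainLaw ν P) ≤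
      ENNReal.ofReal γ * (ENNReal.ofReal (2 * Λ * √n) +
        n * (2 * (ENNReal.ofReal (Λ ^ (-ε)) * M))) := by
  set ξ : E × E → E := fun q => γ⁻¹ • (q.2 - q.1) with hξ
  have hξm : Measurable ξ := (measurable_snd.sub measurable_fst).const_smul _
  set ξ₁ : E × E → E := fun q => trunc Λ (ξ q) with hξ₁
  have hξ₁m : Measurable ξ₁ := (measurable_trunc Λ).comp hξm
  have hξ₁b : ∀ q, ‖ξ₁ q‖ ≤ Λ := fun q => norm_trunc_le hΛ.le _
  set m₁ : E → E := fun x => ∫ y, ξ₁ (x, y) ∂(P x) with hm₁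
  have hm₁m : Measurable m₁ :=
    (StronglyMeasurable.integral_kernel_prod_right' hξ₁m.stronglyMeasurable).measurable
  have hξ₁i : ∀ x, Integrable (fun y => ξ₁ (x, y)) (P x) := fun x =>
    Integrable.of_bound (hξ₁m.comp measurable_prodMk_left).aestronglyMeasurable Λ
      (Eventually.of_forall fun y => hξ₁b _)
  have hm₁b : ∀ x, ‖m₁ x‖ ≤ Λ := fun x => by
    have := norm_integral_le_of_norm_le_const (μ := P x)
      (Eventually.of_forall fun y => hξ₁b (x, y))
    simpa using this
  set C := ENNReal.ofReal (Λ ^ (-ε)) * M with hC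
  have htail : ∀ x, ‖x‖ ≤ R → ∫⁻ y, ‖ξ (x, y) - ξ₁ (x, y)‖ₑ ∂(P x) ≤ C := fun x hx => by
    calc ∫⁻ y, ‖ξ (x, y) - ξ₁ (x, y)‖ₑ ∂(P x)
        ≤ ∫⁻ y, ENNReal.ofReal (Λ ^ (-ε)) * ‖ξ (x, y)‖ₑ ^ (1 + ε) ∂(P x) :=
          lintegral_mono fun y => enorm_sub_trunc_le hΛ hε _
      _ ≤ C := by
          rw [lintegral_const_mul' _ _ ENNReal.ofReal_ne_top]
          exact mul_le_mul' le_rfl (hmom x hx)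
  have hbias : ∀ x, ‖x‖ ≤ R → ‖b x - m₁ x‖ₑ ≤ C := fun x hx => by
    have hξi : Integrable (fun y => ξ (x, y)) (P x) :=
      integrable_of_lintegral_rpow_le _ (hξm.comp measurable_prodMk_left).aestronglyMeasurable hε
        ((hmom x hx).trans_lt hM.lt_top)
    have h1 : b x - m₁ x = ∫ y, (ξ (x, y) - ξ₁ (x, y)) ∂(P x) := by
      rw [integral_sub hξi (hξ₁i x), hb]
    rw [h1]
    exact (enorm_integral_le_lintegral_enorm _).trans (htail x hx)
  -- Stopping restarts at time `k`, but the indicator is still determined by the original path up to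
  -- time `k + l`, so the shifted chain needs no separate law.
  set J : ℕ → (ℕ → E) → ℝ := fun l ω => aliveInd Rad γ (shiftPath k ω) l with hJ
  have hJm : ∀ l, Measurable (J l) := fun l =>
    (measurable_aliveInd Rad γ l).comp (measurable_shiftPath k)
  have hJ1 : ∀ l ω, |J l ω| ≤ 1 := fun l ω => abs_aliveInd_le l
  have hJR : ∀ l < n, ∀ ω, J l ω = 0 ∨ ‖ω (k + l)‖ ≤ R := fun l hl ω => by
    by_cases h : Alive Rad γ (shiftPath k ω) l
    · exact Or.inr ((h l le_rfl).trans (hR l hl))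
    · exact Or.inl (aliveInd_of_not_alive h)
  set g : E × E → E := fun q => ξ₁ q - m₁ q.1 with hg
  have hgm : Measurable g := hξ₁m.sub (hm₁m.comp measurable_fst)
  have hgb : ∀ q, ‖g q‖ ≤ 2 * Λ := fun q =>
    (norm_sub_le _ _).trans (by linarith [hξ₁b q, hm₁b q.1])
  have hg0 : ∀ x, ∫ y, g (x, y) ∂(P x) = 0 := fun x => by
    simp only [hg]
    rw [integral_sub (hξ₁i x) (integrable_const _)]
    simp [hm₁]
  set Z : (ℕ → E) → E := fun ω => ∑ l ∈ Finset.range n, J l ω • g (ω (k + l), ω (k + l + 1)) with hZ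
  have hZm : Measurable Z :=
    Finset.measurable_sum _ fun l _ => (hJm l).smul (hgm.comp (by fun_prop))
  have hZ2 := integral_sq_norm_martingale_le ν P g hgm hgb hg0 k J hJm hJ1
    (fun l ω ω' h => aliveInd_shiftPath_congr Rad γ k l ω ω' h) n
  have hZ1 : ∫⁻ ω, ‖Z ω‖ₑ ∂(chainLaw ν P) ≤ ENNReal.ofReal (2 * Λ * √n) := by
    refine lintegral_enorm_le_of_integral_sq_le _ hZm.aestronglyMeasurable (by positivity)
      (b := n * (2 * Λ)) (fun ω => ?_) ?_
    · refine (norm_sum_le _ _).trans ?_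
      refine (Finset.sum_le_card_nsmul _ _ (2 * Λ) fun l _ => ?_).trans (by simp)
      rw [norm_smul, Real.norm_eq_abs]
      nlinarith [hJ1 l ω, hgb (ω (k + l), ω (k + l + 1)),
        norm_nonneg (g (ω (k + l), ω (k + l + 1))),
        abs_nonneg (J l ω)]
    · refine hZ2.trans (le_of_eq ?_)
      rw [mul_pow (2 * Λ) (√n) 2, Real.sq_sqrt (Nat.cast_nonneg n)]; ring
  set W : ℕ → (ℕ → E) → E := fun l ω =>
    J l ω • ((ξ (ω (k + l), ω (k + l + 1)) - ξ₁ (ω (k + l), ω (k + l + 1))) -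
      (b (ω (k + l)) - m₁ (ω (k + l)))) with hW
  have hdec : ∀ ω, stopErr Rad γ (shiftPath k ω) b n =
      γ • (Z ω + ∑ l ∈ Finset.range n, W l ω) := by
    intro ω
    rw [hZ]
    simp only
    rw [← Finset.sum_add_distrib, Finset.smul_sum, stopErr]
    refine Finset.sum_congr rfl fun l _ => ?_
    simp only [hW, hg, hJ]
    rw [← smul_add, smul_comm γ]
    congr 1
    have h1 : γ • ξ (ω (k + l), ω (k + l + 1)) = ω (k + l + 1) - ω (k + l) := by
      simp only [hξ]
      rw [smul_smul, mul_inv_cancel₀ hγ.ne', one_smul]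
    have h2 : ξ₁ (ω (k + l), ω (k + l + 1)) - m₁ (ω (k + l)) +
        (ξ (ω (k + l), ω (k + l + 1)) - ξ₁ (ω (k + l), ω (k + l + 1)) -
          (b (ω (k + l)) - m₁ (ω (k + l)))) =
        ξ (ω (k + l), ω (k + l + 1)) - b (ω (k + l)) := by abel
    rw [h2, smul_sub, h1]
    rfl
  have hJe : ∀ l ω, ‖J l ω‖ₑ ≤ 1 := fun l ω => by
    rw [← ofReal_norm, ← ENNReal.ofReal_one]
    exact ENNReal.ofReal_le_ofReal (hJ1 l ω)
  have hWl : ∀ l < n, ∫⁻ ω, ‖W l ω‖ₑ ∂(chainLaw ν P) ≤ 2 * C := by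
    intro l hl
    set F : (ℕ → E) × E → ℝ≥0∞ := fun q =>
      ‖J l q.1‖ₑ * ‖ξ (q.1 (k + l), q.2) - ξ₁ (q.1 (k + l), q.2)‖ₑ with hF
    have hpair : Measurable fun q : (ℕ → E) × E => (q.1 (k + l), q.2) :=
      ((measurable_pi_apply _).comp measurable_fst).prodMk measurable_snd
    have hFm : Measurable F := ((hJm l).comp measurable_fst).enorm.mul
      ((hξm.comp hpair).sub (hξ₁m.comp hpair)).enorm
    have hFa : AdaptedTo (k + l) F := fun ω ω' y h => by
      simp only [hF, hJ]
      rw [aliveInd_shiftPath_congr Rad γ k l ω ω' h, h (k + l) le_rfl]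
    have h1 : ∫⁻ ω, F (ω, ω (k + l + 1)) ∂(chainLaw ν P) ≤ C := by
      rw [lintegral_chainLaw_succ ν P hFm hFa]
      calc ∫⁻ ω, ∫⁻ y, F (ω, y) ∂(P (ω (k + l))) ∂(chainLaw ν P) ≤
            ∫⁻ _, C ∂(chainLaw ν P) := by
            refine lintegral_mono fun ω => ?_
            simp only [hF]
            rw [lintegral_const_mul' _ _ enorm_ne_top]
            rcases hJR l hl ω with h | h
            · simp [h]
            · calc _ ≤ 1 * C := mul_le_mul' (hJe l ω) (htail _ h)
                _ = C := one_mul C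
        _ = C := by simp
    have h2 : ∀ ω, ‖W l ω‖ₑ ≤ F (ω, ω (k + l + 1)) + C := by
      intro ω
      simp only [hW, hF]
      rw [enorm_smul]
      calc _ ≤ ‖J l ω‖ₑ * (‖ξ (ω (k + l), ω (k + l + 1)) - ξ₁ (ω (k + l), ω (k + l + 1))‖ₑ +
            ‖b (ω (k + l)) - m₁ (ω (k + l))‖ₑ) := by gcongr; exact enorm_sub_le
        _ = ‖J l ω‖ₑ * ‖ξ (ω (k + l), ω (k + l + 1)) - ξ₁ (ω (k + l), ω (k + l + 1))‖ₑ +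
            ‖J l ω‖ₑ * ‖b (ω (k + l)) - m₁ (ω (k + l))‖ₑ := mul_add _ _ _
        _ ≤ _ := by
          gcongr
          rcases hJR l hl ω with h | h
          · simp [h]
          · calc _ ≤ 1 * C := mul_le_mul' (hJe l ω) (hbias _ h)
              _ = C := one_mul C
    calc ∫⁻ ω, ‖W l ω‖ₑ ∂(chainLaw ν P) ≤ ∫⁻ ω, (F (ω, ω (k + l + 1)) + C) ∂(chainLaw ν P) :=
          lintegral_mono h2
      _ = ∫⁻ ω, F (ω, ω (k + l + 1)) ∂(chainLaw ν P) + C := by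
          rw [lintegral_add_right _ measurable_const]; simp
      _ ≤ C + C := by gcongr
      _ = 2 * C := (two_mul C).symm
  have hWm : ∀ l, Measurable (W l) := fun l => by
    have h1 : Measurable fun ω : ℕ → E => (ω (k + l), ω (k + l + 1)) := by fun_prop
    exact (hJm l).smul (((hξm.comp h1).sub (hξ₁m.comp h1)).sub
      ((hbm.comp (measurable_pi_apply _)).sub (hm₁m.comp (measurable_pi_apply _))))
  calc ∫⁻ ω, ‖stopErr Rad γ (shiftPath k ω) b n‖ₑ ∂(chainLaw ν P)
      ≤ ∫⁻ ω, ENNReal.ofReal γ * (‖Z ω‖ₑ + ∑ l ∈ Finset.range n, ‖W l ω‖ₑ) ∂(chainLaw ν P) := by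
        refine lintegral_mono fun ω => ?_
        rw [hdec, enorm_smul, Real.enorm_of_nonneg hγ.le]
        gcongr
        exact (enorm_add_le _ _).trans (by gcongr; exact enorm_sum_le _ _)
    _ = ENNReal.ofReal γ * (∫⁻ ω, ‖Z ω‖ₑ ∂(chainLaw ν P) +
          ∑ l ∈ Finset.range n, ∫⁻ ω, ‖W l ω‖ₑ ∂(chainLaw ν P)) := by
        rw [lintegral_const_mul' _ _ ENNReal.ofReal_ne_top, lintegral_add_left hZm.enorm,
          lintegral_finsetSum _ fun l _ => (hWm l).enorm]
    _ ≤ ENNReal.ofReal γ * (ENNReal.ofReal (2 * Λ * √n) + n * (2 * C)) := by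
        gcongr
        refine (Finset.sum_le_card_nsmul _ _ (2 * C) fun l hl =>
          hWl l (Finset.mem_range.1 hl)).trans (le_of_eq ?_)
        simp

end StopErrBound

/-! ### Averaged laws of shifted paths. -/

section OccupationLaw

variable {E : Type*} [MeasurableSpace E]

/-- The average of the laws of the first `n + 1` shifts of a random path. -/
noncomputable def occLaw (m : Measure (ℕ → E)) (n : ℕ) : Measure (ℕ → E) :=
  ((n + 1 : ℕ) : ℝ≥0∞)⁻¹ • ∑ k ∈ Finset.range (n + 1), m.map (shiftPath k)

lemma lintegral_occLaw (m : Measure (ℕ → E)) (n : ℕ) {F : (ℕ → E) → ℝ≥0∞} (hF : Measurable F) :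
    ∫⁻ ω, F ω ∂(occLaw m n) =
      ((n + 1 : ℕ) : ℝ≥0∞)⁻¹ * ∑ k ∈ Finset.range (n + 1), ∫⁻ ω, F (shiftPath k ω) ∂m := by
  rw [occLaw, lintegral_smul_measure, lintegral_finsetSum_measure, smul_eq_mul]
  congr 1
  exact Finset.sum_congr rfl fun k _ => lintegral_map hF (measurable_shiftPath k)

lemma lintegral_occLaw_le (m : Measure (ℕ → E)) (n : ℕ) {F : (ℕ → E) → ℝ≥0∞} (hF : Measurable F)
    {c : ℝ≥0∞} (h : ∀ k, ∫⁻ ω, F (shiftPath k ω) ∂m ≤ c) : ∫⁻ ω, F ω ∂(occLaw m n) ≤ c := by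
  rw [lintegral_occLaw m n hF]
  calc _ ≤ ((n + 1 : ℕ) : ℝ≥0∞)⁻¹ * ∑ k ∈ Finset.range (n + 1), c := by
        gcongr with k _; exact h k
    _ = c := by
        rw [Finset.sum_const, Finset.card_range, nsmul_eq_mul, ← mul_assoc,
          ENNReal.inv_mul_cancel (by simp) (by simp), one_mul]

instance (m : Measure (ℕ → E)) [IsProbabilityMeasure m] (n : ℕ) :
    IsProbabilityMeasure (occLaw m n) := by
  refine ⟨?_⟩
  rw [← lintegral_one, lintegral_occLaw m n measurable_const]
  simp only [lintegral_one, measure_univ, Finset.sum_const, Finset.card_range, nsmul_eq_mul,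
    mul_one]
  exact ENNReal.inv_mul_cancel (by simp) (by simp)

lemma integral_occLaw (m : Measure (ℕ → E)) [IsProbabilityMeasure m] (n : ℕ) {F : (ℕ → E) → ℝ}
    (hF : Measurable F) {B : ℝ} (hB : ∀ ω, |F ω| ≤ B) :
    ∫ ω, F ω ∂(occLaw m n) =
      ((n : ℝ) + 1)⁻¹ * ∑ k ∈ Finset.range (n + 1), ∫ ω, F (shiftPath k ω) ∂m := by
  rw [occLaw, integral_smul_measure, integral_finsetSum_measure, smul_eq_mul]
  · congr 1
    · rw [← Nat.cast_succ, ENNReal.toReal_inv, ENNReal.toReal_natCast]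
    · exact Finset.sum_congr rfl fun k _ =>
        integral_map (measurable_shiftPath k).aemeasurable hF.aestronglyMeasurable
  · intro k _
    have := Measure.isProbabilityMeasure_map (μ := m) (measurable_shiftPath k).aemeasurable
    exact Integrable.of_bound hF.aestronglyMeasurable B (Eventually.of_forall hB)

lemma sum_range_sub_shift {G : Type*} [AddCommGroup G] (y : ℕ → G) (n i : ℕ) :
    ∑ k ∈ Finset.range n, (y (k + i) - y k) =
      ∑ k ∈ Finset.range i, (y (k + n) - y k) := by
  rw [Finset.sum_sub_distrib, Finset.sum_sub_distrib]
  have h1 := Finset.sum_range_add y n i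
  rw [add_comm n i, Finset.sum_range_add y i n] at h1
  simp only [add_comm _ i, add_comm _ n]
  rw [sub_eq_sub_iff_add_eq_add, add_comm, h1, add_comm]

/-- The overlap of the two windows cancels, which leaves `2 * i` boundary terms whatever `n` is.
Almost invariance of the averaged law and insensitivity of Cesàro means to shifts both come from
this. -/
lemma norm_sum_range_sub_shift_le {G : Type*} [NormedAddCommGroup G] (y : ℕ → G) {L : ℝ}
    (hL : ∀ k, ‖y k‖ ≤ L) (n i : ℕ) :
    ‖∑ k ∈ Finset.range n, (y (k + i) - y k)‖ ≤ 2 * i * L := by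
  rw [sum_range_sub_shift]
  refine (norm_sum_le _ _).trans ((Finset.sum_le_card_nsmul _ _ (2 * L) fun k _ => ?_).trans ?_)
  · exact (norm_sub_le _ _).trans (by linarith [hL k, hL (k + n)])
  · rw [Finset.card_range, nsmul_eq_mul]; exact le_of_eq (by ring)

/-- The averaged law is almost invariant under shifts. -/
lemma abs_integral_occLaw_shift_sub_le (m : Measure (ℕ → E)) [IsProbabilityMeasure m] (n i : ℕ)
    {F : (ℕ → E) → ℝ} (hF : Measurable F) {B : ℝ} (hB : ∀ ω, |F ω| ≤ B) :
    |∫ ω, F (shiftPath i ω) ∂(occLaw m n) - ∫ ω, F ω ∂(occLaw m n)| ≤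
      ((n : ℝ) + 1)⁻¹ * (2 * i * B) := by
  have h2 := integral_occLaw m n (hF.comp (measurable_shiftPath i)) (fun ω => hB _)
  simp only [Function.comp] at h2
  rw [integral_occLaw m n hF hB, h2, ← mul_sub, ← Finset.sum_sub_distrib, abs_mul,
    abs_of_nonneg (by positivity)]
  refine mul_le_mul_of_nonneg_left ?_ (by positivity)
  have h1 : ∀ k (ω : ℕ → E), shiftPath i (shiftPath k ω) = shiftPath (k + i) ω := fun k ω => by
    funext l; simp [shiftPath, add_assoc]
  simp only [h1]
  refine norm_sum_range_sub_shift_le (fun k => ∫ ω, F (shiftPath k ω) ∂m) (fun k => ?_) _ _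
  have := norm_integral_le_of_norm_le_const (μ := m) (f := fun ω => F (shiftPath k ω)) (C := B)
    (Eventually.of_forall fun ω => hB _)
  simpa using this

end OccupationLaw

/-! ### Uniform integrability under the averaged laws. -/

section UniformIntegrability

/-- Superlinear growth of `ψ` makes the norm at most `η * ψ` outside of a large ball, and the
truncation error vanishes inside it. -/
lemma exists_norm_sub_trunc_le {E : Type*} [NormedAddCommGroup E] {ψ : E → ℝ}
    (hψ0 : ∀ x, 0 ≤ ψ x) (hψ : Tendsto (fun a => ψ a / ‖a‖) (Bornology.cobounded _) atTop)
    {η : ℝ} (hη : 0 < η) : ∃ L, 0 ≤ L ∧ ∀ x, ‖x - trunc L x‖ ≤ η * ψ x := by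
  obtain ⟨L, hL⟩ : ∃ L, ∀ x : E, L < ‖x‖ → η⁻¹ ≤ ψ x / ‖x‖ := by
    have h1 := hψ.eventually_ge_atTop η⁻¹
    rw [← comap_norm_atTop, eventually_comap] at h1
    obtain ⟨L, hL⟩ := eventually_atTop.1 h1
    exact ⟨L, fun x hx => hL _ hx.le x rfl⟩
  refine ⟨max L 0, le_max_right _ _, fun x => ?_⟩
  unfold trunc
  split_ifs with h
  · simpa using mul_nonneg hη.le (hψ0 x)
  · rw [not_le] at h
    have h2 := hL x ((le_max_left _ _).trans_lt h)
    have hx : 0 < ‖x‖ := (le_max_right _ _).trans_lt h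
    rw [le_div_iff₀ hx, inv_mul_le_iff₀ hη] at h2
    simpa using h2

variable {E : Type*} [MeasurableSpace E] [Zero E] (ν : Measure E) [IsProbabilityMeasure ν]
  (P : Kernel E E) [IsMarkovKernel P] {V ψ : E → ℝ} {a b : ℝ}

/-- For `i ≤ n` the shifted window stays in the first `2n + 1` indices, at the cost of a factor
about two in the occupation bound. The condition `hn` absorbs the initial value of `V` and makes the
bound independent of `a` and `n`. -/
lemma lintegral_psi_occLaw_le (hVm : Measurable V) (hψm : Measurable ψ) (hV0 : ∀ x, 0 ≤ V x)
    (hψ0 : ∀ x, 0 ≤ ψ x) (ha : 0 < a)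
    (hlyap : ∀ x, Integrable V (P x) ∧ ∫ y, V y ∂(P x) ≤ V x - a * ψ x + b)
    (hν : Integrable V ν) {c : ℝ} (hc : 0 ≤ c) (hb : b ≤ a * c) {n : ℕ}
    (hn : ∫ x, V x ∂ν ≤ a * (n + 1)) {i : ℕ} (hi : i ≤ n) :
    ∫⁻ ω, ENNReal.ofReal (ψ (ω i)) ∂(occLaw (chainLaw ν P) n) ≤ ENNReal.ofReal (1 + 2 * c) := by
  have hψi := integrable_psi_chainLaw ν P hVm hψm hV0 hψ0 ha hlyap hν
  have h1 := sum_integral_psi_le ν P hVm hψm hV0 hψ0 ha hlyap hν (2 * n + 1)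
  have h2 : ∑ k ∈ Finset.range (n + 1), ∫ ω, ψ (ω (k + i)) ∂(chainLaw ν P) ≤
      ∑ k ∈ Finset.range (2 * n + 1), ∫ ω, ψ (ω k) ∂(chainLaw ν P) := by
    have h := Finset.sum_map (Finset.range (n + 1)) (addRightEmbedding i)
      (fun k => ∫ ω, ψ (ω k) ∂(chainLaw ν P))
    simp only [addRightEmbedding_apply] at h
    rw [← h]
    refine Finset.sum_le_sum_of_subset_of_nonneg (fun k hk => ?_) fun k _ _ =>
      integral_nonneg fun ω => hψ0 _
    simp only [Finset.mem_map, Finset.mem_range, addRightEmbedding_apply] at hk ⊢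
    obtain ⟨l, hl, rfl⟩ := hk
    omega
  have hn' : (0 : ℝ) < n + 1 := by positivity
  have h3 : ((n : ℝ) + 1)⁻¹ * ∑ k ∈ Finset.range (n + 1), ∫ ω, ψ (ω (k + i)) ∂(chainLaw ν P) ≤
      1 + 2 * c := by
    rw [inv_mul_le_iff₀ hn']
    have h4 : a * ∑ k ∈ Finset.range (2 * n + 1), ∫ ω, ψ (ω k) ∂(chainLaw ν P) ≤
        a * ((n + 1) * (1 + 2 * c)) := by
      push_cast at h1
      have h5 : (2 * (n : ℝ) + 1) * b ≤ (2 * n + 1) * (a * c) :=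
        mul_le_mul_of_nonneg_left hb (by positivity)
      have h6 : 0 ≤ a * c := mul_nonneg ha.le hc
      nlinarith
    exact h2.trans (le_of_mul_le_mul_left h4 ha)
  have hm : Measurable fun ω : ℕ → E => ENNReal.ofReal (ψ (ω i)) :=
    (hψm.comp (measurable_pi_apply i)).ennreal_ofReal
  rw [lintegral_occLaw _ _ hm]
  refine le_trans (le_of_eq ?_) (ENNReal.ofReal_le_ofReal h3)
  rw [ENNReal.ofReal_mul (by positivity), ENNReal.ofReal_sum_of_nonneg fun k _ =>
    integral_nonneg fun ω => hψ0 _, ENNReal.ofReal_inv_of_pos hn']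
  congr 1
  · congr 1
    rw [← Nat.cast_succ, ENNReal.ofReal_natCast]
  · refine Finset.sum_congr rfl fun k _ => ?_
    rw [ofReal_integral_eq_lintegral_ofReal (hψi _) (Eventually.of_forall fun ω => hψ0 _)]
    rfl

end UniformIntegrability

/-! ### Cesàro means as averages of block averages. -/

section BlockAverages

/-- The average of the first `K` norms of the parts of the path removed by the truncation. -/
noncomputable def tailAvg {E : Type*} [NormedAddCommGroup E] (L : ℝ) (K : ℕ) (ω : ℕ → E) : ℝ :=
  blockAvg K fun i => ‖ω i - trunc L (ω i)‖

lemma tailAvg_nonneg {E : Type*} [NormedAddCommGroup E] (L : ℝ) (K : ℕ) (ω : ℕ → E) :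
    0 ≤ tailAvg L K ω :=
  smul_nonneg (by positivity) (Finset.sum_nonneg fun _ _ => norm_nonneg _)

variable {E : Type*} [NormedAddCommGroup E] [NormedSpace ℝ E]

lemma norm_blockAvg_sub_trunc_le (L : ℝ) (K : ℕ) (ω : ℕ → E) :
    ‖blockAvg K ω - blockAvg K (fun i => trunc L (ω i))‖ ≤ tailAvg L K ω := by
  rw [blockAvg, blockAvg, ← smul_sub, ← Finset.sum_sub_distrib, norm_smul, Real.norm_of_nonneg
    (by positivity), tailAvg, blockAvg, smul_eq_mul]
  gcongr
  exact norm_sum_le _ _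

lemma norm_blockAvg_le {L : ℝ} (hL : 0 ≤ L) (K : ℕ) (ω : ℕ → E) (h : ∀ i, ‖ω i‖ ≤ L) :
    ‖blockAvg K ω‖ ≤ L := by
  rw [blockAvg, norm_smul, Real.norm_of_nonneg (by positivity)]
  rcases K.eq_zero_or_pos with rfl | hK
  · simpa using hL
  · rw [inv_mul_le_iff₀ (by exact_mod_cast hK)]
    refine (norm_sum_le _ _).trans ((Finset.sum_le_card_nsmul _ _ L fun i _ => h i).trans ?_)
    simp

lemma norm_blockAvg_le_add_tailAvg {L : ℝ} (hL : 0 ≤ L) (K : ℕ) (ω : ℕ → E) :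
    ‖blockAvg K ω‖ ≤ L + tailAvg L K ω := by
  have h1 := norm_blockAvg_le hL K (fun i => trunc L (ω i)) fun i => norm_trunc_le hL _
  have h2 := norm_blockAvg_sub_trunc_le L K ω
  have h3 := norm_sub_norm_le (blockAvg K ω) (blockAvg K (fun i => trunc L (ω i)))
  linarith

/-- The path is split at radius `L`: the truncated part contributes only `2 * i` boundary terms,
while the removed part is estimated by brute force and controlled later by uniform integrability. -/
lemma norm_cesaro_sub_shift_le {L : ℝ} (hL : 0 ≤ L) (n i : ℕ) (ω : ℕ → E) :
    ‖cesaro n ω - cesaro n (shiftPath i ω)‖ ≤ ((n : ℝ) + 1)⁻¹ * (∑ k ∈ Finset.range (n + 1),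
      (‖ω k - trunc L (ω k)‖ + ‖ω (k + i) - trunc L (ω (k + i))‖) + 2 * i * L) := by
  rw [cesaro, cesaro, ← smul_sub, norm_smul, Real.norm_of_nonneg (by positivity)]
  gcongr
  set t : E → E := trunc L with ht
  have h1 : ∑ k ∈ Finset.range (n + 1), ω k - ∑ k ∈ Finset.range (n + 1), shiftPath i ω k =
      ∑ k ∈ Finset.range (n + 1), ((ω k - t (ω k)) - (ω (k + i) - t (ω (k + i)))) -
        ∑ k ∈ Finset.range (n + 1), (t (ω (k + i)) - t (ω k)) := by
    rw [← Finset.sum_sub_distrib, ← Finset.sum_sub_distrib]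
    refine Finset.sum_congr rfl fun k _ => ?_
    rw [shiftPath, add_comm i k]; abel
  rw [h1]
  refine (norm_sub_le _ _).trans (add_le_add ?_ ?_)
  · exact (norm_sum_le _ _).trans (Finset.sum_le_sum fun k _ => norm_sub_le _ _)
  · exact norm_sum_range_sub_shift_le (fun k => t (ω k)) (fun k => norm_trunc_le hL _) _ _

/-- Cesàro means are averages of the block averages of the shifted paths, up to boundary terms. -/
lemma norm_cesaro_sub_le {L : ℝ} (hL : 0 ≤ L) (n : ℕ) {K : ℕ} (hK : 0 < K) (ω : ℕ → E) :
    ‖cesaro n ω - cesaro n (fun k => blockAvg K (shiftPath k ω))‖ ≤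
      ((n : ℝ) + 1)⁻¹ * ∑ k ∈ Finset.range (n + 1),
        (‖ω k - trunc L (ω k)‖ + tailAvg L K (shiftPath k ω)) + ((n : ℝ) + 1)⁻¹ * (2 * K * L) := by
  have hK' : (0 : ℝ) < K := by exact_mod_cast hK
  -- Exchanging the sums gives an average of Cesàro means of shifts by `i < K`, each close to the
  -- unshifted one.
  have h1 : cesaro n (fun k => blockAvg K (shiftPath k ω)) =
      blockAvg K fun i => cesaro n (shiftPath i ω) := by
    simp only [cesaro, blockAvg]
    rw [← Finset.smul_sum, ← Finset.smul_sum, smul_comm, Finset.sum_comm]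
    simp only [shiftPath, add_comm]
  have h2 : cesaro n ω = blockAvg K fun _ => cesaro n ω := by
    rw [blockAvg, Finset.sum_const, Finset.card_range, ← Nat.cast_smul_eq_nsmul ℝ, smul_smul,
      inv_mul_cancel₀ hK'.ne', one_smul]
  rw [h1, h2, blockAvg, blockAvg, ← smul_sub, ← Finset.sum_sub_distrib, norm_smul,
    Real.norm_of_nonneg (by positivity)]
  calc (K : ℝ)⁻¹ * ‖∑ i ∈ Finset.range K, (cesaro n ω - cesaro n (shiftPath i ω))‖
      ≤ (K : ℝ)⁻¹ * ∑ i ∈ Finset.range K, ((n : ℝ) + 1)⁻¹ * (∑ k ∈ Finset.range (n + 1),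
          (‖ω k - trunc L (ω k)‖ + ‖ω (k + i) - trunc L (ω (k + i))‖) + 2 * K * L) := by
        gcongr
        refine (norm_sum_le _ _).trans (Finset.sum_le_sum fun i hi => ?_)
        refine (norm_cesaro_sub_shift_le hL n i ω).trans ?_
        gcongr
        exact (Finset.mem_range.1 hi).le
    _ = _ := by
        rw [← Finset.mul_sum, Finset.sum_add_distrib, Finset.sum_comm]
        simp only [Finset.sum_add_distrib, tailAvg, blockAvg, shiftPath, Finset.sum_const,
          Finset.card_range, nsmul_eq_mul, smul_eq_mul, ← Finset.mul_sum]
        field_simp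

end BlockAverages

/-! ### Transfer of the mean cost from Cesàro means to block averages. -/

section BlockAverageLaws

variable {E : Type*} [NormedAddCommGroup E] [NormedSpace ℝ E] [MeasurableSpace E] [BorelSpace E]

lemma measurable_tailAvg {E : Type*} [NormedAddCommGroup E] [MeasurableSpace E] [BorelSpace E]
    [SecondCountableTopology E] (L : ℝ) (K : ℕ) : Measurable (tailAvg (E := E) L K) := by
  have h : ∀ i, Measurable fun ω : ℕ → E => ‖ω i - trunc L (ω i)‖ := fun i =>
    ((measurable_pi_apply i).sub ((measurable_trunc L).comp (measurable_pi_apply i))).norm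
  exact (Finset.measurable_sum _ fun i _ => h i).const_mul _

lemma lintegral_tailAvg_le {E : Type*} [NormedAddCommGroup E] [MeasurableSpace E] [BorelSpace E]
    [SecondCountableTopology E] (Q : Measure (ℕ → E)) (L : ℝ) (K : ℕ) {c : ℝ≥0∞}
    (h : ∀ i < K, ∫⁻ ω, ENNReal.ofReal ‖ω i - trunc L (ω i)‖ ∂Q ≤ c) :
    ∫⁻ ω, ENNReal.ofReal (tailAvg L K ω) ∂Q ≤ c := by
  rcases K.eq_zero_or_pos with rfl | hK
  · simp [tailAvg, blockAvg]
  have hK' : (0 : ℝ) < K := by exact_mod_cast hK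
  have h1 : ∀ ω : ℕ → E, ENNReal.ofReal (tailAvg L K ω) =
      (K : ℝ≥0∞)⁻¹ * ∑ i ∈ Finset.range K, ENNReal.ofReal ‖ω i - trunc L (ω i)‖ := fun ω => by
    rw [tailAvg, blockAvg, smul_eq_mul, ENNReal.ofReal_mul (by positivity),
      ENNReal.ofReal_inv_of_pos hK', ENNReal.ofReal_natCast,
      ENNReal.ofReal_sum_of_nonneg fun _ _ => norm_nonneg _]
  have hm : ∀ i, Measurable fun ω : ℕ → E => ENNReal.ofReal ‖ω i - trunc L (ω i)‖ := fun i =>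
    ((measurable_pi_apply i).sub
      ((measurable_trunc L).comp (measurable_pi_apply i))).norm.ennreal_ofReal
  simp only [h1]
  rw [lintegral_const_mul' _ _ (by simpa using hK.ne'), lintegral_finsetSum _ fun i _ => hm i]
  calc _ ≤ (K : ℝ≥0∞)⁻¹ * ∑ i ∈ Finset.range K, c := by
        gcongr with i hi; exact h i (Finset.mem_range.1 hi)
    _ = c := by
        rw [Finset.sum_const, Finset.card_range, nsmul_eq_mul, ← mul_assoc,
          ENNReal.inv_mul_cancel (by simpa using hK.ne') (by simp), one_mul]

lemma measurable_blockAvg [SecondCountableTopology E] (K : ℕ) :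
    Measurable (blockAvg (E := E) K) := by
  unfold blockAvg
  exact (Finset.measurable_sum _ fun i _ => measurable_pi_apply i).const_smul _

lemma measurable_cesaro [SecondCountableTopology E] (n : ℕ) : Measurable (cesaro (E := E) n) := by
  unfold cesaro
  exact (Finset.measurable_sum _ fun i _ => measurable_pi_apply i).const_smul _

/-- The mean cost of a Cesàro mean is at most the mean cost of a block average. -/
lemma lintegral_cesaro_le [SecondCountableTopology E] (m : Measure (ℕ → E))
    [IsProbabilityMeasure m] {d : E → ℝ} (hd0 : ∀ x, 0 ≤ d x) (hconv : ConvexOn ℝ univ d)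
    (hlip : LipschitzWith 1 d) {L : ℝ} (hL : 0 ≤ L) {n K : ℕ} (hK : 0 < K) {c : ℝ≥0∞}
    (h : ∀ i < K, ∫⁻ ω, ENNReal.ofReal ‖ω i - trunc L (ω i)‖ ∂(occLaw m n) ≤ c) :
    ∫⁻ ω, ENNReal.ofReal (d (cesaro n ω)) ∂m ≤
      ∫⁻ ω, ENNReal.ofReal (d (blockAvg K ω)) ∂(occLaw m n) + 2 * c +
        ENNReal.ofReal (((n : ℝ) + 1)⁻¹ * (2 * K * L)) := by
  have hn : (0 : ℝ) < n + 1 := by positivity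
  set f : (ℕ → E) → ℝ := fun ω => ‖ω 0 - trunc L (ω 0)‖ with hf
  have hfm : Measurable f := ((measurable_pi_apply 0).sub
      ((measurable_trunc L).comp (measurable_pi_apply 0))).norm
  set F : (ℕ → E) → ℝ≥0∞ := fun ω => ENNReal.ofReal (d (blockAvg K ω)) + (ENNReal.ofReal (f ω) +
    ENNReal.ofReal (tailAvg L K ω)) with hF
  have hdm : Measurable d := hlip.continuous.measurable
  have hFm1 : Measurable fun ω : ℕ → E => ENNReal.ofReal (d (blockAvg K ω)) :=
    (hdm.comp (measurable_blockAvg K)).ennreal_ofReal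
  have hFm : Measurable F :=
    hFm1.add (hfm.ennreal_ofReal.add (measurable_tailAvg L K).ennreal_ofReal)
  have hpt : ∀ ω : ℕ → E, ENNReal.ofReal (d (cesaro n ω)) ≤
      ((n + 1 : ℕ) : ℝ≥0∞)⁻¹ * ∑ k ∈ Finset.range (n + 1), F (shiftPath k ω) +
        ENNReal.ofReal (((n : ℝ) + 1)⁻¹ * (2 * K * L)) := by
    intro ω
    have h1 := norm_cesaro_sub_le hL n hK ω
    -- Jensen's inequality for the uniform average over starting times; integrating it produces the
    -- averaged law.
    have h2 : d (cesaro n fun k => blockAvg K (shiftPath k ω)) ≤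
        ((n : ℝ) + 1)⁻¹ * ∑ k ∈ Finset.range (n + 1), d (blockAvg K (shiftPath k ω)) := by
      have h3 := hconv.map_sum_le (t := Finset.range (n + 1)) (w := fun _ => ((n : ℝ) + 1)⁻¹)
        (p := fun k => blockAvg K (shiftPath k ω)) (fun _ _ => by positivity)
        (by simp [Finset.sum_const]; field_simp) (fun _ _ => mem_univ _)
      rw [← Finset.smul_sum, ← Finset.smul_sum] at h3
      exact h3
    have h3 : d (cesaro n ω) ≤ d (cesaro n fun k => blockAvg K (shiftPath k ω)) +
        ‖cesaro n ω - cesaro n (fun k => blockAvg K (shiftPath k ω))‖ := by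
      have := hlip.dist_le_mul (cesaro n ω) (cesaro n fun k => blockAvg K (shiftPath k ω))
      rw [NNReal.coe_one, one_mul, Real.dist_eq, dist_eq_norm] at this
      linarith [le_abs_self (d (cesaro n ω) - d (cesaro n fun k => blockAvg K (shiftPath k ω)))]
    have h4 : d (cesaro n ω) ≤ ((n : ℝ) + 1)⁻¹ * ∑ k ∈ Finset.range (n + 1),
        (d (blockAvg K (shiftPath k ω)) + (f (shiftPath k ω) + tailAvg L K (shiftPath k ω))) +
          ((n : ℝ) + 1)⁻¹ * (2 * K * L) := by
      rw [Finset.sum_add_distrib, mul_add]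
      simp only [hf, shiftPath, add_zero] at h1 h2 h3 ⊢
      linarith
    have h5 : ∀ k, 0 ≤ d (blockAvg K (shiftPath k ω)) + (f (shiftPath k ω) +
        tailAvg L K (shiftPath k ω)) := fun k =>
      add_nonneg (hd0 _) (add_nonneg (norm_nonneg _) (tailAvg_nonneg _ _ _))
    refine (ENNReal.ofReal_le_ofReal h4).trans (ENNReal.ofReal_add_le.trans (le_of_eq ?_))
    congr 1
    rw [ENNReal.ofReal_mul (by positivity), ENNReal.ofReal_inv_of_pos hn,
      ENNReal.ofReal_sum_of_nonneg fun k _ => h5 k, ← Nat.cast_succ, ENNReal.ofReal_natCast]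
    congr 1
    refine Finset.sum_congr rfl fun k _ => ?_
    rw [ENNReal.ofReal_add (hd0 _) (add_nonneg (norm_nonneg _) (tailAvg_nonneg _ _ _)),
      ENNReal.ofReal_add (norm_nonneg _) (tailAvg_nonneg _ _ _)]
  have hFk : ∀ k, Measurable fun ω => F (shiftPath k ω) := fun k =>
    hFm.comp (measurable_shiftPath k)
  calc _ ≤ ∫⁻ ω, (((n + 1 : ℕ) : ℝ≥0∞)⁻¹ * ∑ k ∈ Finset.range (n + 1), F (shiftPath k ω) +
        ENNReal.ofReal (((n : ℝ) + 1)⁻¹ * (2 * K * L))) ∂m := lintegral_mono hpt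
    _ = ∫⁻ ω, F ω ∂(occLaw m n) + ENNReal.ofReal (((n : ℝ) + 1)⁻¹ * (2 * K * L)) := by
        rw [lintegral_add_right _ measurable_const, lintegral_const_mul' _ _ (by simp),
          lintegral_finsetSum _ fun k _ => hFk k,
          lintegral_occLaw m n hFm]
        simp
    _ ≤ _ := by
        gcongr
        simp only [hF]
        rw [lintegral_add_left hFm1, lintegral_add_left hfm.ennreal_ofReal, two_mul]
        gcongr
        · exact h 0 hK
        · exact lintegral_tailAvg_le _ L K h

end BlockAverageLaws

/-! ### Ergodic comparison of long block averages. -/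

section Ergodic

variable {E : Type*} [NormedAddCommGroup E] [InnerProductSpace ℝ E]
  [MeasurableSpace E] [BorelSpace E] [SecondCountableTopology E]

lemma blockAvg_mul {E : Type*} [AddCommGroup E] [Module ℝ E] (m κ : ℕ) (ω : ℕ → E) :
    blockAvg (m * κ) ω = blockAvg m fun i => blockAvg κ (shiftPath (i * κ) ω) := by
  unfold blockAvg
  rw [← Finset.smul_sum, smul_smul, Nat.cast_mul, mul_inv]
  congr 1
  induction m with
  | zero => simp
  | succ m ih =>
    rw [Nat.succ_mul, Finset.sum_range_add, ih, Finset.sum_range_succ]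
    rfl

/-- Long block averages of asymptotically stationary sequences are close to each other. -/
lemma exists_forall_lintegral_blockAvg_sub_le (𝒰 : Ultrafilter ℕ) (h𝒰 : (𝒰 : Filter ℕ) ≤ atTop)
    (m : ℕ → Measure (ℕ → E)) [∀ j, IsProbabilityMeasure (m j)] (n κ : ℕ → ℕ)
    (hκ : Tendsto (fun j => (κ j : ℝ) / ((n j : ℝ) + 1)) atTop (𝓝 0))
    {δ : ℝ} (hδ : 0 < δ)
    (htail : ∃ L, 0 ≤ L ∧ ∀ j, ∀ i ≤ n j,
      ∫⁻ ω, ENNReal.ofReal ‖ω i - trunc L (ω i)‖ ∂(occLaw (m j) (n j)) ≤ ENNReal.ofReal δ) :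
    ∃ a₀ : ℕ, ∀ a ≥ a₀, ∀ b ≥ a₀, ∀ᶠ j in 𝒰,
      ∫⁻ ω, ENNReal.ofReal ‖blockAvg (a * κ j) ω - blockAvg (b * κ j) ω‖ ∂(occLaw (m j) (n j)) ≤
        ENNReal.ofReal (3 * δ) := by
  obtain ⟨L, hL, htail⟩ := htail
  set t : (ℕ → E) → ℕ → E := fun ω i => trunc L (ω i) with ht
  have htm : Measurable t := measurable_pi_lambda _ fun i =>
    (measurable_trunc L).comp (measurable_pi_apply i)
  -- The stationary variables are averages of the truncated path over consecutive blocks of `κ j`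
  -- steps, with `θ` the shift by `κ j`. The defect of invariance is of order `κ j / (n j + 1)`,
  -- which tends to zero.
  obtain ⟨a₀, ha₀⟩ := exists_forall_integral_norm_avg_sub_le 𝒰 (fun j => occLaw (m j) (n j))
    (fun j => shiftPath (κ j)) (fun j i ω => blockAvg (κ j) (shiftPath (i * κ j) (t ω)))
    (fun j i => (measurable_blockAvg _).comp ((measurable_shiftPath _).comp htm)) L
    (fun j i ω => norm_blockAvg_le hL _ _ fun l => norm_trunc_le hL _)
    (fun j i ω => by
      congr 1; funext l
      simp only [shiftPath, ht]
      congr 2; ring)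
    (fun F B hF hB => by
      have h1 : Tendsto (fun j => 2 * B * ((κ j : ℝ) / ((n j : ℝ) + 1))) 𝒰 (𝓝 0) := by
        simpa using (hκ.mono_left h𝒰).const_mul (2 * B)
      refine squeeze_zero_norm (fun j => ?_) h1
      refine (abs_integral_occLaw_shift_sub_le (m j) (n j) (κ j) (hF j) (hB j)).trans (le_of_eq ?_)
      field_simp) hδ
  refine ⟨a₀, fun a ha b hb => ?_⟩
  have hsmall : ∀ c : ℕ, ∀ᶠ j in 𝒰, c * κ j ≤ n j + 1 := by
    intro c
    have h1 : Tendsto (fun j => c * ((κ j : ℝ) / ((n j : ℝ) + 1))) 𝒰 (𝓝 0) := by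
      simpa using (hκ.mono_left h𝒰).const_mul (c : ℝ)
    filter_upwards [h1.eventually (gt_mem_nhds zero_lt_one)] with j hj
    rw [← mul_div_assoc, div_lt_one (by positivity)] at hj
    exact_mod_cast hj.le
  filter_upwards [ha₀ a ha b hb, hsmall a, hsmall b] with j hj hja hjb
  have hb' : ∀ (c : ℕ) (ω : ℕ → E), blockAvg (c * κ j) (t ω) = (c : ℝ)⁻¹ • ∑ i ∈ Finset.range c,
      blockAvg (κ j) (shiftPath (i * κ j) (t ω)) := fun c ω => blockAvg_mul _ _ _
  simp only [← hb'] at hj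
  have hm : ∀ c : ℕ, Measurable fun ω : ℕ → E => blockAvg (c * κ j) (t ω) := fun c =>
    (measurable_blockAvg _).comp htm
  have hpt : ∀ ω : ℕ → E, ENNReal.ofReal ‖blockAvg (a * κ j) ω - blockAvg (b * κ j) ω‖ ≤
      ENNReal.ofReal ‖blockAvg (a * κ j) (t ω) - blockAvg (b * κ j) (t ω)‖ +
        (ENNReal.ofReal (tailAvg L (a * κ j) ω) + ENNReal.ofReal (tailAvg L (b * κ j) ω)) := by
    intro ω
    rw [← ENNReal.ofReal_add (tailAvg_nonneg _ _ _) (tailAvg_nonneg _ _ _),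
      ← ENNReal.ofReal_add (norm_nonneg _)
        (add_nonneg (tailAvg_nonneg _ _ _) (tailAvg_nonneg _ _ _))]
    refine ENNReal.ofReal_le_ofReal ?_
    have h1 := norm_blockAvg_sub_trunc_le L (a * κ j) ω
    have h2 := norm_blockAvg_sub_trunc_le L (b * κ j) ω
    rw [norm_sub_rev] at h2
    have h3 := norm_add₃_le (a := blockAvg (a * κ j) (t ω) - blockAvg (b * κ j) (t ω))
      (b := blockAvg (a * κ j) ω - blockAvg (a * κ j) (t ω))
      (c := blockAvg (b * κ j) (t ω) - blockAvg (b * κ j) ω)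
    have h4 : blockAvg (a * κ j) (t ω) - blockAvg (b * κ j) (t ω) +
        (blockAvg (a * κ j) ω - blockAvg (a * κ j) (t ω)) +
        (blockAvg (b * κ j) (t ω) - blockAvg (b * κ j) ω) =
        blockAvg (a * κ j) ω - blockAvg (b * κ j) ω := by abel
    rw [h4] at h3
    linarith
  have hT : ∀ c : ℕ, c * κ j ≤ n j + 1 → ∫⁻ ω, ENNReal.ofReal (tailAvg L (c * κ j) ω)
      ∂(occLaw (m j) (n j)) ≤ ENNReal.ofReal δ := fun c hc =>
    lintegral_tailAvg_le _ L _ fun i hi => htail j i (by omega)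
  have hi : Integrable (fun ω => ‖blockAvg (a * κ j) (t ω) - blockAvg (b * κ j) (t ω)‖)
      (occLaw (m j) (n j)) :=
    Integrable.of_bound ((hm a).sub (hm b)).norm.aestronglyMeasurable (L + L)
      (Eventually.of_forall fun ω => by
        rw [norm_norm]
        exact (norm_sub_le _ _).trans (add_le_add
          (norm_blockAvg_le hL _ _ fun l => norm_trunc_le hL _)
          (norm_blockAvg_le hL _ _ fun l => norm_trunc_le hL _)))
  calc _ ≤ ∫⁻ ω, (ENNReal.ofReal ‖blockAvg (a * κ j) (t ω) - blockAvg (b * κ j) (t ω)‖ +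
        (ENNReal.ofReal (tailAvg L (a * κ j) ω) + ENNReal.ofReal (tailAvg L (b * κ j) ω)))
          ∂(occLaw (m j) (n j)) := lintegral_mono hpt
    _ ≤ ENNReal.ofReal δ + (ENNReal.ofReal δ + ENNReal.ofReal δ) := by
        have hm' : Measurable fun ω : ℕ → E =>
            ENNReal.ofReal ‖blockAvg (a * κ j) (t ω) - blockAvg (b * κ j) (t ω)‖ :=
          ((hm a).sub (hm b)).norm.ennreal_ofReal
        rw [lintegral_add_left hm',
          lintegral_add_left (measurable_tailAvg L _).ennreal_ofReal]
        gcongr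
        · rw [← ofReal_integral_eq_lintegral_ofReal hi
            (Eventually.of_forall fun ω => norm_nonneg _)]
          exact ENNReal.ofReal_le_ofReal hj
        · exact hT a hja
        · exact hT b hjb
    _ = ENNReal.ofReal (3 * δ) := by
        rw [← ENNReal.ofReal_add hδ.le hδ.le, ← ENNReal.ofReal_add hδ.le (by positivity)]
        congr 1; ring

end Ergodic

/-! ### Selecting a sample point outside of a small bad set. -/

section Selection

variable {Ω : Type*} [MeasurableSpace Ω] (Q : Measure Ω)

/-- If `f` were at most `s` off `B`, its integral could not exceed `s + C * q + e`. The splitting `f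
≤ C + g` stands in for boundedness of `f` on the bad set. -/
lemma exists_notMem_lt_of_lt_lintegral [IsProbabilityMeasure Q] {f g : Ω → ℝ≥0∞} (hg : Measurable g)
    {C e s q : ℝ≥0∞} {B : Set Ω} (hf : ∀ ω, f ω ≤ C + g ω) (hB : Q B ≤ q) (hge : ∫⁻ ω, g ω ∂Q ≤ e)
    (hlt : s + C * q + e < ∫⁻ ω, f ω ∂Q) : ∃ ω ∉ B, s < f ω := by
  by_contra! hcon
  refine hlt.not_ge ?_
  calc ∫⁻ ω, f ω ∂Q ≤ ∫⁻ ω, (s + B.indicator (fun _ => C) ω + g ω) ∂Q := by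
        refine lintegral_mono fun ω => ?_
        by_cases hω : ω ∈ B
        · simp only [indicator_of_mem hω]
          exact (hf ω).trans (by gcongr; exact le_add_self)
        · exact (hcon ω hω).trans (by simp [indicator_of_notMem hω])
    _ = s + ∫⁻ ω, B.indicator (fun _ => C) ω ∂Q + ∫⁻ ω, g ω ∂Q := by
        rw [lintegral_add_right _ hg, lintegral_add_left measurable_const]
        simp
    _ ≤ s + C * q + e := by
        gcongr
        exact (lintegral_indicator_const_le B C).trans (by gcongr)

lemma measure_ge_le_of_lintegral_le {F : Ω → ℝ} (hF : Measurable F) {c q : ℝ} (hc : 0 < c)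
    (h : ∫⁻ ω, ENNReal.ofReal (F ω) ∂Q ≤ ENNReal.ofReal (c * q)) :
    Q {ω | c ≤ F ω} ≤ ENNReal.ofReal q := by
  have h1 := mul_meas_ge_le_lintegral (μ := Q) hF.ennreal_ofReal (ENNReal.ofReal c)
  have h2 : {ω | c ≤ F ω} ⊆ {ω | ENNReal.ofReal c ≤ ENNReal.ofReal (F ω)} := fun ω hω =>
    ENNReal.ofReal_le_ofReal hω
  have h3 : ENNReal.ofReal c * Q {ω | c ≤ F ω} ≤ ENNReal.ofReal c * ENNReal.ofReal q := by
    rw [← ENNReal.ofReal_mul hc.le]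
    exact le_trans (by gcongr) (h1.trans h)
  exact (ENNReal.mul_le_mul_iff_right (ENNReal.ofReal_pos.2 hc).ne' ENNReal.ofReal_ne_top).1 h3

end Selection

/-! ### Radius of the stopping ball and smallness of the noise as `γ → 0`. -/

section Drift

variable {N : ℕ} {Ξ : Type*} [MeasurableSpace Ξ] {γ₀ : ℝ} {μ : Measure Ξ}
  {P : Ioo (0 : ℝ) γ₀ → Kernel (EuclideanSpace ℝ (Fin N)) (EuclideanSpace ℝ (Fin N))}
  {h : Ioo (0 : ℝ) γ₀ → Ξ → EuclideanSpace ℝ (Fin N) → EuclideanSpace ℝ (Fin N)}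
  {H : Ξ → EuclideanSpace ℝ (Fin N) → Set (EuclideanSpace ℝ (Fin N))}

lemma RM.measurable_meanDrift [IsProbabilityMeasure μ] (hRM : RM μ P h H) (γ : Ioo (0 : ℝ) γ₀) :
    Measurable (meanDrift μ h γ) :=
  (StronglyMeasurable.integral_prod_left' (μ := μ)
    (hRM.measurable_h γ).stronglyMeasurable).measurable

/-- A time-dependent radius which dominates all solutions started in a ball. -/
lemma RM.exists_radius (hRM : RM μ P h H) (r : ℝ) : ∃ Rad : ℝ → ℝ, Monotone Rad ∧
    ∀ a, ‖a‖ ≤ r → ∀ x ∈ solutions (fun x => selectionIntegral μ (fun s => H s x)) a,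
      ∀ t : ℝ≥0, ‖x t‖ + 1 ≤ Rad (t - 1) := by
  choose C hC using fun n : ℕ => hRM.solutions_bounded ((n : ℝ≥0) + 1) (by positivity)
    (Metric.closedBall 0 r) (isCompact_closedBall 0 r)
  -- Summing absolute values makes the radius monotone, and its last term bounds the solutions up to
  -- time `⌈t - 1⌉ + 1 ≥ t`.
  refine ⟨fun s => ∑ n ∈ Finset.range (⌈s⌉₊ + 1), |C n| + 1, fun s t hst => ?_,
    fun a ha x hx t => ?_⟩
  · simp only
    gcongr
  · have h1 : t ≤ (⌈(t : ℝ) - 1⌉₊ : ℝ≥0) + 1 := by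
      have := Nat.le_ceil ((t : ℝ) - 1)
      rw [← NNReal.coe_le_coe]
      push_cast
      linarith
    have h2 := hC _ a (mem_closedBall_zero_iff.2 ha) x hx t h1
    have h3 := Finset.single_le_sum (f := fun n => |C n|) (fun _ _ => abs_nonneg _)
      (Finset.self_mem_range_succ ⌈(t : ℝ) - 1⌉₊)
    simp only at h3 ⊢
    linarith [le_abs_self (C ⌈(t : ℝ) - 1⌉₊)]

/-- The order of choice matters: a large `Λ` first makes the tail term small, then a small `γ`
handles the martingale term, which grows with `Λ`. -/
lemma exists_pos_forall_bound_le {T c M : ℝ} {ε η : ℝ}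
    (hε : 0 < ε) (hη : 0 < η) : ∃ Λ > 0, ∀ᶠ γ in 𝓝 (0 : ℝ),
      c * (2 * Λ * √(T * γ) + T * (2 * (Λ ^ (-ε) * M))) ≤ η := by
  have h1 : Tendsto (fun Λ : ℝ => c * (T * (2 * (Λ ^ (-ε) * M)))) atTop (𝓝 0) := by
    have := ((((tendsto_rpow_neg_atTop hε).mul_const M).const_mul 2).const_mul T).const_mul c
    simpa using this
  obtain ⟨Λ, hΛ, hΛ0⟩ := ((h1.eventually (gt_mem_nhds hη)).and (eventually_gt_atTop 0)).exists
  refine ⟨Λ, hΛ0, ?_⟩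
  have h2 : Tendsto (fun γ : ℝ => c * (2 * Λ * √(T * γ) + T * (2 * (Λ ^ (-ε) * M)))) (𝓝 0)
      (𝓝 (c * (2 * Λ * √(T * 0) + T * (2 * (Λ ^ (-ε) * M))))) :=
    Continuous.tendsto (by fun_prop) 0
  refine (h2.eventually (gt_mem_nhds ?_)).mono fun γ hγ => hγ.le
  simpa using hΛ

/-- The accumulated deviations from the mean drift are small in mean. -/
lemma RM.eventually_lintegral_stopErr_le [IsProbabilityMeasure μ]
    [∀ γ, IsMarkovKernel (P γ)] (hRM : RM μ P h H)
    (ν : Measure (EuclideanSpace ℝ (Fin N))) [IsProbabilityMeasure ν] {Rad : ℝ → ℝ}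
    (hRad : Monotone Rad) (T : ℕ) {η : ℝ} (hη : 0 < η) :
    ∀ᶠ γ : Ioo (0 : ℝ) γ₀ in comap Subtype.val (𝓝 0), ∀ n,
      ∫⁻ ω, ENNReal.ofReal ((γ : ℝ) * ∑ i ∈ Finset.range (⌊T / (γ : ℝ)⌋₊ + 1),
        ‖stopErr Rad γ ω (meanDrift μ h γ) i‖) ∂(occLaw (chainLaw ν (P γ)) n) ≤
        ENNReal.ofReal η := by
  obtain ⟨ε, hε, M, hM, hmom⟩ := hRM.exists_moment_bound (Rad T)
  have hT : (0 : ℝ) ≤ T := Nat.cast_nonneg T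
  have hγ₀ : (0 : ℝ) ≤ T + |γ₀| := by positivity
  obtain ⟨Λ, hΛ, hev⟩ := exists_pos_forall_bound_le (T := T) (c := T + |γ₀|)
    (M := M.toReal) hε hη
  filter_upwards [preimage_mem_comap hev] with γ hγη n
  have hγ : (0 : ℝ) < γ := γ.2.1
  have hbm := hRM.measurable_meanDrift γ
  set b := meanDrift μ h γ with hb
  have hm : ∀ i, Measurable fun ω : ℕ → EuclideanSpace ℝ (Fin N) =>
      ENNReal.ofReal ‖stopErr Rad γ ω b i‖ := fun i =>
    (measurable_stopErr Rad γ hbm i).norm.ennreal_ofReal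
  set K := ⌊T / (γ : ℝ)⌋₊ with hK
  have hKT : (K : ℝ) * γ ≤ T := by
    have := Nat.floor_le (div_nonneg hT hγ.le)
    rwa [le_div_iff₀ hγ] at this
  set D : ℝ := γ * (2 * Λ * √K + K * (2 * (Λ ^ (-ε) * M.toReal))) with hD
  have hΛε : 0 ≤ Λ ^ (-ε) := Real.rpow_nonneg hΛ.le _
  have hterm : ∀ i < K + 1, ∫⁻ ω, ENNReal.ofReal ‖stopErr Rad γ ω b i‖
      ∂(occLaw (chainLaw ν (P γ)) n) ≤ ENNReal.ofReal D := by
    intro i hi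
    refine lintegral_occLaw_le _ n (hm i) fun k => ?_
    have hiK : (i : ℝ) ≤ K := by exact_mod_cast Nat.lt_succ_iff.1 hi
    have h1 := lintegral_enorm_stopErr_le ν (P γ) hγ hbm (fun x => (hRM.drift γ x).symm) Rad hε hΛ
      hM
      (fun x hx => (hmom γ x hx).1) k i fun l hl => hRad <| by
        have : (l : ℝ) ≤ K := by exact_mod_cast hl.le.trans (Nat.lt_succ_iff.1 hi)
        exact (mul_le_mul_of_nonneg_right this hγ.le).trans hKT
    simp only [ofReal_norm]
    refine h1.trans ?_
    rw [hD, ENNReal.ofReal_mul hγ.le, ENNReal.ofReal_add (by positivity) (by positivity),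
      ENNReal.ofReal_mul (p := (K : ℝ)) (by positivity),
      ENNReal.ofReal_mul (p := 2) (by positivity),
      ENNReal.ofReal_mul (p := Λ ^ (-ε)) hΛε, ENNReal.ofReal_toReal hM, ENNReal.ofReal_natCast,
      ENNReal.ofReal_ofNat]
    gcongr
    exact Nat.lt_succ_iff.1 hi
  have hsum : ∫⁻ ω, ENNReal.ofReal ((γ : ℝ) * ∑ i ∈ Finset.range (K + 1), ‖stopErr Rad γ ω b i‖)
      ∂(occLaw (chainLaw ν (P γ)) n) ≤ ENNReal.ofReal (γ * ((K + 1 : ℕ) * D)) := by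
    have h1 : ∀ ω : ℕ → EuclideanSpace ℝ (Fin N),
        ENNReal.ofReal ((γ : ℝ) * ∑ i ∈ Finset.range (K + 1), ‖stopErr Rad γ ω b i‖) =
        ENNReal.ofReal γ * ∑ i ∈ Finset.range (K + 1), ENNReal.ofReal ‖stopErr Rad γ ω b i‖ :=
      fun ω => by
        rw [ENNReal.ofReal_mul hγ.le, ENNReal.ofReal_sum_of_nonneg fun _ _ => norm_nonneg _]
    simp only [h1]
    rw [lintegral_const_mul' _ _ ENNReal.ofReal_ne_top, lintegral_finsetSum _ fun i _ => hm i,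
      ENNReal.ofReal_mul hγ.le, ENNReal.ofReal_mul (Nat.cast_nonneg _), ENNReal.ofReal_natCast]
    gcongr
    refine (Finset.sum_le_card_nsmul _ _ (ENNReal.ofReal D) fun i hi =>
      hterm i (Finset.mem_range.1 hi)).trans (le_of_eq ?_)
    simp
  refine hsum.trans (ENNReal.ofReal_le_ofReal (le_trans ?_ hγη))
  -- With `K` of order `T / γ` steps, the martingale contribution `γ * √K` is at most `√(T * γ)` and
  -- hence vanishes.
  have h2 : √(K : ℝ) * γ = √(K * γ * γ) := by
    rw [mul_assoc, Real.sqrt_mul (Nat.cast_nonneg K), Real.sqrt_mul_self hγ.le]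
  have hD' : D ≤ 2 * Λ * √(T * γ) + T * (2 * (Λ ^ (-ε) * M.toReal)) := by
    have h3 : √(K : ℝ) * γ ≤ √(T * γ) := by
      rw [h2]; exact Real.sqrt_le_sqrt (mul_le_mul_of_nonneg_right hKT hγ.le)
    have h4 : D = 2 * Λ * (√(K : ℝ) * γ) + (K * γ) * (2 * (Λ ^ (-ε) * M.toReal)) := by
      rw [hD]; ring
    rw [h4]
    gcongr
  have hD0 : 0 ≤ D := by positivity
  calc (γ : ℝ) * ((K + 1 : ℕ) * D) = (K * γ + γ) * D := by push_cast; ring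
    _ ≤ (T + |γ₀|) * D := by
        gcongr
        exact γ.2.2.le.trans (le_abs_self _)
    _ ≤ _ := mul_le_mul_of_nonneg_left hD' hγ₀

end Drift

/-! ### Good sample paths and limit points of the averaged flow. -/

section LimitPoints

variable {N : ℕ} {Ξ : Type*} [MeasurableSpace Ξ] {γ₀ : ℝ} {μ : Measure Ξ} [IsProbabilityMeasure μ]
  {P : Ioo (0 : ℝ) γ₀ → Kernel (EuclideanSpace ℝ (Fin N)) (EuclideanSpace ℝ (Fin N))}
  {h : Ioo (0 : ℝ) γ₀ → Ξ → EuclideanSpace ℝ (Fin N) → EuclideanSpace ℝ (Fin N)}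
  {H : Ξ → EuclideanSpace ℝ (Fin N) → Set (EuclideanSpace ℝ (Fin N))}

lemma mem_limitSet_of_tendsto {E : Type*} [NormedAddCommGroup E] {x : C(ℝ≥0, E)} {t : ℕ → ℝ≥0}
    (ht : Tendsto t atTop atTop) {z : E} (hz : Tendsto (fun i => x (t i)) atTop (𝓝 z)) :
    z ∈ limitSet x := by
  refine mem_iInter.2 fun s => mem_closure_of_tendsto hz ?_
  filter_upwards [ht.eventually_ge_atTop s] with i hi
  exact mem_image_of_mem x hi

/-- Good paths, along which long block averages are close to each other and which deviate little
from the mean drift, produce a limit point of an averaged solution. -/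
lemma RM.exists_limit_point (hRM : RM μ P h H) {Rad : ℝ → ℝ} (hRad : Monotone Rad) {r : ℝ}
    (hbound : ∀ a, ‖a‖ ≤ r → ∀ x ∈ solutions (fun x => selectionIntegral μ (fun s => H s x)) a,
      ∀ t : ℝ≥0, ‖x t‖ + 1 ≤ Rad (t - 1))
    (γ : ℕ → Ioo (0 : ℝ) γ₀) (hγ : Tendsto (fun k => (γ k : ℝ)) atTop (𝓝 0))
    (ω : ℕ → ℕ → EuclideanSpace ℝ (Fin N)) (h0 : ∀ k, ‖ω k 0‖ ≤ r)
    (herr : ∀ k, ∀ i < k, (γ k : ℝ) * ∑ l ∈ Finset.range (⌊i / (γ k : ℝ)⌋₊ + 1),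
      ‖stopErr Rad (γ k) (ω k) (meanDrift μ h (γ k)) l‖ ≤ 1 / ((i : ℝ) + 1))
    {a : ℕ → ℕ} (ha : StrictMono a) (ha0 : 0 < a 0) {δ : ℝ}
    (hclose : ∀ k, ∀ i < k, ‖blockAvg (a i * ⌈(γ k : ℝ)⁻¹⌉₊) (ω k) -
      blockAvg (a (i + 1) * ⌈(γ k : ℝ)⁻¹⌉₊) (ω k)‖ ≤ δ / 2 / 2 ^ i)
    {d : EuclideanSpace ℝ (Fin N) → ℝ} (hlip : LipschitzWith 1 d) {c : ℝ}
    (hd : ∀ k, c ≤ d (blockAvg (a 0 * ⌈(γ k : ℝ)⁻¹⌉₊) (ω k))) :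
    ∃ z ∈ flowLimitSet (averFlow (solutions (fun x => selectionIntegral μ (fun s => H s x)))),
      c - δ ≤ d z := by
  have herr' : ∀ T : ℕ, Tendsto (fun k => (γ k : ℝ) * ∑ i ∈ Finset.range (⌊T / (γ k : ℝ)⌋₊ + 1),
      ‖stopErr Rad (γ k) (ω k) (meanDrift μ h (γ k)) i‖) atTop (𝓝 0) := by
    intro T
    rw [← tendsto_add_atTop_iff_nat 1]
    refine squeeze_zero' (Eventually.of_forall fun k => mul_nonneg (γ _).2.1.le
      (Finset.sum_nonneg fun _ _ => norm_nonneg _)) ?_ tendsto_one_div_add_atTop_nhds_zero_nat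
    filter_upwards [eventually_ge_atTop T] with k hk
    -- The error increases with the horizon, so for fixed `T` the bound at the moving horizon `k ≥
    -- T` applies and tends to zero.
    refine le_trans ?_ (herr (k + 1) k k.lt_succ_self)
    refine mul_le_mul_of_nonneg_left ?_ (γ _).2.1.le
    refine Finset.sum_le_sum_of_subset_of_nonneg ?_ fun _ _ _ => norm_nonneg _
    refine Finset.range_mono (Nat.succ_le_succ (Nat.floor_le_floor ?_))
    exact div_le_div_of_nonneg_right (by exact_mod_cast hk) (γ _).2.1.le
  obtain ⟨φ, hφ, b, x, hx, hlim⟩ :=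
    hRM.exists_solution_tendsto_blockAvg hRad hbound γ hγ ω h0 herr'
  have hapos : ∀ i, 0 < a i := fun i => ha0.trans_le (ha.monotone (Nat.zero_le i))
  have hdist : ∀ i, dist (aver x (a i)) (aver x (a (i + 1))) ≤ δ / 2 / 2 ^ i := by
    intro i
    rw [dist_eq_norm]
    refine le_of_tendsto ((hlim _ (hapos i)).sub (hlim _ (hapos (i + 1)))).norm ?_
    filter_upwards [eventually_gt_atTop i] with k hk
    exact hclose _ i (hk.trans_le (hφ.id_le k))
  obtain ⟨z, hz⟩ := cauchySeq_tendsto_of_complete (cauchySeq_of_le_geometric_two hdist)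
  refine ⟨z, mem_iUnion.2 ⟨b, mem_iUnion₂.2 ⟨aver x, mem_image_of_mem _ hx, ?_⟩⟩, ?_⟩
  · exact mem_limitSet_of_tendsto (tendsto_natCast_atTop_atTop.comp ha.tendsto_atTop) hz
  · have h1 : c ≤ d (aver x (a 0)) :=
      ge_of_tendsto ((hlip.continuous.tendsto _).comp ((hlim _ ha0)))
        (Eventually.of_forall fun k => hd (φ k))
    have h2 := dist_le_of_le_geometric_two_of_tendsto₀ hdist hz
    have h3 := hlip.dist_le_mul (aver x (a 0)) z
    rw [NNReal.coe_one, one_mul, Real.dist_eq] at h3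
    linarith [le_abs_self (d (aver x (a 0)) - d z)]

lemma exists_strictMono_ge (f : ℕ → ℕ) : ∃ a : ℕ → ℕ, StrictMono a ∧ 0 < a 0 ∧ ∀ i, f i ≤ a i := by
  refine ⟨fun i => ∑ l ∈ Finset.range (i + 1), (f l + 1), strictMono_nat_of_lt_succ fun i => ?_,
    by simp, fun i => ?_⟩
  · rw [Finset.sum_range_succ _ (i + 1)]; omega
  · simp only
    rw [Finset.sum_range_succ]; omega

/-- If the mean cost of the Cesàro means does not vanish, then the cost does not vanish on the
limit set of the averaged flow. -/
lemma RM.exists_pos_of_lintegral_cesaro_ge [∀ γ, IsMarkovKernel (P γ)] (hRM : RM μ P h H)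
    (ν : Measure (EuclideanSpace ℝ (Fin N))) [IsProbabilityMeasure ν]
    {d : EuclideanSpace ℝ (Fin N) → ℝ} (hd0 : ∀ x, 0 ≤ d x) (hconv : ConvexOn ℝ univ d)
    (hlip : LipschitzWith 1 d) (γ : ℕ → Ioo (0 : ℝ) γ₀)
    (hγ : Tendsto (fun j => (γ j : ℝ)) atTop (𝓝 0)) (n : ℕ → ℕ)
    (hn : Tendsto (fun j => (γ j : ℝ) * ((n j : ℝ) + 1)) atTop atTop)
    (htail : ∀ η : ℝ, 0 < η → ∃ L, 0 ≤ L ∧ ∀ j, ∀ i ≤ n j,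
      ∫⁻ ω, ENNReal.ofReal ‖ω i - trunc L (ω i)‖ ∂(occLaw (chainLaw ν (P (γ j))) (n j)) ≤
        ENNReal.ofReal η)
    {δ : ℝ} (hδ : 0 < δ) (hge : ∀ j, ENNReal.ofReal δ ≤
      ∫⁻ ω, ENNReal.ofReal (d (cesaro (n j) ω)) ∂(chainLaw ν (P (γ j)))) :
    ∃ z ∈ flowLimitSet (averFlow (solutions (fun x => selectionIntegral μ (fun s => H s x)))),
      0 < d z := by
  set Q : ℕ → Measure (ℕ → EuclideanSpace ℝ (Fin N)) := fun j =>
    occLaw (chainLaw ν (P (γ j))) (n j) with hQ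
  set κ : ℕ → ℕ := fun j => ⌈(γ j : ℝ)⁻¹⌉₊ with hκdef
  have hκpos : ∀ j, 0 < κ j := fun j => Nat.ceil_pos.2 (inv_pos.2 (γ j).2.1)
  have hκ : Tendsto (fun j => (κ j : ℝ) / ((n j : ℝ) + 1)) atTop (𝓝 0) := by
    have h1 : Tendsto (fun j => (1 + γ₀) * ((γ j : ℝ) * ((n j : ℝ) + 1))⁻¹) atTop (𝓝 0) := by
      simpa using hn.inv_tendsto_atTop.const_mul (1 + γ₀)
    refine squeeze_zero (fun j => by positivity) (fun j => ?_) h1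
    have hp : (0 : ℝ) < γ j := (γ j).2.1
    have h2 : (κ j : ℝ) < (γ j : ℝ)⁻¹ + 1 := Nat.ceil_lt_add_one (inv_nonneg.2 hp.le)
    have h3 : (1 : ℝ) ≤ γ₀ * (γ j : ℝ)⁻¹ := by
      rw [← div_eq_mul_inv, one_le_div hp]; exact (γ j).2.2.le
    rw [mul_inv, ← mul_assoc, div_eq_mul_inv]
    gcongr
    linarith
  -- The ergodic estimates hold along an ultrafilter, and so do finitely many of them together with
  -- `j ≥ k`; this is all the diagonal selection below needs.
  obtain ⟨𝒰, h𝒰⟩ := Ultrafilter.exists_le (atTop : Filter ℕ)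
  -- the mean cost of the block averages
  obtain ⟨L, hL, hLtail⟩ := htail (δ / 16) (by positivity)
  have hsmall : ∀ a : ℕ, ∀ᶠ j in 𝒰, a * κ j ≤ n j + 1 ∧
      ((n j : ℝ) + 1)⁻¹ * (2 * (a * κ j : ℕ) * L) < δ / 16 := by
    intro a
    have h1 : Tendsto (fun j => a * ((κ j : ℝ) / ((n j : ℝ) + 1))) 𝒰 (𝓝 0) := by
      simpa using (hκ.mono_left h𝒰).const_mul (a : ℝ)
    have h2 : Tendsto (fun j => 2 * L * (a * ((κ j : ℝ) / ((n j : ℝ) + 1)))) 𝒰 (𝓝 0) := by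
      simpa using h1.const_mul (2 * L)
    filter_upwards [h1.eventually (gt_mem_nhds zero_lt_one),
      h2.eventually (gt_mem_nhds (by positivity : 0 < δ / 16))] with j hj hj2
    rw [← mul_div_assoc, div_lt_one (by positivity)] at hj
    refine ⟨by exact_mod_cast hj.le, lt_of_eq_of_lt ?_ hj2⟩
    push_cast
    field_simp
  have hblock : ∀ a : ℕ, 0 < a → ∀ᶠ j in 𝒰, a * κ j ≤ n j + 1 ∧ ENNReal.ofReal (3 * δ / 4) ≤
      ∫⁻ ω, ENNReal.ofReal (d (blockAvg (a * κ j) ω)) ∂(Q j) := by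
    intro a ha
    filter_upwards [hsmall a] with j ⟨hj1, hj2⟩
    refine ⟨hj1, ?_⟩
    have h1 := (hge j).trans (lintegral_cesaro_le _ hd0 hconv hlip hL (n := n j)
      (mul_pos ha (hκpos j)) fun i hi => hLtail j i (by omega))
    by_contra! hcon
    refine h1.not_gt ?_
    calc _ < ENNReal.ofReal (3 * δ / 4) + 2 * ENNReal.ofReal (δ / 16) +
          ENNReal.ofReal (δ / 16) := by
          refine ENNReal.add_lt_add_of_lt_of_le (by finiteness) ?_ (ENNReal.ofReal_le_ofReal hj2.le)
          exact ENNReal.add_lt_add_right (by finiteness) hcon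
      _ ≤ ENNReal.ofReal δ := by
          rw [← ENNReal.ofReal_ofNat 2, ← ENNReal.ofReal_mul (by norm_num),
            ← ENNReal.ofReal_add (by positivity) (by positivity),
            ← ENNReal.ofReal_add (by positivity) (by positivity)]
          exact ENNReal.ofReal_le_ofReal (by linarith)
  -- `q` is the allowed mass of the bad set: the cost is at most `d 0 + L` plus a tail of mean at
  -- most `δ / 16`, so the bad set carries at most `δ / 8 + δ / 16` of the mean `3δ / 4`. More than
  -- `δ / 2` is left for the good paths.
  set q : ℝ := δ / (8 * (d 0 + L + 1)) with hq
  have hd0L : 0 < d 0 + L + 1 := by linarith [hd0 0]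
  have hqpos : 0 < q := by positivity
  have hqle : (d 0 + L) * q ≤ δ / 8 := by
    rw [hq, ← mul_div_assoc, div_le_div_iff₀ (by positivity) (by norm_num)]
    nlinarith
  -- the first value
  obtain ⟨L₀, hL₀, hL₀tail⟩ := htail (q / 2) (by positivity)
  set r : ℝ := L₀ + 1 with hr
  have hinit : ∀ j, Q j {ω | r < ‖ω 0‖} ≤ ENNReal.ofReal (q / 2) := by
    intro j
    have hm : Measurable fun ω : ℕ → EuclideanSpace ℝ (Fin N) => ‖ω 0 - trunc L₀ (ω 0)‖ :=
      ((measurable_pi_apply 0).sub ((measurable_trunc L₀).comp (measurable_pi_apply 0))).norm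
    refine (measure_mono fun ω hω => ?_).trans
      (measure_ge_le_of_lintegral_le (Q j) hm zero_lt_one (q := q / 2) ?_)
    · have h1 := norm_sub_norm_le (ω 0) (trunc L₀ (ω 0))
      have h2 := norm_trunc_le hL₀ (ω 0)
      have h3 : r < ‖ω 0‖ := hω
      change 1 ≤ ‖ω 0 - trunc L₀ (ω 0)‖
      linarith
    · rw [one_mul]; exact hL₀tail j 0 (Nat.zero_le _)
  obtain ⟨Rad, hRad, hbound⟩ := hRM.exists_radius r
  -- Half of `q` is spent on the initial value; each of the two countable families of bad events
  -- receives a quarter, distributed summably.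
  obtain ⟨q', hq'pos, hq'sum⟩ := ENNReal.exists_pos_sum_of_countable
    (ENNReal.ofReal_pos.2 (by positivity : 0 < q / 4)).ne' ℕ
  -- consecutive block averages
  have hq'R : ∀ i, (0 : ℝ) < q' i := fun i => hq'pos i
  -- The `L¹` tolerance is, up to the factor `3` of the ergodic lemma, the desired distance times
  -- the allowed probability, as Markov's inequality demands.
  choose f hf using fun i : ℕ => exists_forall_lintegral_blockAvg_sub_le 𝒰 h𝒰
    (fun j => chainLaw ν (P (γ j))) n κ hκ (δ := δ / 8 / 2 / 2 ^ i * q' i / 3)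
    (by have := hq'R i; positivity) (htail _ (by have := hq'R i; positivity))
  obtain ⟨a, ha, ha0, hfa⟩ := exists_strictMono_ge f
  have hclose : ∀ i, ∀ᶠ j in 𝒰, Q j {ω | δ / 8 / 2 / 2 ^ i ≤
      ‖blockAvg (a i * κ j) ω - blockAvg (a (i + 1) * κ j) ω‖} ≤ q' i := by
    intro i
    filter_upwards [hf i (a i) (hfa i) (a (i + 1)) ((hfa i).trans (ha i.lt_succ_self).le)] with j hj
    have hm : Measurable fun ω : ℕ → EuclideanSpace ℝ (Fin N) =>
        ‖blockAvg (a i * κ j) ω - blockAvg (a (i + 1) * κ j) ω‖ :=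
      ((measurable_blockAvg _).sub (measurable_blockAvg _)).norm
    have h1 := measure_ge_le_of_lintegral_le (Q j) hm (c := δ / 8 / 2 / 2 ^ i) (q := q' i)
      (by positivity) (hj.trans (le_of_eq (by congr 1; ring)))
    rwa [ENNReal.ofReal_coe_nnreal] at h1
  -- deviations from the mean drift
  set err : ℕ → ℕ → (ℕ → EuclideanSpace ℝ (Fin N)) → ℝ := fun i j ω =>
    (γ j : ℝ) * ∑ l ∈ Finset.range (⌊i / (γ j : ℝ)⌋₊ + 1),
      ‖stopErr Rad (γ j) ω (meanDrift μ h (γ j)) l‖ with herr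
  have hγ' : Tendsto γ atTop (comap Subtype.val (𝓝 0)) := tendsto_comap_iff.2 hγ
  have hdev : ∀ i : ℕ, ∀ᶠ j in 𝒰, Q j {ω | 1 / ((i : ℝ) + 1) ≤ err i j ω} ≤ q' i := by
    intro i
    have h1 := hRM.eventually_lintegral_stopErr_le ν hRad i
      (η := 1 / ((i : ℝ) + 1) * q' i) (by have := hq'R i; positivity)
    filter_upwards [h𝒰 (hγ'.eventually h1)] with j hj
    have hm : Measurable (err i j) := (Finset.measurable_sum _ fun l _ =>
      (measurable_stopErr Rad (γ j) (hRM.measurable_meanDrift (γ j)) l).norm).const_mul _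
    have h1 := measure_ge_le_of_lintegral_le (Q j) hm (c := 1 / ((i : ℝ) + 1)) (q := q' i)
      (by positivity) (hj (n j))
    rwa [ENNReal.ofReal_coe_nnreal] at h1
  -- selection of good paths
  have hgood : ∀ k : ℕ, ∀ᶠ j in 𝒰, k ≤ j ∧ ∃ ω, ‖ω 0‖ ≤ r ∧ δ / 2 ≤ d (blockAvg (a 0 * κ j) ω) ∧
      ∀ i < k, err i j ω ≤ 1 / ((i : ℝ) + 1) ∧
        ‖blockAvg (a i * κ j) ω - blockAvg (a (i + 1) * κ j) ω‖ ≤ δ / 8 / 2 / 2 ^ i := by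
    intro k
    filter_upwards [h𝒰 (eventually_ge_atTop k), hblock (a 0) ha0,
      (Filter.eventually_all_finset (Finset.range k)).2 fun i _ => hclose i,
      (Filter.eventually_all_finset (Finset.range k)).2 fun i _ => hdev i] with j hj hb hc he
    refine ⟨hj, ?_⟩
    set B1 : ℕ → Set (ℕ → EuclideanSpace ℝ (Fin N)) := fun i => {ω | δ / 8 / 2 / 2 ^ i ≤
      ‖blockAvg (a i * κ j) ω - blockAvg (a (i + 1) * κ j) ω‖}
    set B2 : ℕ → Set (ℕ → EuclideanSpace ℝ (Fin N)) := fun i => {ω | 1 / ((i : ℝ) + 1) ≤ err i j ω}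
    have hsum : ∑ i ∈ Finset.range k, (q' i : ℝ≥0∞) ≤ ENNReal.ofReal (q / 4) :=
      (ENNReal.sum_le_tsum _).trans hq'sum.le
    have hB : Q j ({ω | r < ‖ω 0‖} ∪ ((⋃ i ∈ Finset.range k, B1 i) ∪ ⋃ i ∈ Finset.range k, B2 i)) ≤
        ENNReal.ofReal q := by
      calc _ ≤ ENNReal.ofReal (q / 2) + (ENNReal.ofReal (q / 4) + ENNReal.ofReal (q / 4)) := by
            refine (measure_union_le _ _).trans (add_le_add (hinit j)
              ((measure_union_le _ _).trans (add_le_add ?_ ?_)))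
            · exact (measure_biUnion_finset_le _ _).trans ((Finset.sum_le_sum hc).trans hsum)
            · exact (measure_biUnion_finset_le _ _).trans ((Finset.sum_le_sum he).trans hsum)
        _ = ENNReal.ofReal q := by
            rw [← ENNReal.ofReal_add (by positivity) (by positivity),
              ← ENNReal.ofReal_add (by positivity) (by positivity)]
            congr 1; ring
    obtain ⟨ω, hωB, hω⟩ := exists_notMem_lt_of_lt_lintegral (Q j)
      (f := fun ω => ENNReal.ofReal (d (blockAvg (a 0 * κ j) ω)))
      (g := fun ω => ENNReal.ofReal (tailAvg L (a 0 * κ j) ω)) (C := ENNReal.ofReal (d 0 + L))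
      (e := ENNReal.ofReal (δ / 16)) (s := ENNReal.ofReal (δ / 2))
      (measurable_tailAvg L _).ennreal_ofReal (fun ω => by
        rw [← ENNReal.ofReal_add (add_nonneg (hd0 0) hL) (tailAvg_nonneg _ _ _)]
        refine ENNReal.ofReal_le_ofReal ?_
        have h1 := norm_blockAvg_le_add_tailAvg hL (a 0 * κ j) ω
        have h2 := hlip.dist_le_mul (blockAvg (a 0 * κ j) ω) 0
        rw [NNReal.coe_one, one_mul, Real.dist_eq, dist_zero_right] at h2
        linarith [le_abs_self (d (blockAvg (a 0 * κ j) ω) - d 0)])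
      hB (lintegral_tailAvg_le _ L _ fun i hi => hLtail j i (by omega)) (by
        refine lt_of_lt_of_le ?_ hb.2
        rw [← ENNReal.ofReal_mul (add_nonneg (hd0 0) hL),
          ← ENNReal.ofReal_add (by positivity)
            (mul_nonneg (add_nonneg (hd0 0) hL) hqpos.le),
          ← ENNReal.ofReal_add (add_nonneg (by positivity)
            (mul_nonneg (add_nonneg (hd0 0) hL) hqpos.le)) (by positivity)]
        exact (ENNReal.ofReal_lt_ofReal_iff (by positivity)).2 (by linarith))
    simp only [mem_union, mem_iUnion, not_or, not_exists, Finset.mem_range] at hωB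
    refine ⟨ω, not_lt.1 hωB.1, (ENNReal.ofReal_lt_ofReal_iff'.1 hω).1.le, fun i hi => ?_⟩
    exact ⟨(not_le.1 (hωB.2.2 i hi)).le, (not_le.1 (hωB.2.1 i hi)).le⟩
  -- The `k`-th path satisfies only the first `k` requirements, which suffices for the limit. The
  -- point obtained has cost at least `δ / 2 - δ / 8`.
  choose j hj ω hω0 hωd hω using fun k => (hgood k).exists
  obtain ⟨z, hz, hdz⟩ := hRM.exists_limit_point hRad hbound (fun k => γ (j k))
    (hγ.comp (tendsto_atTop_mono hj tendsto_id)) ω hω0 (fun k i hi => (hω k i hi).1) ha ha0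
    (fun k i hi => (hω k i hi).2) hlip hωd
  exact ⟨z, hz, lt_of_lt_of_le (by linarith) hdz⟩

end LimitPoints

lemma convexOn_infDist {E : Type*} [NormedAddCommGroup E] [NormedSpace ℝ E] {S : Set E}
    (hS : Convex ℝ S) (hne : S.Nonempty) : ConvexOn ℝ univ fun x => Metric.infDist x S := by
  refine ⟨convex_univ, fun x _ y _ a b ha hb hab => le_of_forall_pos_le_add fun ε hε => ?_⟩
  obtain ⟨u, hu, hxu⟩ := (Metric.infDist_lt_iff hne).1 (lt_add_of_pos_right (Metric.infDist x S) hε)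
  obtain ⟨v, hv, hyv⟩ := (Metric.infDist_lt_iff hne).1 (lt_add_of_pos_right (Metric.infDist y S) hε)
  calc Metric.infDist (a • x + b • y) S ≤ dist (a • x + b • y) (a • u + b • v) :=
        Metric.infDist_le_dist_of_mem (hS hu hv ha hb hab)
    _ ≤ dist (a • x) (a • u) + dist (b • y) (b • v) := dist_add_add_le _ _ _ _
    _ = a * dist x u + b * dist y v := by
        rw [dist_smul₀, dist_smul₀, Real.norm_of_nonneg ha, Real.norm_of_nonneg hb]
    _ ≤ a * (Metric.infDist x S + ε) + b * (Metric.infDist y S + ε) := by gcongr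
    _ = a • Metric.infDist x S + b • Metric.infDist y S + ε := by
        simp only [smul_eq_mul]; linear_combination ε * hab

/-! ### The double limit for convex costs. -/

section AverageCost

variable {N : ℕ} {Ξ : Type*} [MeasurableSpace Ξ] {γ₀ : ℝ} {μ : Measure Ξ}
  {P : Ioo (0 : ℝ) γ₀ → Kernel (EuclideanSpace ℝ (Fin N)) (EuclideanSpace ℝ (Fin N))}
  [∀ γ, IsMarkovKernel (P γ)]
  {h : Ioo (0 : ℝ) γ₀ → Ξ → EuclideanSpace ℝ (Fin N) → EuclideanSpace ℝ (Fin N)}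
  {H : Ξ → EuclideanSpace ℝ (Fin N) → Set (EuclideanSpace ℝ (Fin N))}
  {V ψ : EuclideanSpace ℝ (Fin N) → ℝ} {α β : Ioo (0 : ℝ) γ₀ → ℝ}

lemma PH.integrable_cesaro (hPH : PH P V ψ α β)
    (ν : Measure (EuclideanSpace ℝ (Fin N))) [IsProbabilityMeasure ν] (hν : Integrable V ν)
    (hψ : Tendsto (fun a => ψ a / ‖a‖) (Bornology.cobounded _) atTop) (γ : Ioo (0 : ℝ) γ₀) (n : ℕ) :
    Integrable (cesaro n) (chainLaw ν (P γ)) := by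
  obtain ⟨L, hL, hLψ⟩ := exists_norm_sub_trunc_le hPH.psi_nonneg hψ zero_lt_one
  have hk : ∀ k, Integrable (fun ω : ℕ → EuclideanSpace ℝ (Fin N) => ω k) (chainLaw ν (P γ)) := by
    intro k
    refine Integrable.mono' ((integrable_const L).add
      (integrable_psi_chainLaw ν (P γ) hPH.measurable_V hPH.measurable_psi hPH.V_nonneg
        hPH.psi_nonneg (hPH.alpha_pos γ) (hPH.lyapunov γ) hν k))
      (measurable_pi_apply k).aestronglyMeasurable (Eventually.of_forall fun ω => ?_)
    have h1 := hLψ (ω k)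
    have h2 := norm_trunc_le hL (ω k)
    have h3 := norm_sub_norm_le (ω k) (trunc L (ω k))
    simp only [Pi.add_apply]
    linarith
  have hs : Integrable (fun ω => ∑ k ∈ Finset.range (n + 1), ω k) (chainLaw ν (P γ)) :=
    integrable_finsetSum _ fun k _ => hk k
  exact hs.smul (((n : ℝ) + 1)⁻¹)

/-- Boundedness of `β / α` makes the occupation bound on `ψ` the same for every step size, so a
single truncation radius serves all `γ`. -/
lemma PH.exists_tail_bound (hPH : PH P V ψ α β)
    (ν : Measure (EuclideanSpace ℝ (Fin N))) [IsProbabilityMeasure ν] (hν : Integrable V ν)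
    (hψ : Tendsto (fun a => ψ a / ‖a‖) (Bornology.cobounded _) atTop) {η : ℝ} (hη : 0 < η) :
    ∃ L, 0 ≤ L ∧ ∀ γ (n : ℕ), ∫ x, V x ∂ν ≤ α γ * (n + 1) → ∀ i ≤ n,
      ∫⁻ ω, ENNReal.ofReal ‖ω i - trunc L (ω i)‖ ∂(occLaw (chainLaw ν (P γ)) n) ≤
        ENNReal.ofReal η := by
  obtain ⟨c, hc⟩ := hPH.ratio_bounded
  have hβ : ∀ γ, β γ ≤ α γ * max c 0 := fun γ => by
    have h1 : β γ / α γ ≤ c := hc (mem_range_self γ)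
    rw [div_le_iff₀ (hPH.alpha_pos γ)] at h1
    nlinarith [hPH.alpha_pos γ, le_max_left c 0]
  set K : ℝ := 1 + 2 * max c 0 with hK
  have hK0 : 0 < K := by positivity
  obtain ⟨L, hL, hLψ⟩ := exists_norm_sub_trunc_le hPH.psi_nonneg hψ (div_pos hη hK0)
  refine ⟨L, hL, fun γ n hn i hi => ?_⟩
  calc _ ≤ ∫⁻ ω, ENNReal.ofReal (η / K) * ENNReal.ofReal (ψ (ω i))
        ∂(occLaw (chainLaw ν (P γ)) n) := by
        refine lintegral_mono fun ω => ?_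
        rw [← ENNReal.ofReal_mul (by positivity)]
        exact ENNReal.ofReal_le_ofReal (hLψ _)
    _ ≤ ENNReal.ofReal (η / K) * ENNReal.ofReal K := by
        rw [lintegral_const_mul' _ _ ENNReal.ofReal_ne_top]
        gcongr
        exact lintegral_psi_occLaw_le ν (P γ) hPH.measurable_V hPH.measurable_psi hPH.V_nonneg
          hPH.psi_nonneg (hPH.alpha_pos γ) (hPH.lyapunov γ) hν (le_max_right c 0) (hβ γ) hn hi
    _ = ENNReal.ofReal η := by
        rw [← ENNReal.ofReal_mul (by positivity), div_mul_cancel₀ _ hK0.ne']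

/-- A convex cost which vanishes on the limit set of the averaged flow has small mean along the
Cesàro means, in the double limit. -/
theorem RM.eventually_lintegral_cesaro_lt [IsProbabilityMeasure μ] (hRM : RM μ P h H)
    (hPH : PH P V ψ α β)
    (ν : Measure (EuclideanSpace ℝ (Fin N))) [IsProbabilityMeasure ν] (hν : Integrable V ν)
    (hψ : Tendsto (fun a => ψ a / ‖a‖) (Bornology.cobounded _) atTop)
    {d : EuclideanSpace ℝ (Fin N) → ℝ} (hd0 : ∀ x, 0 ≤ d x) (hconv : ConvexOn ℝ univ d)
    (hlip : LipschitzWith 1 d) (hd : ∀ z ∈ flowLimitSet (averFlow (solutions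
      (fun x => selectionIntegral μ (fun s => H s x)))), d z = 0) {δ : ℝ} (hδ : 0 < δ) :
    ∀ᶠ γ : Ioo (0 : ℝ) γ₀ in comap Subtype.val (𝓝 0), ∀ᶠ n in atTop,
      ∫⁻ ω, ENNReal.ofReal (d (cesaro n ω)) ∂(chainLaw ν (P γ)) < ENNReal.ofReal δ := by
  by_contra hcon
  rw [not_eventually] at hcon
  -- For each fixed `γ` the cost is large for infinitely many `n`, so `n` may also be taken large
  -- enough for `γ * (n + 1)` to exceed `j` and for the initial Lyapunov mass to be absorbed.
  have hex : ∀ j : ℕ, ∃ (γ : Ioo (0 : ℝ) γ₀) (n : ℕ), (γ : ℝ) < 1 / ((j : ℝ) + 1) ∧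
      (j : ℝ) ≤ γ * ((n : ℝ) + 1) ∧ ∫ x, V x ∂ν ≤ α γ * (n + 1) ∧ ENNReal.ofReal δ ≤
        ∫⁻ ω, ENNReal.ofReal (d (cesaro n ω)) ∂(chainLaw ν (P γ)) := by
    intro j
    have hj : (0 : ℝ) < 1 / ((j : ℝ) + 1) := by positivity
    obtain ⟨γ, hγ, hγj⟩ := (hcon.and_eventually (preimage_mem_comap (gt_mem_nhds hj))).exists
    rw [not_eventually] at hγ
    have hlim : ∀ c : ℝ, 0 < c → Tendsto (fun n : ℕ => c * ((n : ℝ) + 1)) atTop atTop := fun c hc =>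
      (tendsto_atTop_add_const_right _ _ tendsto_natCast_atTop_atTop).const_mul_atTop hc
    obtain ⟨n, hn, hn1, hn2⟩ := (hγ.and_eventually
      (((hlim γ γ.2.1).eventually_ge_atTop (j : ℝ)).and
        ((hlim (α γ) (hPH.alpha_pos γ)).eventually_ge_atTop (∫ x, V x ∂ν)))).exists
    exact ⟨γ, n, hγj, hn1, hn2, not_lt.1 hn⟩
  choose γ n hγ hn hV hge using hex
  obtain ⟨z, hz, hdz⟩ := hRM.exists_pos_of_lintegral_cesaro_ge ν hd0 hconv hlip γ
    (squeeze_zero (fun j => (γ j).2.1.le) (fun j => (hγ j).le)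
      tendsto_one_div_add_atTop_nhds_zero_nat) n
    (tendsto_atTop_mono hn tendsto_natCast_atTop_atTop)
    (fun η hη => by
      obtain ⟨L, hL, hb⟩ := hPH.exists_tail_bound ν hν hψ hη
      exact ⟨L, hL, fun j => hb (γ j) (n j) (hV j)⟩) hδ hge
  exact hdz.ne' (hd z hz)

lemma neBot_comap_nhds_zero (hγ₀ : 0 < γ₀) :
    (comap (Subtype.val : Ioo (0 : ℝ) γ₀ → ℝ) (𝓝 0)).NeBot := by
  rw [← mem_closure_iff_comap_neBot, closure_Ioo hγ₀.ne]
  exact ⟨le_rfl, hγ₀.le⟩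

end AverageCost

end StochApprox

theorem mainTheorem2 {N : ℕ} (hN : 1 ≤ N) {Ξ : Type*} [MeasurableSpace Ξ]
    (μ : Measure Ξ) [IsProbabilityMeasure μ] (γ₀ : ℝ) (hγ₀ : 0 < γ₀)
    (P : Ioo (0 : ℝ) γ₀ → Kernel (EuclideanSpace ℝ (Fin N)) (EuclideanSpace ℝ (Fin N)))
    [∀ γ, IsMarkovKernel (P γ)]
    (h : Ioo (0 : ℝ) γ₀ → Ξ → EuclideanSpace ℝ (Fin N) → EuclideanSpace ℝ (Fin N))
    (H : Ξ → EuclideanSpace ℝ (Fin N) → Set (EuclideanSpace ℝ (Fin N)))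
    (V ψ : EuclideanSpace ℝ (Fin N) → ℝ) (α β : Ioo (0 : ℝ) γ₀ → ℝ)
    (hRM : RM μ P h H) (hPH : PH P V ψ α β) (hFL : FL h)
    (Φ : EuclideanSpace ℝ (Fin N) → Set C(ℝ≥0, EuclideanSpace ℝ (Fin N)))
    (hΦ : Φ = solutions (fun x => selectionIntegral μ (fun s => H s x)))
    (hclosed : IsClosed (⋃ a, Φ a))
    (ν : Measure (EuclideanSpace ℝ (Fin N))) [IsProbabilityMeasure ν] (hν : Integrable V ν)
    (hψ : Tendsto (fun a => ψ a / ‖a‖) (Bornology.cobounded _) atTop) :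
    (∀ γ n, Integrable (cesaro n) (chainLaw ν (P γ))) ∧
    Tendsto
      (fun γ : Ioo (0 : ℝ) γ₀ => limsup (fun n : ℕ =>
        Metric.infEDist (∫ x, cesaro n x ∂(chainLaw ν (P γ)))
          (convexHull ℝ (flowLimitSet (averFlow Φ)))) atTop)
      (comap Subtype.val (𝓝 0)) (𝓝 0) ∧
    ∀ ε : ℝ, 0 < ε →
      Tendsto
        (fun γ : Ioo (0 : ℝ) γ₀ => limsup (fun n : ℕ =>
          chainLaw ν (P γ) {x | ENNReal.ofReal ε ≤
            Metric.infEDist (cesaro n x) (convexHull ℝ (flowLimitSet (averFlow Φ)))}) atTop)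
        (comap Subtype.val (𝓝 0)) (𝓝 0) := by
  subst hΦ
  have hint := hPH.integrable_cesaro ν hν hψ
  have := neBot_comap_nhds_zero hγ₀
  set S := convexHull ℝ (flowLimitSet (averFlow
    (solutions (fun x => selectionIntegral μ (fun s => H s x))))) with hS
  -- Were the limit set empty, the constant cost `1` would vanish on it vacuously, and its mean
  -- would have to drop below `1`.
  have hSne : S.Nonempty := by
    rw [hS, convexHull_nonempty_iff, nonempty_iff_ne_empty]
    intro hempty
    obtain ⟨γ, hγ⟩ := (hRM.eventually_lintegral_cesaro_lt hPH ν hν hψ (d := fun _ => 1)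
      (fun _ => zero_le_one) (convexOn_const 1 convex_univ) (LipschitzWith.const' 1)
      (fun z hz => by rw [hempty] at hz; exact absurd hz (notMem_empty z)) zero_lt_one).exists
    obtain ⟨n, hn⟩ := hγ.exists
    simp at hn
  have hdist : ∀ x, Metric.infEDist x S = ENNReal.ofReal (Metric.infDist x S) := fun x =>
    (ENNReal.ofReal_toReal (Metric.infEDist_ne_top hSne)).symm
  have hconv : ConvexOn ℝ univ fun x => Metric.infDist x S :=
    convexOn_infDist (convex_convexHull ℝ _) hSne
  have hlip : LipschitzWith 1 fun x => Metric.infDist x S := Metric.lipschitz_infDist_pt S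
  have hcost : ∀ {δ : ℝ}, 0 < δ → ∀ᶠ γ : Ioo (0 : ℝ) γ₀ in comap Subtype.val (𝓝 0),
      ∀ᶠ n in atTop, ∫⁻ ω, ENNReal.ofReal (Metric.infDist (cesaro n ω) S) ∂(chainLaw ν (P γ)) <
        ENNReal.ofReal δ := fun hδ =>
    hRM.eventually_lintegral_cesaro_lt hPH ν hν hψ (fun _ => Metric.infDist_nonneg) hconv hlip
      (fun z hz => Metric.infDist_zero_of_mem (subset_convexHull ℝ _ hz)) hδ
  refine ⟨hint, ENNReal.tendsto_nhds_zero.2 fun e he => ?_, fun ε hε =>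
    ENNReal.tendsto_nhds_zero.2 fun e he => ?_⟩
  · obtain ⟨δ, hδ0, hδ⟩ := ENNReal.lt_iff_exists_nnreal_btwn.1 he
    filter_upwards [hcost (δ := δ) (by exact_mod_cast hδ0)] with γ hγ
    refine limsup_le_of_le (by isBoundedDefault) (hγ.mono fun n hn => ?_)
    rw [ENNReal.ofReal_coe_nnreal] at hn
    refine le_trans ?_ (hn.le.trans hδ.le)
    have hdi : Integrable (fun ω => Metric.infDist (cesaro n ω) S) (chainLaw ν (P γ)) := by
      refine Integrable.mono' ((integrable_const (Metric.infDist 0 S)).add (hint γ n).norm)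
        (hlip.continuous.comp_aestronglyMeasurable (hint γ n).1) (Eventually.of_forall fun ω => ?_)
      rw [Real.norm_of_nonneg Metric.infDist_nonneg]
      have := Metric.infDist_le_infDist_add_dist (s := S) (x := cesaro n ω) (y := 0)
      rwa [dist_zero_right] at this
    rw [hdist, ← ofReal_integral_eq_lintegral_ofReal hdi
      (Eventually.of_forall fun ω => Metric.infDist_nonneg)]
    -- Jensen's inequality: the distance of the expectation to `S` is at most the expected distance,
    -- and the latter is the mean cost already shown to be small.
    exact ENNReal.ofReal_le_ofReal (hconv.map_integral_le hlip.continuous.continuousOn isClosed_univ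
      (Eventually.of_forall fun _ => mem_univ _) (hint γ n) hdi)
  · obtain ⟨δ, hδ0, hδ⟩ := ENNReal.lt_iff_exists_nnreal_btwn.1 he
    have hδR : (0 : ℝ) < δ := by exact_mod_cast hδ0
    filter_upwards [hcost (mul_pos hε hδR)] with γ hγ
    refine limsup_le_of_le (by isBoundedDefault) (hγ.mono fun n hn => ?_)
    have h1 := measure_ge_le_of_lintegral_le (chainLaw ν (P γ))
      (hlip.continuous.measurable.comp (measurable_cesaro n)) hε hn.le
    rw [ENNReal.ofReal_coe_nnreal] at h1
    refine le_trans (measure_mono fun ω hω => ?_) (h1.trans hδ.le)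
    have h2 : ENNReal.ofReal ε ≤ Metric.infEDist (cesaro n ω) S := hω
    rw [hdist] at h2
    exact (ENNReal.ofReal_le_ofReal_iff Metric.infDist_nonneg).1 h2
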